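/- Write $[z^m]f$ for Taylor coefficients at $0$, let $\mathrm{LTToep}(f)$ be the infinite lower-triangular Toeplitz matrix with $(i,j)$ entry $[z^{i-j}]f$ for $i\ge j$ and $0$ otherwise, let $\|A\|_{1\to2}$ be the supremum of the $\ell_2$ norms of the columns of $A$, and for real $\gamma,\eta$ put $$f(z;\gamma,\eta)=\frac1{\sqrt{1-z}}\Big(\frac1z\ln\frac1{1-z}\Big)^{\gamma}\Big(\frac2z\ln\Big(\frac1z\ln\frac1{1-z}\Big)\Big)^{\eta}.$$ The logarithmic matrix mechanism with parameters $\gamma<-1/2$, $\eta\in\mathbb R$ and $C>0$ outputs, at each time step $t=1,2,\dots$ of a stream $x_1,x_2,\dots$, the value $\sum_{i\le t}x_i+(Ly)_t$, where $L=\mathrm{LTToep}(f(z;-\gamma,-\eta))$, $\Delta=\|\mathrm{LTToep}(f(z;\gamma,\eta))\|_{1\to2}$, and $y_1,y_2,\dots$ are independent samples of $\mathcal N(0,C^2\Delta^2)$. There are positive numbers $C_{\varepsilon,\delta}$ ($\varepsilon,\delta>0$), depending only on $\varepsilon$ and $\delta$, with $C_{\varepsilon,\delta}=O(\varepsilon^{-1}\sqrt{\log(1/\delta)})$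 uniformly on $(0,\varepsilon_0]\times(0,\delta_0]$ for all $\varepsilon_0>0$ and $0<\delta_0<1$, and a single real-RAM streaming program (arithmetic operations, square roots and standard Gaussian samples at unit cost; integers linear in $t$; no knowledge of the length of the stream; its only real constants are natural numbers and the parameters $\gamma,\eta,C,\Delta$), such that for every $\alpha>0$ there are $\gamma<-1/2$ and $\eta\in\mathbb R$ with $\Delta<\infty$ and a constant $K$ such that for all $\varepsilon,\delta>0$, with $C=C_{\varepsilon,\delta}$: (1) the program computes the outputs of the logarithmic matrix mechanism with parameters $\gamma,\eta,C$; for every $t\ge1$ it uses at most $Kt$ memory cells through time $t$, and for every $t\ge2$ its total running time over the first $t$ steps is at most $Kt\log t$ (that is, amortized $O(\log t)$ time per step); (2) the mechanism is $(\varepsilon,\delta)$-differentially private under continual observation: for all streams $x,x'\in[0,1]^{\mathbb N}$ that differ in at most one time step, all $n$ and all measurable $E\subseteq\mathbb R^n$, the first $n$ outputs $M_n$ satisfy $\Pr[M_n(x)\in E]\le e^{\varepsilon}\Pr[M_n(x')\in E]+\delta$; (3) at every time step $t$ the noise $(Ly)_t$ is a centred Gaussian whose law does not depend on the input, with standard deviation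 at most $K\,C_{\varepsilon,\delta}\,\log^{1+\alpha}(t)$ for all $t\ge2$. -/

import Mathlib

open MeasureTheory ProbabilityTheory
open scoped NNReal ENNReal

namespace ContinualCounting

/-! ## Real-RAM programs with a step count and a space bound

A small imperative language.  A program has finitely many integer variables and finitely many
real arrays, which are addressed indirectly by integer expressions.  The real operations are the
field operations and square root; there is no rounding and there are no comparisons of reals.  The
only real constants that a program can mention are natural numbers and its real parameters. -/

/-- Integer (index) expressions.  `sub` is truncated subtraction, `div` is integer division. -/
inductive IExpr : Type
  | lit (n : ℕ)
  | var (v : ℕ)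
  | add (a b : IExpr)
  | sub (a b : IExpr)
  | mul (a b : IExpr)
  | div (a b : IExpr)

/-- The value of an integer expression when variable `v` holds `s v`. -/
def IExpr.eval (s : ℕ → ℕ) : IExpr → ℕ
  | .lit n => n
  | .var v => s v
  | .add a b => a.eval s + b.eval s
  | .sub a b => a.eval s - b.eval s
  | .mul a b => a.eval s * b.eval s
  | .div a b => a.eval s / b.eval s

/-- The number of nodes, which is the cost of one evaluation. -/
def IExpr.size : IExpr → ℕ
  | .lit _ => 1
  | .var _ => 1
  | .add a b => a.size + b.size + 1
  | .sub a b => a.size + b.size + 1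
  | .mul a b => a.size + b.size + 1
  | .div a b => a.size + b.size + 1

/-- The largest integer that occurs in the evaluation, intermediate results included. -/
def IExpr.peak (s : ℕ → ℕ) : IExpr → ℕ
  | .lit n => n
  | .var v => s v
  | .add a b => max ((IExpr.add a b).eval s) (max (a.peak s) (b.peak s))
  | .sub a b => max (a.peak s) (b.peak s)
  | .mul a b => max ((IExpr.mul a b).eval s) (max (a.peak s) (b.peak s))
  | .div a b => max (a.peak s) (b.peak s)

/-- The integer variables that occur in the expression. -/
def IExpr.vars : IExpr → Finset ℕ
  | .lit _ => ∅
  | .var v => {v}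
  | .add a b => a.vars ∪ b.vars
  | .sub a b => a.vars ∪ b.vars
  | .mul a b => a.vars ∪ b.vars
  | .div a b => a.vars ∪ b.vars

/-- Real expressions: `param k` is the `k`-th real parameter of the program, `cell a i` is the
entry of array `a` at index `i`, `ofInt i` is the integer `i` as a real number. -/
inductive RExpr : Type
  | param (k : ℕ)
  | cell (a : ℕ) (i : IExpr)
  | ofInt (i : IExpr)
  | add (x y : RExpr)
  | sub (x y : RExpr)
  | mul (x y : RExpr)
  | div (x y : RExpr)
  | sqrt (x : RExpr)

/-- The value of a real expression, for parameters `θ`, integer variables `s`, arrays `m`. -/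
noncomputable def RExpr.eval (θ : ℕ → ℝ) (s : ℕ → ℕ) (m : ℕ → ℕ → ℝ) : RExpr → ℝ
  | .param k => θ k
  | .cell a i => m a (i.eval s)
  | .ofInt i => (i.eval s : ℝ)
  | .add x y => x.eval θ s m + y.eval θ s m
  | .sub x y => x.eval θ s m - y.eval θ s m
  | .mul x y => x.eval θ s m * y.eval θ s m
  | .div x y => x.eval θ s m / y.eval θ s m
  | .sqrt x => Real.sqrt (x.eval θ s m)

/-- The number of nodes, which is the cost of one evaluation. -/
def RExpr.size : RExpr → ℕ
  | .param _ => 1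
  | .cell _ i => i.size + 1
  | .ofInt i => i.size + 1
  | .add x y => x.size + y.size + 1
  | .sub x y => x.size + y.size + 1
  | .mul x y => x.size + y.size + 1
  | .div x y => x.size + y.size + 1
  | .sqrt x => x.size + 1

/-- The largest integer that occurs in the evaluation; in particular it bounds every index at
which an array is read. -/
def RExpr.peak (s : ℕ → ℕ) : RExpr → ℕ
  | .param _ => 0
  | .cell _ i => i.peak s
  | .ofInt i => i.peak s
  | .add x y => max (x.peak s) (y.peak s)
  | .sub x y => max (x.peak s) (y.peak s)
  | .mul x y => max (x.peak s) (y.peak s)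
  | .div x y => max (x.peak s) (y.peak s)
  | .sqrt x => x.peak s

/-- The integer variables that occur in the expression. -/
def RExpr.vars : RExpr → Finset ℕ
  | .param _ => ∅
  | .cell _ i => i.vars
  | .ofInt i => i.vars
  | .add x y => x.vars ∪ y.vars
  | .sub x y => x.vars ∪ y.vars
  | .mul x y => x.vars ∪ y.vars
  | .div x y => x.vars ∪ y.vars
  | .sqrt x => x.vars

/-- The arrays that occur in the expression. -/
def RExpr.arrays : RExpr → Finset ℕ
  | .param _ => ∅
  | .cell a _ => {a}
  | .ofInt _ => ∅
  | .add x y => x.arrays ∪ y.arrays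
  | .sub x y => x.arrays ∪ y.arrays
  | .mul x y => x.arrays ∪ y.arrays
  | .div x y => x.arrays ∪ y.arrays
  | .sqrt x => x.arrays

/-- Programs.  `setInt v e` is `v := e`; `setReal a i e` is `a[i] := e`; `sample a i` puts a fresh
standard Gaussian sample into `a[i]`; `ite e₁ e₂ p q` is `if e₁ < e₂ then p else q`;
`loop e₁ e₂ p` is `while e₁ < e₂ do p`. -/
inductive Program : Type
  | skip
  | setInt (v : ℕ) (e : IExpr)
  | setReal (a : ℕ) (i : IExpr) (e : RExpr)
  | sample (a : ℕ) (i : IExpr)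
  | seq (p q : Program)
  | ite (e₁ e₂ : IExpr) (p q : Program)
  | loop (e₁ e₂ : IExpr) (p : Program)

/-- The integer variables of a program. -/
def Program.vars : Program → Finset ℕ
  | .skip => ∅
  | .setInt v e => {v} ∪ e.vars
  | .setReal _ i e => i.vars ∪ e.vars
  | .sample _ i => i.vars
  | .seq p q => p.vars ∪ q.vars
  | .ite e₁ e₂ p q => e₁.vars ∪ e₂.vars ∪ p.vars ∪ q.vars
  | .loop e₁ e₂ p => e₁.vars ∪ e₂.vars ∪ p.vars

/-- The arrays of a program. -/
def Program.arrays : Program → Finset ℕ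
  | .skip => ∅
  | .setInt _ _ => ∅
  | .setReal a _ e => {a} ∪ e.arrays
  | .sample a _ => {a}
  | .seq p q => p.arrays ∪ q.arrays
  | .ite _ _ p q => p.arrays ∪ q.arrays
  | .loop _ _ p => p.arrays

/-- The number of memory cells that a program can use if all its integers and all its array
indices are at most `S`: one per integer variable and `S + 1` per array. -/
def Program.memory (p : Program) (S : ℕ) : ℕ :=
  p.vars.card + p.arrays.card * (S + 1)

/-- Memory contents: integer variables, arrays, and the number of random samples drawn so far. -/
structure Store where
  ints : ℕ → ℕ
  arrs : ℕ → ℕ → ℝ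
  drawn : ℕ

/-- The blank memory. -/
def Store.init : Store := ⟨fun _ => 0, fun _ _ => 0, 0⟩

/-- `v := n`. -/
def Store.putInt (σ : Store) (v n : ℕ) : Store :=
  { σ with ints := Function.update σ.ints v n }

/-- `a[i] := r`. -/
def Store.putReal (σ : Store) (a i : ℕ) (r : ℝ) : Store :=
  { σ with arrs := Function.update σ.arrs a (Function.update (σ.arrs a) i r) }

/-- `a[i]` receives the next sample of the random tape `ω`. -/
def Store.draw (σ : Store) (ω : ℕ → ℝ) (a i : ℕ) : Store :=
  { σ.putReal a i (ω σ.drawn) with drawn := σ.drawn + 1 }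

/-- `Exec θ ω S p σ σ' τ`: with real parameters `θ` and random tape `ω`, the program `p`, started
in memory `σ`, halts in memory `σ'` after exactly `τ` unit-cost operations, and every integer that
it computes and every array index that it uses on the way is at most `S`. -/
inductive Exec (θ : ℕ → ℝ) (ω : ℕ → ℝ) (S : ℕ) : Program → Store → Store → ℕ → Prop
  | skip (σ : Store) : Exec θ ω S .skip σ σ 1
  | setInt (σ : Store) (v : ℕ) (e : IExpr) (h : e.peak σ.ints ≤ S) :
      Exec θ ω S (.setInt v e) σ (σ.putInt v (e.eval σ.ints)) (e.size + 1)
  | setReal (σ : Store) (a : ℕ) (i : IExpr) (e : RExpr)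
      (hi : i.peak σ.ints ≤ S) (he : e.peak σ.ints ≤ S) :
      Exec θ ω S (.setReal a i e) σ
        (σ.putReal a (i.eval σ.ints) (e.eval θ σ.ints σ.arrs)) (i.size + e.size + 1)
  | sample (σ : Store) (a : ℕ) (i : IExpr) (hi : i.peak σ.ints ≤ S) :
      Exec θ ω S (.sample a i) σ (σ.draw ω a (i.eval σ.ints)) (i.size + 1)
  | seq {p q : Program} {σ₁ σ₂ σ₃ : Store} {τ₁ τ₂ : ℕ}
      (hp : Exec θ ω S p σ₁ σ₂ τ₁) (hq : Exec θ ω S q σ₂ σ₃ τ₂) :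
      Exec θ ω S (.seq p q) σ₁ σ₃ (τ₁ + τ₂)
  | ite_true {e₁ e₂ : IExpr} {p q : Program} {σ σ' : Store} {τ : ℕ}
      (h₁ : e₁.peak σ.ints ≤ S) (h₂ : e₂.peak σ.ints ≤ S)
      (h : e₁.eval σ.ints < e₂.eval σ.ints) (hp : Exec θ ω S p σ σ' τ) :
      Exec θ ω S (.ite e₁ e₂ p q) σ σ' (e₁.size + e₂.size + 1 + τ)
  | ite_false {e₁ e₂ : IExpr} {p q : Program} {σ σ' : Store} {τ : ℕ}
      (h₁ : e₁.peak σ.ints ≤ S) (h₂ : e₂.peak σ.ints ≤ S)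
      (h : ¬ e₁.eval σ.ints < e₂.eval σ.ints) (hq : Exec θ ω S q σ σ' τ) :
      Exec θ ω S (.ite e₁ e₂ p q) σ σ' (e₁.size + e₂.size + 1 + τ)
  | loop_done {e₁ e₂ : IExpr} {p : Program} {σ : Store}
      (h₁ : e₁.peak σ.ints ≤ S) (h₂ : e₂.peak σ.ints ≤ S)
      (h : ¬ e₁.eval σ.ints < e₂.eval σ.ints) :
      Exec θ ω S (.loop e₁ e₂ p) σ σ (e₁.size + e₂.size + 1)
  | loop_step {e₁ e₂ : IExpr} {p : Program} {σ₁ σ₂ σ₃ : Store} {τ₁ τ₂ : ℕ}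
      (h₁ : e₁.peak σ₁.ints ≤ S) (h₂ : e₂.peak σ₁.ints ≤ S)
      (h : e₁.eval σ₁.ints < e₂.eval σ₁.ints)
      (hp : Exec θ ω S p σ₁ σ₂ τ₁) (hl : Exec θ ω S (.loop e₁ e₂ p) σ₂ σ₃ τ₂) :
      Exec θ ω S (.loop e₁ e₂ p) σ₁ σ₃ (e₁.size + e₂.size + 1 + τ₁ + τ₂)

/-! ## Streaming algorithms

Streams and output sequences are indexed from `0`: index `t` belongs to time step `t + 1`. -/

/-- The program `p` with parameters `θ`, run once per time step, is an unbounded streaming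
algorithm with output `M x ω t` at time step `t + 1`, on input stream `x` and random tape `ω`.
At each time step the new datum is put into `a₀[0]`, the program runs on the memory left by the
previous step, and the output is read off from `a₁[0]`.  Through time `t` it uses at most `K * t`
memory cells (with integers at most that large), and for `t ≥ 2` the total running time of the
first `t` steps is at most `K * t * log t`. -/
def Program.Streams (p : Program) (θ : ℕ → ℝ) (M : (ℕ → ℝ) → (ℕ → ℝ) → ℕ → ℝ) (K : ℝ) : Prop :=
  ∀ x ω : ℕ → ℝ, ∃ (σ : ℕ → Store) (S τ : ℕ → ℕ),
    σ 0 = Store.init ∧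
    (∀ t, Exec θ ω (S t) p ((σ t).putReal 0 0 (x t)) (σ (t + 1)) (τ t)) ∧
    (∀ t, (σ (t + 1)).arrs 1 0 = M x ω t) ∧
    (∀ t, (p.memory (S t) : ℝ) ≤ K * ((t : ℝ) + 1)) ∧
    (∀ t, 1 ≤ t →
      ((∑ s ∈ Finset.range (t + 1), τ s : ℕ) : ℝ) ≤
        K * (((t : ℝ) + 1) * Real.log ((t : ℝ) + 1)))

/-! ## Differential privacy under continual observation -/

/-- Two streams are neighbouring if they differ in at most one time step. -/
def Neighboring (x x' : ℕ → ℝ) : Prop := ∃ s, ∀ t, t ≠ s → x t = x' t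

/-- `(ε, δ)`-differential privacy under continual observation, for streams in `[0, 1]`, of the
mechanism with output sequence `M x ω` on the stream `x`, where `ω` has law `P`. -/
def IsContinualDP {Ω : Type*} [MeasurableSpace Ω] (P : Measure Ω)
    (M : (ℕ → ℝ) → Ω → ℕ → ℝ) (ε δ : ℝ) : Prop :=
  ∀ x x' : ℕ → ℝ, (∀ t, x t ∈ Set.Icc (0 : ℝ) 1) → (∀ t, x' t ∈ Set.Icc (0 : ℝ) 1) →
    Neighboring x x' → ∀ (n : ℕ) (E : Set (Fin n → ℝ)), MeasurableSet E →
      P {ω | (fun i : Fin n => M x ω i) ∈ E} ≤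
        ENNReal.ofReal (Real.exp ε) * P {ω | (fun i : Fin n => M x' ω i) ∈ E} +
          ENNReal.ofReal δ

/-! ## The logarithmic matrix mechanism -/

/-- The power `g ^ s = exp (s * log g)` of a power series with constant coefficient `1`. -/
noncomputable def rpowSeries (g : PowerSeries ℝ) (s : ℝ) : PowerSeries ℝ :=
  (PowerSeries.exp ℝ).subst (s • PowerSeries.logOf g)

/-- The quotient `g / z` of a power series with constant coefficient `0`. -/
noncomputable def divZ (g : PowerSeries ℝ) : PowerSeries ℝ :=
  PowerSeries.mk fun n => PowerSeries.coeff (n + 1) g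

/-- `(1 / z) * ln (1 / (1 - z))`. -/
noncomputable def logBase : PowerSeries ℝ :=
  divZ (-PowerSeries.logOf (1 - PowerSeries.X))

/-- `(2 / z) * ln ((1 / z) * ln (1 / (1 - z)))`. -/
noncomputable def logLogBase : PowerSeries ℝ :=
  (2 : ℝ) • divZ (PowerSeries.logOf logBase)

/-- The Taylor series at `0` of `f(z; γ, η) = f₁(z) f₂(z; γ) f₃(z; η)`, where
`f₁ = (1 - z) ^ (-1/2)`, `f₂ = ((1 / z) ln (1 / (1 - z))) ^ γ` and
`f₃ = ((2 / z) ln ((1 / z) ln (1 / (1 - z)))) ^ η`. -/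
noncomputable def fSeries (γ η : ℝ) : PowerSeries ℝ :=
  rpowSeries (1 - PowerSeries.X) (-1 / 2) * rpowSeries logBase γ * rpowSeries logLogBase η

/-- The infinite lower-triangular Toeplitz matrix of (the Taylor coefficients of) `f`. -/
noncomputable def ltToep (f : PowerSeries ℝ) : Matrix ℕ ℕ ℝ :=
  fun i j => if j ≤ i then PowerSeries.coeff (i - j) f else 0

/-- `‖A‖_{1 → 2}`, the supremum of the `ℓ²` norms of the columns (possibly `∞`). -/
noncomputable def colNorm (A : Matrix ℕ ℕ ℝ) : ℝ≥0∞ :=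
  ⨆ j, (∑' i, ENNReal.ofReal (A i j ^ 2)) ^ (1 / 2 : ℝ)

/-- The sensitivity `Δ = ‖R‖_{1 → 2}` of `R = LTToep(f(z; γ, η))`. -/
noncomputable def sensitivity (γ η : ℝ) : ℝ := (colNorm (ltToep (fSeries γ η))).toReal

/-- The running total of the stream, at time step `t + 1`. -/
noncomputable def partialSum (x : ℕ → ℝ) (t : ℕ) : ℝ := ∑ i ∈ Finset.range (t + 1), x i

/-- The output of the logarithmic matrix mechanism with matrix parameters `γ, η` and privacy
parameter `C`: the running total plus `(L y)_t`, where `L = LTToep(f(z; -γ, -η))` and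
`y_j = C * Δ * ω_j`, so that the `y_j` are independent with law `N(0, C² Δ²)` if the `ω_j` are
independent and standard Gaussian. -/
noncomputable def logMatrixMechanism (γ η C : ℝ) (x ω : ℕ → ℝ) (t : ℕ) : ℝ :=
  partialSum x t +
    ∑ j ∈ Finset.range (t + 1),
      ltToep (fSeries (-γ) (-η)) t j * (C * sensitivity γ η * ω j)

/-- The law of the random tape: independent standard Gaussians. -/
noncomputable def gaussianTape : Measure (ℕ → ℝ) :=
  Measure.infinitePi fun _ : ℕ => gaussianReal 0 1

/-- The real parameters handed to the program: `γ`, `η`, the privacy parameter `C`, and the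
sensitivity `Δ`. -/
noncomputable def mechanismParams (γ η C : ℝ) : ℕ → ℝ
  | 0 => γ
  | 1 => η
  | 2 => C
  | 3 => sensitivity γ η
  | _ => 0

end ContinualCounting

/-! Take `η = 0` and `γ = -1/2 - α`. Write f_s for (1 - z)^(-1/2) times the s-th power of (1/z)
ln(1/(1 - z)). Since f_s f_{-s} = 1/(1 - z), the Toeplitz matrices R of f_γ and L of f_{-γ} satisfy
LR = prefix sums, so the output is L(Rx + y): a Gaussian mechanism on Rx followed by a linear map
that does not depend on the input. Privacy thus concerns a standard Gaussian vector shifted by at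
most 1/C in norm (`stdGaussianPi_shift_le`, `exp_noiseMultiplier_le`). Finiteness of the sensitivity
and the size of the noise concern sums of squares of coefficients, and both follow from [z^n] f_s =
O(log^s n / √n) (`coeff_fSeries_sq_le`): for s < -1/2 the squares are summable, and for s = 1/2 + α
their sum up to t is O(log^(2 + 2α) t).

The coefficient bound is proved on the real axis. The series satisfies z f' = Q f with Q_n = 1/2 + s
u_n for n ≥ 1, where u_n are the coefficients of z / ((1 - z) ln(1/(1 - z))). These solve the
renewal equation ∑ u_k / (n - k + 1) = 1; they are nonnegative, decreasing (Kaluza) and at most 1 /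
log(n + 2). Hence Q_n is negative only finitely often, and passing to |Q_n| adds only a bounded
amount to Q(x) on (0, 1). The majorant series with coefficients r_n then obeys a differential
inequality, which Grönwall's argument integrates up to x = 1 - 1/n (`eulerPartial_le`). This bounds
∑_{k<n} r_k by a multiple of √n log^s n, and n r_n = ∑ |Q_{n-k}| r_k converts it into a bound on
r_n.

For the algorithm, (Ly)_t is, up to the factor CΔ, the coefficient of z^t in f_{-γ} times the series
of samples. A machine with field operations and square roots has no real powers, but the equation z
f' = Q f involves γ only as a factor. So f_{-γ} is computed by Newton iteration: a reciprocal of the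
logarithmic series, prefix sums giving Q, a variation-of-constants step for f (`newton_euler`) and a
reciprocal step for 1/f (`newton_inverse`). Products use a fast Fourier transform modulo X^n - i
whose roots of unity come from half-angle formulas; modulo X^n - i the wrapped part of a real
product is imaginary, so no padding is needed. The number of prepared noise values is doubled
whenever the time reaches it. One doubling to length n costs O(n log n), and these costs sum
geometrically. -/

namespace ContinualCounting

/-! ### Formal powers of the logarithmic series and their differential equations. -/

section FormalSeries

open PowerSeries

theorem hasSubst_sub_one {g : PowerSeries ℝ} (hg : constantCoeff g = 1) : HasSubst (g - 1) :=
  HasSubst.of_constantCoeff_zero' (by simp [hg])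

theorem hasSubst_smul_logOf {g : PowerSeries ℝ} (hg : constantCoeff g = 1) (s : ℝ) :
    HasSubst (s • logOf g) :=
  HasSubst.of_constantCoeff_zero' (by simp [constantCoeff_logOf hg])

/-- Substitute g - 1 into (1 + X) log'(1 + X) = 1 and apply the chain rule. The properties of real
powers needed below are derived from such differential equations. -/
theorem mul_derivative_logOf {g : PowerSeries ℝ} (hg : constantCoeff g = 1) :
    g * d⁄dX ℝ (logOf g) = d⁄dX ℝ g := by
  have hs := hasSubst_sub_one hg
  have key : (1 + X) * d⁄dX ℝ (PowerSeries.log ℝ) = 1 := by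
    rw [deriv_log]
    ext n
    rw [add_mul, one_mul, map_add]
    cases n with
    | zero => simp
    | succ n => rw [coeff_succ_X_mul]; simp [pow_succ]
  have h2 := congrArg (PowerSeries.subst (g - 1)) key
  rw [subst_mul hs, subst_add hs, subst_X hs] at h2
  have h1 : (1 : PowerSeries ℝ).subst (g - 1) = 1 := by
    rw [← coe_substAlgHom hs, map_one]
  rw [h1, add_sub_cancel] at h2
  rw [logOf_eq, derivative_subst hs, ← mul_assoc, h2, one_mul, map_sub, ← map_one C,
    derivative_C, sub_zero]

theorem constantCoeff_rpowSeries {g : PowerSeries ℝ} (hg : constantCoeff g = 1) (s : ℝ) :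
    constantCoeff (rpowSeries g s) = 1 := by
  have hs := hasSubst_smul_logOf hg s
  have h0 : MvPowerSeries.constantCoeff (s • logOf g : PowerSeries ℝ) = 0 := by
    have : constantCoeff (s • logOf g) = 0 := by simp [constantCoeff_logOf hg]
    exact this
  have h1 : constantCoeff ((PowerSeries.exp ℝ - 1).subst (s • logOf g)) = 0 :=
    constantCoeff_subst_eq_zero h0 _ (by simp [constantCoeff_exp])
  rw [← coe_substAlgHom hs, map_sub, map_one, map_sub, map_one, coe_substAlgHom hs] at h1
  rw [rpowSeries]
  linarith

theorem mul_derivative_rpowSeries {g : PowerSeries ℝ} (hg : constantCoeff g = 1) (s : ℝ) :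
    g * d⁄dX ℝ (rpowSeries g s) = s • d⁄dX ℝ g * rpowSeries g s := by
  have hs := hasSubst_smul_logOf hg s
  rw [rpowSeries, derivative_subst hs, derivative_exp, Derivation.map_smul,
    ← mul_derivative_logOf hg]
  simp only [smul_eq_C_mul]
  ring

theorem rpowSeries_zero (g : PowerSeries ℝ) : rpowSeries g 0 = 1 := by
  rw [rpowSeries, zero_smul, ← coe_substAlgHom (HasSubst.zero')]
  ext n
  rw [coe_substAlgHom, coeff_subst' (HasSubst.zero'), finsum_eq_single _ 0]
  · simp
  · intro d hd; simp [hd]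

/-- The geometric series `1 / (1 - X)`. -/
noncomputable def geomSeries : PowerSeries ℝ := PowerSeries.mk fun _ => 1

theorem one_sub_X_mul_geomSeries : (1 - X) * geomSeries = 1 := by
  ext n
  rw [sub_mul, one_mul, map_sub]
  cases n with
  | zero => simp [geomSeries]
  | succ n => rw [coeff_succ_X_mul]; simp [geomSeries]

theorem coeff_mul_geomSeries (f : PowerSeries ℝ) (n : ℕ) :
    coeff n (f * geomSeries) = ∑ k ∈ Finset.range (n + 1), coeff k f := by
  rw [coeff_mul, Finset.Nat.sum_antidiagonal_eq_sum_range_succ_mk]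
  simp [geomSeries]

theorem derivative_one_sub_X : d⁄dX ℝ (1 - X) = -1 := by
  rw [map_sub, ← map_one C, derivative_C, derivative_X, zero_sub, map_one]

theorem derivative_neg_logOf_one_sub_X : d⁄dX ℝ (-logOf (1 - X)) = geomSeries := by
  have h := mul_derivative_logOf (g := 1 - X) (by simp)
  rw [derivative_one_sub_X] at h
  rw [map_neg]
  calc -d⁄dX ℝ (logOf (1 - X)) = -(((1 - X) * geomSeries) * d⁄dX ℝ (logOf (1 - X))) := by
        rw [one_sub_X_mul_geomSeries, one_mul]
    _ = -(geomSeries * ((1 - X) * d⁄dX ℝ (logOf (1 - X)))) := by ring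
    _ = geomSeries := by rw [h]; ring

theorem coeff_logBase (n : ℕ) : coeff n logBase = 1 / ((n : ℝ) + 1) := by
  have h := congrArg (coeff n) derivative_neg_logOf_one_sub_X
  rw [coeff_derivative] at h
  simp only [geomSeries, coeff_mk] at h
  rw [logBase, divZ, coeff_mk]
  have : (n : ℝ) + 1 ≠ 0 := by positivity
  field_simp
  exact h

theorem constantCoeff_logBase : constantCoeff logBase = 1 := by
  rw [← coeff_zero_eq_constantCoeff_apply, coeff_logBase]; simp

theorem X_mul_logBase : X * logBase = -logOf (1 - X) := by
  ext n
  cases n with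
  | zero =>
    simp [constantCoeff_logOf]
  | succ n => rw [coeff_succ_X_mul, logBase, divZ, coeff_mk]

/-- The reciprocal of `(1 / z) * ln (1 / (1 - z))`. -/
noncomputable def recipSeries : PowerSeries ℝ := logBase⁻¹

theorem recipSeries_mul_logBase : recipSeries * logBase = 1 :=
  PowerSeries.inv_mul_cancel _ (by rw [constantCoeff_logBase]; exact one_ne_zero)

theorem constantCoeff_recipSeries : constantCoeff recipSeries = 1 := by
  have h := congrArg constantCoeff recipSeries_mul_logBase
  rwa [map_mul, constantCoeff_logBase, mul_one, map_one] at h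

/-- The series `z / ((1 - z) ln (1 / (1 - z)))`. -/
noncomputable def renewalSeries : PowerSeries ℝ := recipSeries * geomSeries

/-- The logarithmic derivative `z f' / f` of `f = (1 - z) ^ (-1/2) ((1 / z) ln (1 / (1 - z))) ^ s`. -/
noncomputable def eulerSeries (s : ℝ) : PowerSeries ℝ :=
  C (1 / 2) * (X * geomSeries) + C s * (renewalSeries - 1)

theorem fSeries_zero_right (s : ℝ) :
    fSeries s 0 = rpowSeries (1 - X) (-1 / 2) * rpowSeries logBase s := by
  rw [fSeries, rpowSeries_zero, mul_one]

theorem constantCoeff_fSeries (s : ℝ) : constantCoeff (fSeries s 0) = 1 := by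
  rw [fSeries_zero_right, map_mul, constantCoeff_rpowSeries (by simp),
    constantCoeff_rpowSeries constantCoeff_logBase, one_mul]

/-- The factor (1 - X)^(-1/2) contributes X / (2(1 - X)). The factor `logBase`^s contributes s X
`logBase`' / `logBase`, which equals s (`renewalSeries` - 1) because (X `logBase`)' = 1/(1 - X). -/
theorem X_mul_derivative_fSeries (s : ℝ) :
    X * d⁄dX ℝ (fSeries s 0) = eulerSeries s * fSeries s 0 := by
  rw [fSeries_zero_right]
  set a := rpowSeries (1 - X) (-1 / 2)
  set b := rpowSeries logBase s
  have ha : (1 - X) * d⁄dX ℝ a = (-1 / 2 : ℝ) • d⁄dX ℝ (1 - X) * a := mul_derivative_rpowSeries (by simp) _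
  have hb : logBase * d⁄dX ℝ b = s • d⁄dX ℝ logBase * b :=
    mul_derivative_rpowSeries constantCoeff_logBase _
  have hJ := one_sub_X_mul_geomSeries
  have hu := recipSeries_mul_logBase
  have hL : X * d⁄dX ℝ logBase + logBase = geomSeries := by
    have := derivative_neg_logOf_one_sub_X
    rw [← X_mul_logBase, Derivation.leibniz, derivative_X] at this
    simpa using this
  rw [derivative_one_sub_X] at ha
  simp only [smul_eq_C_mul] at ha hb
  have hC : C (-1 / 2 : ℝ) = -C (1 / 2) := by rw [← map_neg]; norm_num
  rw [hC] at ha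
  have ha' : d⁄dX ℝ a = geomSeries * (C (1 / 2) * a) := by
    linear_combination geomSeries * ha - d⁄dX ℝ a * hJ
  have hb' : d⁄dX ℝ b = recipSeries * (C s * d⁄dX ℝ logBase * b) := by
    linear_combination recipSeries * hb - d⁄dX ℝ b * hu
  rw [Derivation.leibniz, smul_eq_mul, smul_eq_mul, ha', hb', eulerSeries, renewalSeries]
  linear_combination (a * b * C s * recipSeries) * hL - (a * b * C s) * hu

/-- The quotient of two solutions has derivative zero, so it equals its constant coefficient 1. -/
theorem derivative_unique {q f g : PowerSeries ℝ} (hf : X * d⁄dX ℝ f = q * f) (hg : X * d⁄dX ℝ g = q * g)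
    (hf0 : constantCoeff f = 1) (hg0 : constantCoeff g = 1) : f = g := by
  have hne : f ≠ 0 := by rintro rfl; simp at hf0
  have hfi : f * f⁻¹ = 1 := PowerSeries.mul_inv_cancel _ (by rw [hf0]; exact one_ne_zero)
  have hd : d⁄dX ℝ (g * f⁻¹) = 0 := by
    have : X * d⁄dX ℝ (g * f⁻¹) = 0 := by
      rw [Derivation.leibniz, derivative_inv', smul_eq_mul, smul_eq_mul]
      linear_combination f⁻¹ * hg - g * f⁻¹ ^ 2 * hf - g * f⁻¹ * q * hfi
    rcases mul_eq_zero.1 this with h | h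
    · exact absurd h X_ne_zero
    · exact h
  have h1 : g * f⁻¹ = 1 := by
    refine derivative.ext (by rw [hd, ← map_one C, derivative_C]) ?_
    have := congrArg constantCoeff hfi
    rw [map_mul, hf0, one_mul] at this
    rw [map_mul, hg0, this, one_mul]
  calc f = (g * f⁻¹) * f := by rw [h1, one_mul]
    _ = g := by linear_combination g * hfi

/-- Logarithmic derivatives add: the terms in s cancel and the two halves give X/(1 - X), the
logarithmic derivative of the geometric series. This is the factorization LR of the prefix-sum
matrix. -/
theorem fSeries_mul_fSeries_neg (s : ℝ) : fSeries s 0 * fSeries (-s) 0 = geomSeries := by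
  have h1 := X_mul_derivative_fSeries s
  have h2 := X_mul_derivative_fSeries (-s)
  have hJ := one_sub_X_mul_geomSeries
  refine derivative_unique (q := X * geomSeries) ?_ ?_ ?_ ?_
  · rw [Derivation.leibniz, smul_eq_mul, smul_eq_mul]
    have hC : C (1 / 2 : ℝ) + C (1 / 2) = 1 := by rw [← map_add]; norm_num
    have hs : C (-s) = -C s := map_neg _ _
    rw [eulerSeries] at h1 h2
    rw [hs] at h2
    linear_combination fSeries s 0 * h2 + fSeries (-s) 0 * h1
      + X * geomSeries * fSeries s 0 * fSeries (-s) 0 * hC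
  · have h3 := congrArg (d⁄dX ℝ) hJ
    rw [Derivation.leibniz, derivative_one_sub_X, smul_eq_mul, smul_eq_mul, ← map_one C,
      derivative_C, map_one] at h3
    linear_combination X * geomSeries * h3 - X * d⁄dX ℝ geomSeries * hJ
  · rw [map_mul, constantCoeff_fSeries, constantCoeff_fSeries, one_mul]
  · rw [← coeff_zero_eq_constantCoeff_apply, geomSeries, coeff_mk]

/-- The reciprocal of `fSeries s 0`. -/
noncomputable def fInvSeries (s : ℝ) : PowerSeries ℝ := (fSeries s 0)⁻¹

theorem fSeries_mul_fInvSeries (s : ℝ) : fSeries s 0 * fInvSeries s = 1 :=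
  PowerSeries.mul_inv_cancel _ (by rw [constantCoeff_fSeries]; exact one_ne_zero)

/-- The partial sums of the coefficients of `recipSeries`. -/
noncomputable def renewal (n : ℕ) : ℝ := coeff n renewalSeries

theorem renewal_eq_sum (n : ℕ) :
    renewal n = ∑ k ∈ Finset.range (n + 1), coeff k recipSeries := by
  rw [renewal, renewalSeries, coeff_mul_geomSeries]

theorem renewal_zero : renewal 0 = 1 := by
  rw [renewal_eq_sum]; simp [constantCoeff_recipSeries]

theorem coeff_eulerSeries (s : ℝ) (n : ℕ) :
    coeff n (eulerSeries s) = if n = 0 then 0 else 1 / 2 + s * renewal n := by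
  rw [eulerSeries, map_add, coeff_C_mul, coeff_C_mul, map_sub, coeff_one]
  cases n with
  | zero =>
    have := renewal_zero
    rw [renewal] at this
    rw [this]; simp
  | succ n => rw [coeff_succ_X_mul]; simp [geomSeries, renewal]

/-- The renewal equation, read off from `renewalSeries * logBase = geomSeries`. -/
theorem sum_renewal (n : ℕ) :
    ∑ k ∈ Finset.range (n + 1), renewal k * (1 / (((n - k : ℕ) : ℝ) + 1)) = 1 := by
  have h : renewalSeries * logBase = geomSeries := by
    rw [renewalSeries]
    linear_combination geomSeries * recipSeries_mul_logBase
  have := congrArg (coeff n) h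
  rw [coeff_mul, Finset.Nat.sum_antidiagonal_eq_sum_range_succ_mk] at this
  simpa only [coeff_logBase, geomSeries, coeff_mk, renewal] using this

theorem coeff_fSeries_recurrence (s : ℝ) (n : ℕ) :
    (n : ℝ) * coeff n (fSeries s 0) =
      ∑ k ∈ Finset.range n, (1 / 2 + s * renewal (n - k)) * coeff k (fSeries s 0) := by
  have h := congrArg (coeff n) (X_mul_derivative_fSeries s)
  rw [mul_comm (eulerSeries s), coeff_mul n (fSeries s 0),
    Finset.Nat.sum_antidiagonal_eq_sum_range_succ_mk, Finset.sum_range_succ] at h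
  have hl : coeff n (X * d⁄dX ℝ (fSeries s 0)) = n * coeff n (fSeries s 0) := by
    cases n with
    | zero => simp
    | succ n => rw [coeff_succ_X_mul, coeff_derivative]; push_cast; ring
  rw [← hl, h, coeff_eulerSeries]
  simp only [Nat.sub_self, if_true, mul_zero, add_zero]
  refine Finset.sum_congr rfl fun k hk => ?_
  rw [Finset.mem_range] at hk
  rw [coeff_eulerSeries, if_neg (by omega), mul_comm]

end FormalSeries

/-! ### Size of the coefficients of `fSeries s 0`. -/

section Asymptotics

open PowerSeries Finset

/-- Compare the renewal equations for n and n + 1: every weight on the old terms decreases, so the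
old terms contribute less to the total 1, and the new term makes up the difference. -/
theorem renewal_nonneg (n : ℕ) : 0 ≤ renewal n := by
  induction n using Nat.strong_induction_on with
  | _ n ih =>
    cases n with
    | zero => rw [renewal_zero]; exact zero_le_one
    | succ n =>
      have h1 := sum_renewal n
      have h2 := sum_renewal (n + 1)
      rw [sum_range_succ] at h2
      have h3 : ∑ k ∈ range (n + 1), renewal k * (1 / (((n + 1 - k : ℕ) : ℝ) + 1)) ≤
          ∑ k ∈ range (n + 1), renewal k * (1 / (((n - k : ℕ) : ℝ) + 1)) := by
        refine sum_le_sum fun k hk => ?_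
        refine mul_le_mul_of_nonneg_left ?_ (ih k (mem_range.1 hk))
        refine one_div_le_one_div_of_le (by positivity) ?_
        have : n - k ≤ n + 1 - k := by omega
        have : ((n - k : ℕ) : ℝ) ≤ ((n + 1 - k : ℕ) : ℝ) := by exact_mod_cast this
        linarith
      simp only [Nat.sub_self, Nat.cast_zero, zero_add, div_one, mul_one] at h2
      linarith

theorem renewal_le_one (n : ℕ) : renewal n ≤ 1 := by
  have h := sum_renewal n
  rw [sum_range_succ] at h
  have : 0 ≤ ∑ k ∈ range n, renewal k * (1 / (((n - k : ℕ) : ℝ) + 1)) :=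
    sum_nonneg fun k _ => mul_nonneg (renewal_nonneg k) (by positivity)
  simp only [Nat.sub_self, Nat.cast_zero, zero_add, div_one, mul_one] at h
  linarith

theorem sum_coeff_recipSeries (n : ℕ) :
    ∑ k ∈ range (n + 2), coeff k recipSeries * (1 / (((n + 1 - k : ℕ) : ℝ) + 1)) = 0 := by
  have := congrArg (coeff (n + 1)) recipSeries_mul_logBase
  rw [coeff_mul, Finset.Nat.sum_antidiagonal_eq_sum_range_succ_mk] at this
  simpa [coeff_logBase, coeff_one] using this

/-- Kaluza's sign property of the reciprocal of a log-convex series. -/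
theorem coeff_recipSeries_nonpos (n : ℕ) : coeff (n + 1) recipSeries ≤ 0 := by
  induction n using Nat.strong_induction_on with
  | _ n ih =>
    have h1 := sum_coeff_recipSeries n
    rw [sum_range_succ] at h1
    simp only [Nat.sub_self, Nat.cast_zero, zero_add, div_one, mul_one] at h1
    cases n with
    | zero =>
      simp [constantCoeff_recipSeries] at h1
      norm_num at h1 ⊢
      linarith
    | succ m =>
      have h2 := sum_coeff_recipSeries m
      -- The factor (m + 2)/(m + 3) cancels the term k = 0, the only one with a positive
      -- coefficient. Log-convexity of 1/(n + 1) makes the remaining brackets nonnegative.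
      have h3 : ∑ k ∈ range (m + 2), coeff k recipSeries *
          ((((m : ℝ) + 2) / (m + 3)) * (1 / (((m + 1 - k : ℕ) : ℝ) + 1))
            - 1 / (((m + 1 + 1 - k : ℕ) : ℝ) + 1)) ≤ 0 := by
        refine sum_nonpos fun k hk => ?_
        have hk' := mem_range.1 hk
        cases k with
        | zero =>
          refine le_of_eq ?_
          simp only [Nat.sub_zero]
          push_cast
          have : (m : ℝ) + 2 ≠ 0 := by positivity
          have : (m : ℝ) + 3 ≠ 0 := by positivity
          have h : (m : ℝ) + 1 + 1 = m + 2 := by ring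
          have h' : (m : ℝ) + 2 + 1 = m + 3 := by ring
          rw [h, h']
          field_simp
          simp
        | succ k =>
          refine mul_nonpos_of_nonpos_of_nonneg (ih k (by omega)) ?_
          obtain ⟨j, rfl⟩ : ∃ j, m = k + j := ⟨m - k, by omega⟩
          have e1 : k + j + 1 - (k + 1) = j := by omega
          have e2 : k + j + 1 + 1 - (k + 1) = j + 1 := by omega
          rw [e1, e2, sub_nonneg]
          push_cast
          rw [div_mul_div_comm, div_le_div_iff₀ (by positivity) (by positivity)]
          have : (0 : ℝ) ≤ k := by positivity
          have : (0 : ℝ) ≤ j := by positivity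
          nlinarith
      have h4 : ∑ k ∈ range (m + 2), coeff k recipSeries *
          ((((m : ℝ) + 2) / (m + 3)) * (1 / (((m + 1 - k : ℕ) : ℝ) + 1))
            - 1 / (((m + 1 + 1 - k : ℕ) : ℝ) + 1)) =
          (((m : ℝ) + 2) / (m + 3)) * ∑ k ∈ range (m + 2), coeff k recipSeries *
            (1 / (((m + 1 - k : ℕ) : ℝ) + 1)) -
          ∑ k ∈ range (m + 2), coeff k recipSeries * (1 / (((m + 1 + 1 - k : ℕ) : ℝ) + 1)) := by
        rw [mul_sum, ← sum_sub_distrib]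
        exact sum_congr rfl fun k _ => by ring
      rw [h4, h2, mul_zero] at h3
      linarith

theorem renewal_antitone : Antitone renewal := by
  refine antitone_nat_of_succ_le fun n => ?_
  have := coeff_recipSeries_nonpos n
  rw [renewal_eq_sum (n + 1), sum_range_succ, ← renewal_eq_sum]
  linarith

/-- By monotonicity every term of the renewal equation may be lowered to `renewal n`; what is left
is `renewal n` times a harmonic number. -/
theorem renewal_mul_log_le (n : ℕ) : renewal n * Real.log (n + 2) ≤ 1 := by
  have h := sum_renewal n
  have h1 : ∑ k ∈ range (n + 1), renewal n * (1 / (((n - k : ℕ) : ℝ) + 1)) ≤ 1 := by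
    refine le_of_le_of_eq ?_ h
    refine sum_le_sum fun k hk => mul_le_mul_of_nonneg_right ?_ ?_
    swap
    · positivity
    exact renewal_antitone (Nat.lt_succ_iff.1 (mem_range.1 hk))
  rw [← mul_sum] at h1
  have h2 : ∑ k ∈ range (n + 1), (1 / (((n - k : ℕ) : ℝ) + 1)) = harmonic (n + 1) := by
    rw [← sum_range_reflect, harmonic]
    push_cast
    refine sum_congr rfl fun k hk => ?_
    have : n - (n - k) = k := by have := mem_range.1 hk; omega
    rw [this, one_div]
  rw [h2] at h1
  have h3 := log_add_one_le_harmonic (n + 1)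
  push_cast at h3
  have h4 : (n : ℝ) + 2 = n + 1 + 1 := by ring
  rw [h4]
  exact (mul_le_mul_of_nonneg_left h3 (renewal_nonneg n)).trans h1

theorem eventually_renewal_le {ε : ℝ} (hε : 0 < ε) : ∃ k₀, ∀ k, k₀ ≤ k → renewal k ≤ ε := by
  obtain ⟨k₀, hk₀⟩ := exists_nat_ge (Real.exp (1 / ε))
  refine ⟨k₀, fun k hk => ?_⟩
  have h1 : 1 / ε ≤ Real.log (k + 2) := by
    rw [Real.le_log_iff_exp_le (by positivity)]
    have : (k₀ : ℝ) ≤ k := by exact_mod_cast hk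
    linarith
  have h2 := renewal_mul_log_le k
  have h3 : renewal k * (1 / ε) ≤ 1 :=
    (mul_le_mul_of_nonneg_left h1 (renewal_nonneg k)).trans h2
  rwa [mul_one_div, div_le_one hε] at h3

/-- The solution `r` of `n * r n = ∑ k < n, q (n - k) * r k` with `r 0 = 1`. -/
noncomputable def eulerSolution (q : ℕ → ℝ) : ℕ → ℝ
  | 0 => 1
  | n + 1 => (∑ k : Fin (n + 1), q (n + 1 - k) * eulerSolution q k) / (n + 1)

theorem eulerSolution_zero (q : ℕ → ℝ) : eulerSolution q 0 = 1 := by rw [eulerSolution]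

theorem eulerSolution_recurrence (q : ℕ → ℝ) (n : ℕ) :
    (n : ℝ) * eulerSolution q n = ∑ k ∈ range n, q (n - k) * eulerSolution q k := by
  cases n with
  | zero => simp
  | succ n =>
    rw [eulerSolution, ← Fin.sum_univ_eq_sum_range fun k => q (n + 1 - k) * eulerSolution q k]
    push_cast
    field_simp

theorem eulerSolution_nonneg {q : ℕ → ℝ} (hq : ∀ k, 0 ≤ q k) (n : ℕ) :
    0 ≤ eulerSolution q n := by
  induction n using Nat.strong_induction_on with
  | _ n ih =>
    cases n with
    | zero => rw [eulerSolution_zero]; exact zero_le_one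
    | succ n =>
      rw [eulerSolution]
      exact div_nonneg (sum_nonneg fun k _ => mul_nonneg (hq _) (ih k k.2)) (by positivity)

/-- Passing to a majorant with nonnegative coefficients makes truncation harmless in the
differential inequality below. -/
theorem abs_coeff_fSeries_le (s : ℝ) (n : ℕ) :
    |coeff n (fSeries s 0)| ≤ eulerSolution (fun k => |1 / 2 + s * renewal k|) n := by
  induction n using Nat.strong_induction_on with
  | _ n ih =>
    rcases Nat.eq_zero_or_pos n with rfl | hn
    · rw [eulerSolution_zero]; simp [constantCoeff_fSeries]
    · have hn' : (0 : ℝ) < n := by exact_mod_cast hn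
      refine le_of_mul_le_mul_left ?_ hn'
      have h := abs_mul (n : ℝ) (coeff n (fSeries s 0))
      rw [abs_of_pos hn'] at h
      rw [eulerSolution_recurrence, ← h, coeff_fSeries_recurrence]
      refine (abs_sum_le_sum_abs _ _).trans (sum_le_sum fun k hk => ?_)
      rw [abs_mul]
      exact mul_le_mul_of_nonneg_left (ih k (mem_range.1 hk)) (abs_nonneg _)

/-- The partial sums of the power series with coefficients `eulerSolution q`. -/
noncomputable def eulerPartial (q : ℕ → ℝ) (N : ℕ) (x : ℝ) : ℝ :=
  ∑ n ∈ range (N + 1), eulerSolution q n * x ^ n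

theorem eulerPartial_nonneg {q : ℕ → ℝ} (hq : ∀ k, 0 ≤ q k) (N : ℕ) {x : ℝ} (hx : 0 ≤ x) :
    0 ≤ eulerPartial q N x :=
  sum_nonneg fun n _ => mul_nonneg (eulerSolution_nonneg hq n) (pow_nonneg hx n)

theorem hasDerivAt_eulerPartial (q : ℕ → ℝ) (N : ℕ) (x : ℝ) :
    HasDerivAt (eulerPartial q N)
      (∑ n ∈ range (N + 1), eulerSolution q n * ((n : ℝ) * x ^ (n - 1))) x := by
  unfold eulerPartial
  exact HasDerivAt.fun_sum fun n _ => (hasDerivAt_pow n x).const_mul _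

/-- A truncation of z r' = q r: the pairs of total degree at most N form part of the product of q
with the truncated r, and all terms are nonnegative. Working with polynomials avoids any convergence
question for r. -/
theorem mul_deriv_eulerPartial_le {q : ℕ → ℝ} (hq : ∀ k, 0 ≤ q k) (N : ℕ) {x W : ℝ}
    (hx : 0 ≤ x) (hW : ∀ M, ∑ j ∈ range M, q (j + 1) * x ^ (j + 1) ≤ W) :
    x * ∑ n ∈ range (N + 1), eulerSolution q n * ((n : ℝ) * x ^ (n - 1)) ≤
      W * eulerPartial q N x := by
  have h1 : x * ∑ n ∈ range (N + 1), eulerSolution q n * ((n : ℝ) * x ^ (n - 1)) =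
      ∑ n ∈ range (N + 1), ∑ k ∈ range n,
        (q (n - k) * x ^ (n - k)) * (eulerSolution q k * x ^ k) := by
    rw [mul_sum]
    refine sum_congr rfl fun n _ => ?_
    have h2 : x * (eulerSolution q n * ((n : ℝ) * x ^ (n - 1))) =
        (n * eulerSolution q n) * x ^ n := by
      cases n with
      | zero => simp
      | succ n => rw [Nat.add_sub_cancel]; ring
    rw [h2, eulerSolution_recurrence, sum_mul]
    refine sum_congr rfl fun k hk => ?_
    have h3 : x ^ n = x ^ (n - k) * x ^ k := by
      rw [← pow_add, Nat.sub_add_cancel (mem_range.1 hk).le]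
    rw [h3]; ring
  have h2 : ∑ n ∈ range (N + 1), ∑ k ∈ range n,
        (q (n - k) * x ^ (n - k)) * (eulerSolution q k * x ^ k) =
      ∑ k ∈ range (N + 1), ∑ n ∈ Ico (k + 1) (N + 1),
        (q (n - k) * x ^ (n - k)) * (eulerSolution q k * x ^ k) := by
    refine sum_comm' fun n k => ?_
    simp only [mem_range, mem_Ico]
    omega
  rw [h1, h2, eulerPartial, mul_sum]
  refine sum_le_sum fun k _ => ?_
  rw [← sum_mul]
  refine mul_le_mul_of_nonneg_right ?_
    (mul_nonneg (eulerSolution_nonneg hq k) (pow_nonneg hx k))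
  rw [sum_Ico_eq_sum_range]
  refine le_trans (le_of_eq (sum_congr rfl fun j _ => ?_)) (hW (N + 1 - (k + 1)))
  have : k + 1 + j - k = j + 1 := by omega
  rw [this]

/-- Grönwall's inequality: P exp(-A) is antitone. -/
theorem le_mul_exp_of_deriv_le {P P' A A' : ℝ → ℝ} {a b : ℝ} (hab : a ≤ b)
    (hP : ∀ x ∈ Set.Icc a b, HasDerivAt P (P' x) x)
    (hA : ∀ x ∈ Set.Icc a b, HasDerivAt A (A' x) x)
    (h : ∀ x ∈ Set.Ioo a b, P' x ≤ A' x * P x) :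
    P b ≤ P a * Real.exp (A b - A a) := by
  have hd : ∀ x ∈ Set.Icc a b, HasDerivAt (fun x => P x * Real.exp (-A x))
      (P' x * Real.exp (-A x) + P x * (Real.exp (-A x) * -A' x)) x :=
    fun x hx => (hP x hx).mul (hA x hx).neg.exp
  have hanti : AntitoneOn (fun x => P x * Real.exp (-A x)) (Set.Icc a b) := by
    refine antitoneOn_of_deriv_nonpos (convex_Icc a b)
      (fun x hx => (hd x hx).continuousAt.continuousWithinAt) ?_ ?_
    · rw [interior_Icc]
      exact fun x hx => (hd x (Set.Ioo_subset_Icc_self hx)).differentiableAt.differentiableWithinAt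
    · rw [interior_Icc]
      intro x hx
      rw [(hd x (Set.Ioo_subset_Icc_self hx)).deriv]
      have := mul_le_mul_of_nonneg_right (h x hx) (Real.exp_pos (-A x)).le
      linarith
  have h1 := hanti (Set.left_mem_Icc.2 hab) (Set.right_mem_Icc.2 hab) hab
  have h2 := mul_le_mul_of_nonneg_right h1 (Real.exp_pos (A b)).le
  simp only [mul_assoc, ← Real.exp_add] at h2
  rw [neg_add_cancel, Real.exp_zero, mul_one] at h2
  rwa [sub_eq_neg_add]

theorem geom_sum_le_two {x : ℝ} (hx : 0 ≤ x) (hx' : x ≤ 1 / 2) (M : ℕ) :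
    ∑ j ∈ range M, x ^ j ≤ 2 := by
  have h := geom_sum_mul_neg x M
  have h0 : 0 ≤ ∑ j ∈ range M, x ^ j := sum_nonneg fun j _ => pow_nonneg hx j
  have h1 : 0 ≤ x ^ M := pow_nonneg hx M
  nlinarith

/-- Grönwall on [0, 1/2], where the majorant is at most 2 B x. This supplies a starting value
independent of N; the sharper comparison in `eulerPartial_le` involves log x and cannot start at 0.
-/
theorem eulerPartial_half_le {q : ℕ → ℝ} (hq : ∀ k, 0 ≤ q k) {B : ℝ} (hB : ∀ k, q k ≤ B)
    (N : ℕ) : eulerPartial q N (1 / 2) ≤ Real.exp B := by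
  have hB0 : 0 ≤ B := (hq 0).trans (hB 0)
  have h := le_mul_exp_of_deriv_le (P := eulerPartial q N) (A := fun x => 2 * B * x)
    (A' := fun _ => 2 * B) (a := 0) (b := 1 / 2) (by norm_num)
    (fun x _ => hasDerivAt_eulerPartial q N x)
    (fun x _ => by simpa using (hasDerivAt_id x).const_mul (2 * B)) ?_
  · have h0 : eulerPartial q N 0 = 1 := by
      rw [eulerPartial, sum_range_succ', sum_eq_zero fun n _ => by simp]
      simp [eulerSolution_zero]
    rw [h0, one_mul] at h
    refine h.trans (le_of_eq ?_)
    congr 1; ring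
  · intro x hx
    have hx0 : 0 < x := hx.1
    refine le_of_mul_le_mul_left ?_ hx0
    refine (mul_deriv_eulerPartial_le hq N hx0.le (W := 2 * B * x) fun M => ?_).trans
      (le_of_eq (by ring))
    calc ∑ j ∈ range M, q (j + 1) * x ^ (j + 1) ≤ ∑ j ∈ range M, (B * x) * x ^ j := by
          refine sum_le_sum fun j _ => ?_
          rw [pow_succ']
          have : 0 ≤ x * x ^ j := by positivity
          nlinarith [hB (j + 1)]
      _ = (B * x) * ∑ j ∈ range M, x ^ j := by rw [mul_sum]
      _ ≤ (B * x) * 2 :=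
          mul_le_mul_of_nonneg_left (geom_sum_le_two hx0.le hx.2.le M) (by positivity)
      _ = 2 * B * x := by ring

/-- The Cauchy product with the logarithmic series is the geometric series, by the renewal equation.
Absolute convergence comes from 0 ≤ `renewal k` ≤ 1. -/
theorem hasSum_renewal {x : ℝ} (hx : 0 < x) (hx1 : x < 1) :
    HasSum (fun k => renewal k * x ^ k) (x / ((1 - x) * -Real.log (1 - x))) := by
  have hgeo := summable_geometric_of_lt_one hx.le hx1
  have hs1 : Summable fun k => renewal k * x ^ k :=
    Summable.of_nonneg_of_le (fun k => mul_nonneg (renewal_nonneg k) (pow_nonneg hx.le k))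
      (fun k => by
        have := mul_le_mul_of_nonneg_right (renewal_le_one k) (pow_nonneg hx.le k)
        rwa [one_mul] at this) hgeo
  have hlog := Real.hasSum_pow_div_log_of_abs_lt_one (x := x) (by rwa [abs_of_pos hx])
  have hg : HasSum (fun k : ℕ => 1 / ((k : ℝ) + 1) * x ^ k) (-Real.log (1 - x) / x) := by
    have hk : (fun k : ℕ => 1 / ((k : ℝ) + 1) * x ^ k) =
        fun k : ℕ => x ^ (k + 1) / ((k : ℝ) + 1) / x := by
      funext k; rw [pow_succ]; field_simp
    rw [hk]
    exact hlog.div_const x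
  have hL : 0 < -Real.log (1 - x) := by
    have := Real.log_neg (x := 1 - x) (by linarith) (by linarith)
    linarith
  have hprod := tsum_mul_tsum_eq_tsum_sum_range_of_summable_norm hs1.norm hg.summable.norm
  have hone : ∀ n, ∑ k ∈ range (n + 1),
      renewal k * x ^ k * (1 / (((n - k : ℕ) : ℝ) + 1) * x ^ (n - k)) = x ^ n := by
    intro n
    have h := congrArg (· * x ^ n) (sum_renewal n)
    simp only [sum_mul, one_mul] at h
    rw [← h]
    refine sum_congr rfl fun k hk => ?_
    have h3 : x ^ n = x ^ (n - k) * x ^ k := by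
      rw [← pow_add, Nat.sub_add_cancel (Nat.lt_succ_iff.1 (mem_range.1 hk))]
    rw [h3]; ring
  rw [tsum_congr hone, hg.tsum_eq, tsum_geometric_of_lt_one hx.le hx1] at hprod
  have : ∑' k, renewal k * x ^ k = x / ((1 - x) * -Real.log (1 - x)) := by
    have h1x : 1 - x ≠ 0 := by linarith
    rw [eq_div_iff (mul_ne_zero h1x hL.ne')]
    field_simp at hprod
    linarith
  rw [← this]
  exact hs1.hasSum

/-- A majorant of the series with coefficients `|1/2 + s * renewal k|`. -/
theorem sum_abs_euler_le (s : ℝ) : ∃ E : ℝ, 0 ≤ E ∧ ∀ x : ℝ, 0 < x → x < 1 → ∀ M : ℕ,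
    ∑ j ∈ range M, |1 / 2 + s * renewal (j + 1)| * x ^ (j + 1) ≤
      x / (2 * (1 - x)) + s * (x / ((1 - x) * -Real.log (1 - x)) - 1) + E := by
  -- From `k₀` on, |s| `renewal k` ≤ 1/2 and the absolute value changes nothing. Each earlier index
  -- costs at most 2|s|, whence the witness for `E`.
  obtain ⟨k₀, hk₀⟩ := eventually_renewal_le (ε := 1 / (2 * (|s| + 1))) (by positivity)
  refine ⟨2 * |s| * k₀, by positivity, fun x hx hx1 M => ?_⟩
  have hpt : ∀ j, |1 / 2 + s * renewal j| ≤
      (1 / 2 + s * renewal j) + if j < k₀ then 2 * |s| else 0 := by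
    intro j
    have h0 := renewal_nonneg j
    have h1 := renewal_le_one j
    have hs := abs_nonneg s
    have hsr : |s * renewal j| = |s| * renewal j := by rw [abs_mul, abs_of_nonneg h0]
    have hlow := neg_abs_le (s * renewal j)
    split_ifs with hj
    · rw [abs_le']
      constructor
      · linarith
      · rw [hsr] at hlow
        nlinarith
    · have h2 := hk₀ j (not_lt.1 hj)
      have h3 : |s| * renewal j ≤ 1 / 2 := by
        calc |s| * renewal j ≤ (|s| + 1) * (1 / (2 * (|s| + 1))) :=
              mul_le_mul (by linarith) h2 h0 (by positivity)
          _ = 1 / 2 := by field_simp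
      rw [abs_of_nonneg (by linarith), add_zero]
  have hU := hasSum_renewal hx hx1
  have hU' : HasSum (fun j => renewal (j + 1) * x ^ (j + 1))
      (x / ((1 - x) * -Real.log (1 - x)) - 1) := by
    have := (hasSum_nat_add_iff' 1).2 hU
    simpa [renewal_zero] using this
  have hG : HasSum (fun j : ℕ => x ^ (j + 1)) (x * (1 - x)⁻¹) := by
    simpa [pow_succ'] using (hasSum_geometric_of_lt_one hx.le hx1).mul_left x
  have hQ := (hG.mul_left (1 / 2)).add (hU'.mul_left s)
  have hfin : HasSum (fun j => if j < k₀ then 2 * |s| else 0) (∑ j ∈ range k₀, 2 * |s|) := by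
    have : HasSum (fun j => if j < k₀ then 2 * |s| else 0)
        (∑ j ∈ range k₀, if j < k₀ then 2 * |s| else 0) :=
      hasSum_sum_of_ne_finset_zero fun j hj => if_neg (by simpa using hj)
    rwa [sum_congr rfl fun j hj => if_pos (mem_range.1 hj)] at this
  have htot := hQ.add hfin
  have hle : ∀ j, |1 / 2 + s * renewal (j + 1)| * x ^ (j + 1) ≤
      1 / 2 * x ^ (j + 1) + s * (renewal (j + 1) * x ^ (j + 1)) +
        if j < k₀ then 2 * |s| else 0 := by
    intro j
    have hp : 0 ≤ x ^ (j + 1) := pow_nonneg hx.le _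
    have hp1 : x ^ (j + 1) ≤ 1 := pow_le_one₀ hx.le hx1.le
    have h1 := mul_le_mul_of_nonneg_right (hpt (j + 1)) hp
    refine h1.trans ?_
    have : (if j + 1 < k₀ then 2 * |s| else 0) * x ^ (j + 1) ≤ if j < k₀ then 2 * |s| else 0 := by
      have hs : 0 ≤ 2 * |s| := by positivity
      split_ifs with ha hb hb
      · nlinarith
      · omega
      · rw [zero_mul]; exact hs
      · simp
    linarith
  have hsum := sum_le_hasSum (range M) (fun j _ =>
    (mul_nonneg (abs_nonneg _) (pow_nonneg hx.le _)).trans (hle j)) htot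
  refine (sum_le_sum fun j _ => hle j).trans (hsum.trans (le_of_eq ?_))
  rw [sum_const, card_range, nsmul_eq_mul]
  have : 1 - x ≠ 0 := by linarith
  field_simp

/-- Grönwall on [1/2, 1 - 1/n]. The exponential of the antiderivative, taken at 1 - 1/n, produces √n
(log n)^s, and the logarithm of x stays bounded on this interval. -/
theorem eulerPartial_le (s : ℝ) : ∃ K : ℝ, 0 ≤ K ∧ ∀ n : ℕ, 2 ≤ n → ∀ N : ℕ,
    eulerPartial (fun k => |1 / 2 + s * renewal k|) N (1 - 1 / (n : ℝ)) ≤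
      K * (Real.sqrt n * Real.log n ^ s) := by
  obtain ⟨E, hE, hsum⟩ := sum_abs_euler_le s
  set q : ℕ → ℝ := fun k => |1 / 2 + s * renewal k| with hqdef
  have hq : ∀ k, 0 ≤ q k := fun k => abs_nonneg _
  have hB : ∀ k, q k ≤ 1 / 2 + |s| := fun k => by
    refine (abs_add_le _ _).trans ?_
    rw [abs_mul, abs_of_nonneg (renewal_nonneg k), abs_of_pos (by norm_num : (0 : ℝ) < 1 / 2)]
    have := mul_le_mul_of_nonneg_left (renewal_le_one k) (abs_nonneg s)
    linarith
  -- Chosen so that x A'(x) is the majorant of `sum_abs_euler_le` with `E` replaced by 2 E x, which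
  -- is at least `E` for x ≥ 1/2.
  let A : ℝ → ℝ := fun x =>
    -(1 / 2) * Real.log (1 - x) + s * Real.log (-Real.log (1 - x)) - s * Real.log x + 2 * E * x
  let A' : ℝ → ℝ := fun x =>
    -(1 / 2) * (-1 / (1 - x)) + s * (-(-1 / (1 - x)) / -Real.log (1 - x)) - s * (1 / x) + 2 * E * 1
  have hA : ∀ x, 0 < x → x < 1 → HasDerivAt A (A' x) x := by
    intro x hx hx1
    have h1 : HasDerivAt (fun x : ℝ => 1 - x) (-1) x := by
      simpa using (hasDerivAt_id x).const_sub 1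
    have h2 : HasDerivAt (fun x : ℝ => Real.log (1 - x)) (-1 / (1 - x)) x :=
      h1.log (by linarith)
    have hneg := Real.log_neg (x := 1 - x) (by linarith) (by linarith)
    have h3 : HasDerivAt (fun x : ℝ => Real.log (-Real.log (1 - x)))
        (-(-1 / (1 - x)) / -Real.log (1 - x)) x := h2.fun_neg.log (by linarith)
    have h4 : HasDerivAt (fun x : ℝ => Real.log x) (1 / x) x := (hasDerivAt_id x).log hx.ne'
    exact (((h2.const_mul _).add (h3.const_mul s)).sub (h4.const_mul s)).add
      ((hasDerivAt_id x).const_mul (2 * E))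
  refine ⟨Real.exp (1 / 2 + |s|) * Real.exp (-A (1 / 2)) *
    Real.exp (|s| * Real.log 2 + 2 * E), by positivity, fun n hn N => ?_⟩
  have hn' : (2 : ℝ) ≤ n := by exact_mod_cast hn
  have hinv : 1 / (n : ℝ) ≤ 1 / 2 := one_div_le_one_div_of_le (by norm_num) hn'
  have hinv0 : 0 < 1 / (n : ℝ) := by positivity
  set b : ℝ := 1 - 1 / (n : ℝ) with hb
  have hstep := le_mul_exp_of_deriv_le (P := eulerPartial q N) (A := A) (A' := A')
    (a := 1 / 2) (b := b) (by linarith)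
    (fun x _ => hasDerivAt_eulerPartial q N x)
    (fun x hx => hA x (by linarith [hx.1]) (by linarith [hx.2])) ?_
  · refine hstep.trans ?_
    have hlogn : 0 < Real.log n := Real.log_pos (by linarith)
    have hAb : A b ≤ 1 / 2 * Real.log n + Real.log (Real.log n) * s +
        (|s| * Real.log 2 + 2 * E) := by
      have h1 : 1 - b = (n : ℝ)⁻¹ := by rw [hb]; ring
      simp only [A]
      rw [h1, Real.log_inv, neg_neg]
      have h2 : -(s * Real.log b) ≤ |s| * Real.log 2 := by
        have h3 : Real.log (1 / 2) ≤ Real.log b := Real.log_le_log (by norm_num) (by linarith)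
        have h4 : Real.log b ≤ 0 := Real.log_nonpos (by linarith) (by linarith)
        rw [one_div, Real.log_inv] at h3
        have h5 := neg_abs_le (s * Real.log b)
        rw [abs_mul, abs_of_nonpos h4] at h5
        have := abs_nonneg s
        nlinarith
      have h6 : 2 * E * b ≤ 2 * E := by nlinarith
      linarith
    have hval : Real.exp (1 / 2 * Real.log n + Real.log (Real.log n) * s) =
        Real.sqrt n * Real.log n ^ s := by
      rw [Real.exp_add, Real.rpow_def_of_pos hlogn, Real.sqrt_eq_rpow,
        Real.rpow_def_of_pos (by linarith)]
      congr 2; ring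
    calc eulerPartial q N (1 / 2) * Real.exp (A b - A (1 / 2))
        ≤ Real.exp (1 / 2 + |s|) * Real.exp ((1 / 2 * Real.log n + Real.log (Real.log n) * s +
          (|s| * Real.log 2 + 2 * E)) + -A (1 / 2)) := by
          refine mul_le_mul (eulerPartial_half_le hq hB N) (Real.exp_le_exp.2 (by linarith))
            (Real.exp_pos _).le (Real.exp_pos _).le
      _ = _ := by
          rw [Real.exp_add _ (-A (1 / 2)), Real.exp_add _ (|s| * Real.log 2 + 2 * E), hval]; ring
  · intro x hx
    have hx0 : 0 < x := by linarith [hx.1]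
    have hx1 : x < 1 := by linarith [hx.2]
    refine le_of_mul_le_mul_left ?_ hx0
    refine (mul_deriv_eulerPartial_le hq N hx0.le (hsum x hx0 hx1)).trans ?_
    rw [← mul_assoc]
    refine mul_le_mul_of_nonneg_right ?_ (eulerPartial_nonneg hq N hx0.le)
    have hneg := Real.log_neg (x := 1 - x) (by linarith) (by linarith)
    have e1 : 1 - x ≠ 0 := by linarith
    have e2 : x ≠ 0 := hx0.ne'
    have e3 : Real.log (1 - x) ≠ 0 := hneg.ne
    have : x * A' x = x / (2 * (1 - x)) + s * (x / ((1 - x) * -Real.log (1 - x)) - 1)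
        + 2 * E * x := by
      simp only [A']
      field_simp
      ring
    rw [this]
    have := hx.1
    nlinarith

/-- At x = 1 - 1/n the weights x^k with k < n stay above 1/e, so the value of a nonnegative
polynomial at x controls the sum of its first n coefficients. -/
theorem exp_neg_one_le_pow {n k : ℕ} (hn : 2 ≤ n) (hk : k < n) :
    Real.exp (-1) ≤ (1 - 1 / (n : ℝ)) ^ k := by
  obtain ⟨m, rfl⟩ : ∃ m, n = m + 1 := ⟨n - 1, by omega⟩
  have hm : (0 : ℝ) < m := by exact_mod_cast (by omega : 0 < m)
  have h1 : 1 - 1 / ((m + 1 : ℕ) : ℝ) = (1 + 1 / (m : ℝ))⁻¹ := by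
    push_cast; field_simp; ring
  have h2 : 1 + 1 / (m : ℝ) ≤ Real.exp (1 / m) := by
    rw [add_comm]; exact Real.add_one_le_exp _
  rw [h1, Real.exp_neg, inv_pow]
  refine inv_anti₀ (by positivity) ?_
  calc (1 + 1 / (m : ℝ)) ^ k ≤ Real.exp (1 / m) ^ k := pow_le_pow_left₀ (by positivity) h2 k
    _ = Real.exp (k * (1 / m)) := by rw [← Real.exp_nat_mul]
    _ ≤ Real.exp 1 := by
        refine Real.exp_le_exp.2 ?_
        rw [mul_one_div, div_le_one hm]
        exact_mod_cast Nat.lt_succ_iff.1 hk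

/-- `eulerPartial_le` bounds the sum of the first n majorant coefficients by a multiple of √n log^s
n. The recurrence n r_n = ∑ q_{n-k} r_k with bounded q then gains a factor 1/n. -/
theorem coeff_fSeries_sq_le (s : ℝ) : ∃ c : ℝ, 0 ≤ c ∧ ∀ n : ℕ, 2 ≤ n →
    coeff n (fSeries s 0) ^ 2 ≤ c * (Real.log n ^ (2 * s) / n) := by
  obtain ⟨K, hK, hP⟩ := eulerPartial_le s
  set q : ℕ → ℝ := fun k => |1 / 2 + s * renewal k| with hqdef
  have hq : ∀ k, 0 ≤ q k := fun k => abs_nonneg _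
  have hB : ∀ k, q k ≤ 1 / 2 + |s| := fun k => by
    refine (abs_add_le _ _).trans ?_
    rw [abs_mul, abs_of_nonneg (renewal_nonneg k), abs_of_pos (by norm_num : (0 : ℝ) < 1 / 2)]
    have := mul_le_mul_of_nonneg_left (renewal_le_one k) (abs_nonneg s)
    linarith
  refine ⟨((1 / 2 + |s|) * (Real.exp 1 * K)) ^ 2, by positivity, fun n hn => ?_⟩
  have hn' : (2 : ℝ) ≤ n := by exact_mod_cast hn
  have hlogn : 0 < Real.log n := Real.log_pos (by linarith)
  obtain ⟨m, hm⟩ : ∃ m, n = m + 1 := ⟨n - 1, by omega⟩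
  have h1 : ∑ k ∈ range n, eulerSolution q k ≤
      Real.exp 1 * (K * (Real.sqrt n * Real.log n ^ s)) := by
    have h2 : Real.exp (-1) * ∑ k ∈ range n, eulerSolution q k ≤
        K * (Real.sqrt n * Real.log n ^ s) := by
      refine le_trans ?_ (hP n hn m)
      rw [eulerPartial, mul_sum, ← hm]
      refine sum_le_sum fun k hk => ?_
      rw [mul_comm]
      exact mul_le_mul_of_nonneg_left (exp_neg_one_le_pow hn (mem_range.1 hk))
        (eulerSolution_nonneg hq k)
    have := mul_le_mul_of_nonneg_left h2 (Real.exp_pos 1).le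
    rwa [← mul_assoc, ← Real.exp_add, add_neg_cancel, Real.exp_zero, one_mul] at this
  have h3 : (n : ℝ) * |coeff n (fSeries s 0)| ≤
      (1 / 2 + |s|) * (Real.exp 1 * K) * (Real.sqrt n * Real.log n ^ s) := by
    calc (n : ℝ) * |coeff n (fSeries s 0)| ≤ n * eulerSolution q n :=
          mul_le_mul_of_nonneg_left (abs_coeff_fSeries_le s n) (by positivity)
      _ = ∑ k ∈ range n, q (n - k) * eulerSolution q k := eulerSolution_recurrence q n
      _ ≤ ∑ k ∈ range n, (1 / 2 + |s|) * eulerSolution q k :=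
          sum_le_sum fun k _ => mul_le_mul_of_nonneg_right (hB _) (eulerSolution_nonneg hq k)
      _ = (1 / 2 + |s|) * ∑ k ∈ range n, eulerSolution q k := by rw [mul_sum]
      _ ≤ _ := by
          rw [mul_assoc, mul_assoc]
          exact mul_le_mul_of_nonneg_left h1 (by positivity)
  have h4 := pow_le_pow_left₀ (by positivity) h3 2
  rw [mul_pow, sq_abs, mul_pow _ (Real.sqrt n * _), mul_pow (Real.sqrt n), Real.sq_sqrt (by linarith),
    ← Real.rpow_natCast (Real.log n ^ s), ← Real.rpow_mul hlogn.le, Nat.cast_ofNat,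
    mul_comm s 2] at h4
  have hn0 : (0 : ℝ) < n := by linarith
  rw [mul_div_assoc', le_div_iff₀ hn0]
  refine le_of_mul_le_mul_left ?_ hn0
  calc (n : ℝ) * (coeff n (fSeries s 0) ^ 2 * n) = n ^ 2 * coeff n (fSeries s 0) ^ 2 := by ring
    _ ≤ _ := h4
    _ = _ := by ring

/-- Cauchy condensation reduces this to ∑ k^p. The argument n + 1 keeps the terms antitone from n =
1 on: log 1 = 0 raised to a negative power would be 0. -/
theorem summable_log_rpow_div {p : ℝ} (hp : p < -1) :
    Summable fun n : ℕ => Real.log ((n : ℝ) + 1) ^ p / n := by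
  rw [← summable_condensed_iff_of_nonneg]
  · have h1 : Summable fun k : ℕ => (Real.log 2) ^ p * (k : ℝ) ^ p :=
      (Real.summable_nat_rpow.2 hp).mul_left _
    refine (summable_nat_add_iff 1).1 (Summable.of_nonneg_of_le (fun k => ?_) (fun k => ?_)
      ((summable_nat_add_iff 1).2 h1))
    · have : (0 : ℝ) ≤ ((2 ^ (k + 1) : ℕ) : ℝ) := Nat.cast_nonneg _
      exact mul_nonneg (by positivity) (div_nonneg (Real.rpow_nonneg
        (Real.log_nonneg (by linarith)) _) this)
    · have h2 : (0 : ℝ) < 2 ^ (k + 1) := by positivity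
      have hl2 : 0 < Real.log 2 := Real.log_pos (by norm_num)
      push_cast
      rw [mul_div_cancel₀ _ h2.ne', ← Real.mul_rpow hl2.le (by positivity)]
      refine Real.rpow_le_rpow_of_nonpos (by positivity) ?_ (by linarith)
      calc Real.log 2 * ((k : ℝ) + 1) = Real.log (2 ^ (k + 1)) := by
            rw [Real.log_pow]; push_cast; ring
        _ ≤ _ := Real.log_le_log h2 (by linarith)
  · intro n
    exact div_nonneg (Real.rpow_nonneg (Real.log_nonneg (by linarith [n.cast_nonneg (α := ℝ)])) _)
      n.cast_nonneg
  · intro m n hm hmn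
    have hm' : (1 : ℝ) ≤ m := by exact_mod_cast hm
    have hmn' : (m : ℝ) ≤ n := by exact_mod_cast hmn
    have h0 : 0 < Real.log ((m : ℝ) + 1) := Real.log_pos (by linarith)
    refine div_le_div₀ (Real.rpow_nonneg h0.le _) ?_ (by linarith) hmn'
    exact Real.rpow_le_rpow_of_nonpos h0 (Real.log_le_log (by linarith) (by linarith)) (by linarith)

theorem summable_coeff_fSeries_sq {s : ℝ} (hs : s < -1 / 2) :
    Summable fun n => coeff n (fSeries s 0) ^ 2 := by
  obtain ⟨c, hc, h⟩ := coeff_fSeries_sq_le s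
  have h1 := (summable_log_rpow_div (p := 2 * s) (by linarith)).mul_left (c * 2 ^ (-(2 * s)))
  rw [← summable_nat_add_iff 2] at h1 ⊢
  refine Summable.of_nonneg_of_le (fun n => sq_nonneg _) (fun n => ?_) h1
  refine (h (n + 2) (by omega)).trans ?_
  rw [mul_assoc]
  refine mul_le_mul_of_nonneg_left ?_ hc
  rw [mul_div_assoc']
  refine div_le_div_of_nonneg_right ?_ (Nat.cast_nonneg _)
  set x : ℝ := ((n + 2 : ℕ) : ℝ)
  have hx : (2 : ℝ) ≤ x := by simp only [x]; push_cast; linarith [n.cast_nonneg (α := ℝ)]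
  have hlx : 0 < Real.log x := Real.log_pos (by linarith)
  have hlx' : 0 < Real.log (x + 1) := Real.log_pos (by linarith)
  have h3 : Real.log (x + 1) / 2 ≤ Real.log x := by
    have : Real.log (x + 1) ≤ Real.log (x ^ 2) := Real.log_le_log (by linarith) (by nlinarith)
    rw [Real.log_pow] at this
    push_cast at this
    linarith
  calc Real.log x ^ (2 * s) ≤ (Real.log (x + 1) / 2) ^ (2 * s) :=
        Real.rpow_le_rpow_of_nonpos (by positivity) h3 (by linarith)
    _ = _ := by
        rw [Real.div_rpow hlx'.le (by norm_num), Real.rpow_neg (by norm_num)]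
        field_simp

theorem sum_coeff_fSeries_sq_le {s : ℝ} (hs : 0 < s) : ∃ K : ℝ, 0 ≤ K ∧ ∀ t : ℕ, 1 ≤ t →
    ∑ n ∈ range (t + 1), coeff n (fSeries s 0) ^ 2 ≤ K * Real.log ((t : ℝ) + 1) ^ (2 * s + 1) := by
  obtain ⟨c, hc, h⟩ := coeff_fSeries_sq_le s
  set a : ℝ := coeff 0 (fSeries s 0) ^ 2 + coeff 1 (fSeries s 0) ^ 2 with ha
  have ha0 : 0 ≤ a := by positivity
  have hl2 : 0 < Real.log 2 := Real.log_pos (by norm_num)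
  -- The coefficients of index 0 and 1, where log n is no use, are absorbed through log 2 ≤ log(t +
  -- 1). For the others, log n is bounded by log(t + 1), and a harmonic sum supplies the extra
  -- logarithm.
  refine ⟨a / Real.log 2 ^ (2 * s + 1) + c, by positivity, fun t ht => ?_⟩
  have ht' : (1 : ℝ) ≤ t := by exact_mod_cast ht
  set l := Real.log ((t : ℝ) + 1) with hl
  have hl2' : Real.log 2 ≤ l := Real.log_le_log (by norm_num) (by linarith)
  obtain ⟨m, rfl⟩ : ∃ m, t = m + 1 := ⟨t - 1, by omega⟩
  rw [sum_range_succ', sum_range_succ', add_assoc]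
  have h1 : ∑ k ∈ range m, coeff (k + 1 + 1) (fSeries s 0) ^ 2 ≤
      c * l ^ (2 * s) * ∑ k ∈ range m, 1 / ((k : ℝ) + 2) := by
    rw [mul_sum]
    refine sum_le_sum fun k hk => (h (k + 2) (by omega)).trans ?_
    rw [mul_assoc, mul_one_div]
    push_cast
    refine mul_le_mul_of_nonneg_left (div_le_div_of_nonneg_right ?_ (by positivity)) hc
    have hk' : ((k : ℝ) + 1) ≤ m := by exact_mod_cast mem_range.1 hk
    refine Real.rpow_le_rpow (Real.log_nonneg (by linarith [k.cast_nonneg (α := ℝ)]))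
      (Real.log_le_log (by positivity) ?_) (by linarith)
    push_cast; linarith
  have h2 : ∑ k ∈ range m, 1 / ((k : ℝ) + 2) ≤ l := by
    have h3 := harmonic_le_one_add_log (m + 1)
    rw [harmonic, sum_range_succ'] at h3
    push_cast at h3
    have h4 : ∑ k ∈ range m, 1 / ((k : ℝ) + 2) = ∑ k ∈ range m, ((k : ℝ) + 1 + 1)⁻¹ :=
      sum_congr rfl fun k _ => by rw [one_div]; congr 1; ring
    have h5 : Real.log ((m : ℝ) + 1) ≤ l :=
      Real.log_le_log (by positivity) (by push_cast; linarith)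
    rw [h4]
    norm_num at h3
    linarith
  have h3 : a ≤ a / Real.log 2 ^ (2 * s + 1) * l ^ (2 * s + 1) := by
    rw [div_mul_eq_mul_div, le_div_iff₀ (by positivity)]
    exact mul_le_mul_of_nonneg_left (Real.rpow_le_rpow hl2.le hl2' (by linarith)) ha0
  have h4 : l ^ (2 * s + 1) = l ^ (2 * s) * l := by
    rw [Real.rpow_add (by linarith), Real.rpow_one]
  have h5 := mul_le_mul_of_nonneg_left h2
    (mul_nonneg hc (Real.rpow_nonneg (hl2.le.trans hl2') (2 * s)))
  have h6 : c * l ^ (2 * s + 1) = c * l ^ (2 * s) * l := by rw [h4, mul_assoc]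
  rw [add_mul, h6]
  have h7 : coeff (0 + 1) (fSeries s 0) ^ 2 + coeff 0 (fSeries s 0) ^ 2 = a := by
    rw [ha]; ring
  rw [h7]
  linarith

end Asymptotics

/-! ### The Gaussian mechanism. -/

section Privacy

open Finset

/-- The product of `n` standard Gaussians. -/
noncomputable def stdGaussianPi (n : ℕ) : Measure (Fin n → ℝ) :=
  Measure.pi fun _ => gaussianReal 0 1

instance (n : ℕ) : IsProbabilityMeasure (stdGaussianPi n) := by
  unfold stdGaussianPi; infer_instance

instance : IsProbabilityMeasure gaussianTape := by
  unfold gaussianTape; infer_instance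

theorem gaussianTape_map_restrict (n : ℕ) :
    gaussianTape.map (fun ω (i : Fin n) => ω i) = stdGaussianPi n := by
  rw [gaussianTape, stdGaussianPi,
    Measure.map_infinitePi_infinitePi_of_inj (P := fun _ : ℕ => gaussianReal 0 1)
      (f := fun i : Fin n => (i : ℕ)) Fin.val_injective, Measure.infinitePi_eq_pi]

/-- The density of a shifted standard Gaussian. -/
noncomputable def shiftDensity {n : ℕ} (d v : Fin n → ℝ) : ℝ≥0∞ :=
  ENNReal.ofReal (Real.exp (∑ i, (d i * v i - d i ^ 2 / 2)))

theorem measurable_shiftDensity {n : ℕ} (d : Fin n → ℝ) : Measurable (shiftDensity d) := by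
  unfold shiftDensity
  fun_prop

theorem gaussianReal_apply_eq_lintegral (a : ℝ) {s : Set ℝ} (hs : MeasurableSet s) :
    gaussianReal a 1 s =
      ∫⁻ x, s.indicator (fun x => ENNReal.ofReal (Real.exp (a * x - a ^ 2 / 2))) x
        ∂gaussianReal 0 1 := by
  have hm : Measurable fun x : ℝ => ENNReal.ofReal (Real.exp (a * x - a ^ 2 / 2)) := by fun_prop
  rw [lintegral_indicator hs, gaussianReal_apply _ one_ne_zero,
    gaussianReal_of_var_ne_zero _ one_ne_zero,
    setLIntegral_withDensity_eq_setLIntegral_mul _ (measurable_gaussianPDF 0 1) hm hs]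
  refine lintegral_congr fun x => ?_
  rw [Pi.mul_apply, gaussianPDF, gaussianPDF,
    ← ENNReal.ofReal_mul (gaussianPDFReal_nonneg 0 1 x), gaussianPDFReal, gaussianPDFReal,
    mul_assoc _ (Real.exp _), ← Real.exp_add]
  congr 3
  push_cast
  ring

/-- The Cameron–Martin formula in finite dimension, checked on boxes, where both sides factor over
the coordinates. -/
theorem stdGaussianPi_map_add {n : ℕ} (d : Fin n → ℝ) :
    (stdGaussianPi n).map (fun v => v + d) = (stdGaussianPi n).withDensity (shiftDensity d) := by
  have h1 : (stdGaussianPi n).map (fun v => v + d) =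
      Measure.pi fun i => gaussianReal (d i) 1 := by
    have hm : ∀ i, (gaussianReal 0 1).map (fun x => x + d i) = gaussianReal (d i) 1 := fun i => by
      rw [gaussianReal_map_add_const, zero_add]
    have : ∀ i, SigmaFinite ((gaussianReal 0 1).map (fun x => x + d i)) := fun i => by
      rw [hm]; infer_instance
    have := Measure.pi_map_pi (μ := fun _ : Fin n => gaussianReal 0 1)
      (f := fun i x => x + d i) (fun i => by fun_prop)
    simp only [hm] at this
    exact this
  rw [h1]
  refine Measure.pi_eq fun s hs => ?_
  rw [withDensity_apply _ (MeasurableSet.univ_pi hs), ← lintegral_indicator (MeasurableSet.univ_pi hs)]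
  have h2 : ∀ v : Fin n → ℝ, (Set.univ.pi s).indicator (shiftDensity d) v =
      ∏ i, (s i).indicator (fun x => ENNReal.ofReal (Real.exp (d i * x - d i ^ 2 / 2))) (v i) := by
    intro v
    by_cases hv : v ∈ Set.univ.pi s
    · rw [Set.indicator_of_mem hv, shiftDensity, Real.exp_sum,
        ENNReal.ofReal_prod_of_nonneg fun i _ => (Real.exp_pos _).le]
      exact prod_congr rfl fun i _ => by rw [Set.indicator_of_mem (hv i trivial)]
    · rw [Set.indicator_of_notMem hv]
      obtain ⟨i, hi⟩ : ∃ i, v i ∉ s i := by simpa [Set.mem_pi] using hv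
      exact (prod_eq_zero (mem_univ i) (Set.indicator_of_notMem hi _)).symm
  have hmeas : ∀ i, Measurable ((s i).indicator
      (fun x => ENNReal.ofReal (Real.exp (d i * x - d i ^ 2 / 2)))) := fun i =>
    Measurable.indicator (by fun_prop) (hs i)
  simp only [h2]
  have hind : iIndepFun (fun i (v : Fin n → ℝ) => (s i).indicator
      (fun x => ENNReal.ofReal (Real.exp (d i * x - d i ^ 2 / 2))) (v i)) (stdGaussianPi n) :=
    iIndepFun_pi (μ := fun _ : Fin n => gaussianReal 0 1) fun i => (hmeas i).aemeasurable
  rw [lintegral_prod_eq_prod_lintegral_of_indepFun univ _ hind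
    fun i => (hmeas i).comp (measurable_pi_apply i)]
  refine prod_congr rfl fun i _ => ?_
  have := (measurePreserving_eval (fun _ : Fin n => gaussianReal 0 1) i).lintegral_comp (hmeas i)
  rw [gaussianReal_apply_eq_lintegral _ (hs i), ← this]
  rfl

theorem lintegral_shiftDensity {n : ℕ} (d : Fin n → ℝ) :
    ∫⁻ v, shiftDensity d v ∂stdGaussianPi n = 1 := by
  have h := congrArg (fun μ => μ Set.univ) (stdGaussianPi_map_add d)
  simp only [withDensity_apply _ MeasurableSet.univ, Measure.restrict_univ] at h
  rw [← h, Measure.map_apply (by fun_prop) MeasurableSet.univ]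
  simp

/-- A Chernoff bound for the privacy loss Z = ⟨d, v⟩ - |d|²/2. Where Z ≤ ε the density e^Z is at
most e^ε; elsewhere it is at most e^(Z + l(Z - ε)), which is a constant times the density of the
shift by (1 + l) d and hence integrates to that constant. -/
theorem stdGaussianPi_shift_le {n : ℕ} (d : Fin n → ℝ) {ε l : ℝ} (hl : 0 ≤ l)
    {A : Set (Fin n → ℝ)} (hA : MeasurableSet A) :
    stdGaussianPi n {v | v + d ∈ A} ≤ ENNReal.ofReal (Real.exp ε) * stdGaussianPi n A +
      ENNReal.ofReal (Real.exp (l * (1 + l) * (∑ i, d i ^ 2) / 2 - l * ε)) := by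
  have h1 : stdGaussianPi n {v | v + d ∈ A} = ∫⁻ v in A, shiftDensity d v ∂stdGaussianPi n := by
    rw [← withDensity_apply _ hA, ← stdGaussianPi_map_add, Measure.map_apply (by fun_prop) hA]
    rfl
  set c : ℝ := l * (1 + l) * (∑ i, d i ^ 2) / 2 - l * ε with hc
  have hpt : ∀ v, shiftDensity d v ≤ ENNReal.ofReal (Real.exp ε) +
      ENNReal.ofReal (Real.exp c) * shiftDensity (fun i => (1 + l) * d i) v := by
    intro v
    have e1 : ∑ i, (d i * v i - d i ^ 2 / 2) = ∑ i, d i * v i - (∑ i, d i ^ 2) / 2 := by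
      rw [sum_sub_distrib, sum_div]
    have e2 : ∑ i, ((1 + l) * d i * v i - ((1 + l) * d i) ^ 2 / 2) =
        (1 + l) * ∑ i, d i * v i - (1 + l) ^ 2 * (∑ i, d i ^ 2) / 2 := by
      rw [sum_sub_distrib, mul_sum, mul_sum, sum_div]
      congr 1 <;> exact sum_congr rfl fun i _ => by ring
    rw [shiftDensity, shiftDensity, ← ENNReal.ofReal_mul (Real.exp_pos _).le, ← Real.exp_add,
      ← ENNReal.ofReal_add (Real.exp_pos _).le (Real.exp_pos _).le]
    refine ENNReal.ofReal_le_ofReal ?_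
    rw [e1, e2]
    set S := ∑ i, d i * v i
    set q := ∑ i, d i ^ 2
    rcases le_or_gt (S - q / 2) ε with h | h
    · have := Real.exp_le_exp.2 h
      have := Real.exp_pos (c + ((1 + l) * S - (1 + l) ^ 2 * q / 2))
      linarith
    · have : Real.exp (S - q / 2) ≤ Real.exp (c + ((1 + l) * S - (1 + l) ^ 2 * q / 2)) := by
        refine Real.exp_le_exp.2 ?_
        have h2 : 0 ≤ l * (S - q / 2 - ε) := mul_nonneg hl (by linarith)
        have h3 : c + ((1 + l) * S - (1 + l) ^ 2 * q / 2) =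
            S - q / 2 + l * (S - q / 2 - ε) := by rw [hc]; ring
        linarith
      have := Real.exp_pos ε
      linarith
  rw [h1]
  calc ∫⁻ v in A, shiftDensity d v ∂stdGaussianPi n
      ≤ ∫⁻ v in A, (ENNReal.ofReal (Real.exp ε) +
          ENNReal.ofReal (Real.exp c) * shiftDensity (fun i => (1 + l) * d i) v) ∂stdGaussianPi n :=
        lintegral_mono fun v => hpt v
    _ = ENNReal.ofReal (Real.exp ε) * stdGaussianPi n A + ENNReal.ofReal (Real.exp c) *
          ∫⁻ v in A, shiftDensity (fun i => (1 + l) * d i) v ∂stdGaussianPi n := by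
        rw [lintegral_add_left measurable_const, setLIntegral_const,
          lintegral_const_mul _ (measurable_shiftDensity _)]
    _ ≤ _ := by
        gcongr
        refine le_trans (mul_le_mul_right (setLIntegral_le_lintegral _ _) _) ?_
        rw [lintegral_shiftDensity, mul_one]

/-- The noise multiplier that makes the Gaussian mechanism `(ε, δ)`-differentially private. -/
noncomputable def noiseMultiplier (ε δ : ℝ) : ℝ :=
  (Real.sqrt (2 * Real.log (1 / δ)) + Real.sqrt ε) / ε

theorem noiseMultiplier_pos {ε : ℝ} (hε : 0 < ε) (δ : ℝ) : 0 < noiseMultiplier ε δ :=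
  div_pos (add_pos_of_nonneg_of_pos (Real.sqrt_nonneg _) (Real.sqrt_pos.2 hε)) hε

/-- The additional term √ε is at most √ε₀ and is absorbed because log(1/δ) is bounded below by
log(1/δ₀) > 0. -/
theorem noiseMultiplier_le {ε₀ δ₀ : ℝ} (hδ₀ : 0 < δ₀) (hδ₀' : δ₀ < 1) {ε δ : ℝ} (hε : 0 < ε)
    (hε' : ε ≤ ε₀) (hδ : 0 < δ) (hδ' : δ ≤ δ₀) :
    noiseMultiplier ε δ ≤ (Real.sqrt 2 + Real.sqrt ε₀ / Real.sqrt (Real.log (1 / δ₀))) *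
      (ε⁻¹ * Real.sqrt (Real.log (1 / δ))) := by
  have h0 : 0 < Real.log (1 / δ₀) := Real.log_pos (by rw [lt_div_iff₀ hδ₀]; linarith)
  have h1 : Real.log (1 / δ₀) ≤ Real.log (1 / δ) :=
    Real.log_le_log (by positivity) (one_div_le_one_div_of_le hδ hδ')
  have h2 := Real.sqrt_le_sqrt h1
  have h3 := Real.sqrt_pos.2 h0
  have h4 : Real.sqrt ε ≤ Real.sqrt ε₀ / Real.sqrt (Real.log (1 / δ₀)) *
      Real.sqrt (Real.log (1 / δ)) := by
    rw [div_mul_eq_mul_div, le_div_iff₀ h3]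
    exact mul_le_mul (Real.sqrt_le_sqrt hε') h2 h3.le (Real.sqrt_nonneg _)
  rw [noiseMultiplier, Real.sqrt_mul (by norm_num), div_eq_inv_mul]
  calc ε⁻¹ * (Real.sqrt 2 * Real.sqrt (Real.log (1 / δ)) + Real.sqrt ε) ≤
      ε⁻¹ * (Real.sqrt 2 * Real.sqrt (Real.log (1 / δ)) +
        Real.sqrt ε₀ / Real.sqrt (Real.log (1 / δ₀)) * Real.sqrt (Real.log (1 / δ))) := by
        gcongr
    _ = _ := by ring

theorem exp_noiseMultiplier_le {ε δ q : ℝ} (hε : 0 < ε) (hδ : 0 < δ)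
    (hq : q ≤ 1 / noiseMultiplier ε δ ^ 2) : ∃ l : ℝ, 0 ≤ l ∧
      Real.exp (l * (1 + l) * q / 2 - l * ε) ≤ δ := by
  set C := noiseMultiplier ε δ with hC
  set b := Real.sqrt (2 * Real.log (1 / δ)) with hb
  have hC0 : 0 < C := noiseMultiplier_pos hε δ
  have hb0 : 0 ≤ b := Real.sqrt_nonneg _
  have hse := Real.sqrt_pos.2 hε
  have hss := Real.mul_self_sqrt hε.le
  have h1 : ε * C = b + Real.sqrt ε := by
    rw [hC, noiseMultiplier, ← hb]; field_simp
  have h2 : 1 ≤ Real.sqrt ε * C := by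
    have : Real.sqrt ε * 1 ≤ Real.sqrt ε * (Real.sqrt ε * C) := by
      rw [← mul_assoc, hss, h1]; linarith
    exact le_of_mul_le_mul_left this hse
  have h3 : 1 ≤ ε * C ^ 2 := by
    calc (1 : ℝ) ≤ (Real.sqrt ε * C) ^ 2 := by nlinarith
      _ = ε * C ^ 2 := by rw [mul_pow, Real.sq_sqrt hε.le]
  -- The minimizer of l(1 + l)/(2C²) - lε, with minimum -(l/C)²/2. The summand √ε in the noise
  -- multiplier gives √ε C ≥ 1, which yields both l ≥ 0 and l/C = εC - 1/(2C) ≥ b.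
  refine ⟨ε * C ^ 2 - 1 / 2, by linarith, ?_⟩
  set l := ε * C ^ 2 - 1 / 2 with hl
  have hl0 : 0 ≤ l := by linarith
  have h4 : l * (1 + l) * q / 2 - l * ε ≤ -(l / C) ^ 2 / 2 := by
    have h5 : l * (1 + l) * q / 2 ≤ l * (1 + l) * (1 / C ^ 2) / 2 := by gcongr
    have h6 : l * (1 + l) * (1 / C ^ 2) / 2 - l * ε = -(l / C) ^ 2 / 2 := by
      field_simp
      rw [hl]; ring
    linarith
  have h7 : b ≤ l / C := by
    rw [le_div_iff₀ hC0, hl]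
    nlinarith
  have h8 : -(l / C) ^ 2 / 2 ≤ -b ^ 2 / 2 := by nlinarith
  refine (Real.exp_le_exp.2 (h4.trans h8)).trans ?_
  rcases le_or_gt δ 1 with hδ1 | hδ1
  · have h9 : 0 ≤ Real.log (1 / δ) := Real.log_nonneg (by rw [le_div_iff₀ hδ]; linarith)
    rw [hb, Real.sq_sqrt (by linarith), one_div, Real.log_inv]
    have : -(2 * -Real.log δ) / 2 = Real.log δ := by ring
    rw [this, Real.exp_log hδ]
  -- For δ > 1 the logarithm is negative and `Real.sqrt` gives b = 0; a nonpositive exponent is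
  -- enough.
  · exact (Real.exp_le_one_iff.2 (by nlinarith)).trans hδ1.le

/-! ### Sensitivity, factorization and privacy of the matrix mechanism. -/

theorem colNorm_ltToep (f : PowerSeries ℝ) :
    colNorm (ltToep f) =
      (∑' n, ENNReal.ofReal (PowerSeries.coeff n f ^ 2)) ^ (1 / 2 : ℝ) := by
  have h : ∀ j, ∑' i, ENNReal.ofReal (ltToep f i j ^ 2) =
      ∑' n, ENNReal.ofReal (PowerSeries.coeff n f ^ 2) := by
    intro j
    rw [← ENNReal.summable.sum_add_tsum_nat_add' (k := j), sum_eq_zero, zero_add]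
    · refine tsum_congr fun n => ?_
      rw [ltToep, if_pos (by omega), Nat.add_sub_cancel]
    · intro i hi
      rw [ltToep, if_neg (by have := mem_range.1 hi; omega)]
      simp
  unfold colNorm
  simp only [h]
  exact ciSup_const

theorem colNorm_fSeries_ne_top {s : ℝ} (hs : s < -1 / 2) :
    colNorm (ltToep (fSeries s 0)) ≠ ⊤ := by
  rw [colNorm_ltToep]
  exact ENNReal.rpow_ne_top_of_nonneg (by norm_num) (summable_coeff_fSeries_sq hs).tsum_ofReal_ne_top

theorem sensitivity_sq {s : ℝ} (hs : s < -1 / 2) :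
    sensitivity s 0 ^ 2 = ∑' n, PowerSeries.coeff n (fSeries s 0) ^ 2 := by
  rw [sensitivity, colNorm_ltToep, ← ENNReal.ofReal_tsum_of_nonneg (fun n => sq_nonneg _)
    (summable_coeff_fSeries_sq hs), ← ENNReal.toReal_rpow,
    ENNReal.toReal_ofReal (tsum_nonneg fun n => sq_nonneg _), ← Real.sqrt_eq_rpow,
    Real.sq_sqrt (tsum_nonneg fun n => sq_nonneg _)]

theorem sensitivity_pos {s : ℝ} (hs : s < -1 / 2) : 0 < sensitivity s 0 := by
  have h0 : 0 ≤ sensitivity s 0 := ENNReal.toReal_nonneg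
  have h1 := (summable_coeff_fSeries_sq hs).sum_le_tsum {0} fun n _ => sq_nonneg _
  rw [← sensitivity_sq hs, sum_singleton, PowerSeries.coeff_zero_eq_constantCoeff_apply,
    constantCoeff_fSeries] at h1
  rcases h0.lt_or_eq with h | h
  · exact h
  · rw [← h] at h1; norm_num at h1

theorem sum_ltToep_mul (f : PowerSeries ℝ) (v : ℕ → ℝ) (t : ℕ) :
    ∑ j ∈ range (t + 1), ltToep f t j * v j =
      PowerSeries.coeff t (PowerSeries.mk v * f) := by
  rw [PowerSeries.coeff_mul, Finset.Nat.sum_antidiagonal_eq_sum_range_succ_mk]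
  refine sum_congr rfl fun j hj => ?_
  rw [ltToep, if_pos (Nat.lt_succ_iff.1 (mem_range.1 hj)), PowerSeries.coeff_mk, mul_comm]

/-- The factorization `L (R x) = A x` of the prefix sums. -/
theorem partialSum_eq (s : ℝ) (x : ℕ → ℝ) (t : ℕ) :
    partialSum x t = ∑ j ∈ range (t + 1), ltToep (fSeries (-s) 0) t j *
      PowerSeries.coeff j (PowerSeries.mk x * fSeries s 0) := by
  have h : PowerSeries.mk (fun j => PowerSeries.coeff j (PowerSeries.mk x * fSeries s 0)) =
      PowerSeries.mk x * fSeries s 0 := by ext; simp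
  rw [sum_ltToep_mul, h, mul_assoc, fSeries_mul_fSeries_neg, coeff_mul_geomSeries, partialSum]
  simp

/-- Neighbouring streams differ by a scalar of modulus at most 1 times X^k, so the difference of
their images under R is that scalar times a column of R. -/
theorem sum_sq_coeff_sub_le {s : ℝ} (hs : s < -1 / 2) {x x' : ℕ → ℝ}
    (hx : ∀ t, x t ∈ Set.Icc (0 : ℝ) 1) (hx' : ∀ t, x' t ∈ Set.Icc (0 : ℝ) 1)
    (h : Neighboring x x') (n : ℕ) :
    ∑ i ∈ range n, (PowerSeries.coeff i (PowerSeries.mk x * fSeries s 0) -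
      PowerSeries.coeff i (PowerSeries.mk x' * fSeries s 0)) ^ 2 ≤ sensitivity s 0 ^ 2 := by
  obtain ⟨k, hk⟩ := h
  have h1 : PowerSeries.mk x - PowerSeries.mk x' =
      PowerSeries.C (x k - x' k) * PowerSeries.X ^ k := by
    ext i
    rw [map_sub, PowerSeries.coeff_mk, PowerSeries.coeff_mk, PowerSeries.coeff_C_mul,
      PowerSeries.coeff_X_pow]
    split_ifs with hi
    · rw [hi, mul_one]
    · rw [hk i hi, sub_self, mul_zero]
  have h2 : (x k - x' k) ^ 2 ≤ 1 := by
    have := hx k; have := hx' k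
    simp only [Set.mem_Icc] at *
    nlinarith
  have h3 : ∀ i, (PowerSeries.coeff i (PowerSeries.mk x * fSeries s 0) -
      PowerSeries.coeff i (PowerSeries.mk x' * fSeries s 0)) ^ 2 ≤
      if k ≤ i then PowerSeries.coeff (i - k) (fSeries s 0) ^ 2 else 0 := by
    intro i
    rw [← map_sub, ← sub_mul, h1, mul_assoc, PowerSeries.coeff_C_mul, PowerSeries.coeff_X_pow_mul',
      mul_pow]
    split_ifs
    · nlinarith [sq_nonneg (PowerSeries.coeff (i - k) (fSeries s 0))]
    · simp
  rw [sensitivity_sq hs]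
  refine (sum_le_sum fun i _ => h3 i).trans ?_
  refine le_trans ?_ ((summable_coeff_fSeries_sq hs).sum_le_tsum (range (n - k))
    fun i _ => sq_nonneg _)
  rw [← sum_filter]
  refine le_of_eq (sum_bij' (fun i _ => i - k) (fun i _ => i + k) ?_ ?_ ?_ ?_ ?_)
  all_goals simp only [mem_filter, mem_range]
  · intro i hi; omega
  · intro i hi; omega
  · intro i hi; omega
  · intro i hi; omega
  · intro i hi; trivial

/-- Writing the prefix sums as L(Rx) moves the input inside L: the mechanism applies L to scaled
Gaussians whose mean alone depends on the input. -/
theorem logMatrixMechanism_eq {s : ℝ} {C : ℝ} (hC : C * sensitivity s 0 ≠ 0) (x ω : ℕ → ℝ)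
    (t : ℕ) :
    logMatrixMechanism s 0 C x ω t = ∑ j ∈ range (t + 1), ltToep (fSeries (-s) 0) t j *
      (C * sensitivity s 0 * (ω j +
        PowerSeries.coeff j (PowerSeries.mk x * fSeries s 0) / (C * sensitivity s 0))) := by
  rw [logMatrixMechanism, partialSum_eq s, neg_zero, ← sum_add_distrib]
  refine sum_congr rfl fun j _ => ?_
  rw [mul_add, mul_div_cancel₀ _ hC]
  ring

/-- Since L is lower triangular, the first n outputs are a fixed linear image `G` of n shifted
Gaussians, with shifts for neighbouring streams differing by at most 1/C in norm. Pulling `E` back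
along `G` reduces privacy to the Gaussian shift bound. -/
theorem isContinualDP_logMatrixMechanism {s : ℝ} (hs : s < -1 / 2) {ε δ : ℝ} (hε : 0 < ε)
    (hδ : 0 < δ) :
    IsContinualDP gaussianTape (logMatrixMechanism s 0 (noiseMultiplier ε δ)) ε δ := by
  intro x x' hx hx' hn n E hE
  set C := noiseMultiplier ε δ with hCdef
  have hC0 : 0 < C := noiseMultiplier_pos hε δ
  have hΔ := sensitivity_pos hs
  have hσ : 0 < C * sensitivity s 0 := mul_pos hC0 hΔ
  set σ := C * sensitivity s 0 with hσdef
  let a : (ℕ → ℝ) → Fin n → ℝ := fun y i =>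
    PowerSeries.coeff (i : ℕ) (PowerSeries.mk y * fSeries s 0) / σ
  let G : (Fin n → ℝ) → Fin n → ℝ := fun v i =>
    ∑ j : Fin n, ltToep (fSeries (-s) 0) i j * (σ * v j)
  have hG : Measurable G := by
    refine measurable_pi_lambda _ fun i => ?_
    simp only [G]
    fun_prop
  have hM : ∀ y ω, (fun i : Fin n => logMatrixMechanism s 0 C y ω i) =
      G ((fun i : Fin n => ω i) + a y) := by
    intro y ω
    funext i
    rw [logMatrixMechanism_eq hσ.ne']
    simp only [G, a, Pi.add_apply]
    rw [Fin.sum_univ_eq_sum_range fun j => ltToep (fSeries (-s) 0) i j * (σ * (ω j +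
      PowerSeries.coeff j (PowerSeries.mk y * fSeries s 0) / σ))]
    -- Entries of L above the diagonal vanish, so all n samples may be included.
    refine sum_subset (range_subset_range.2 i.2) fun j _ hj => ?_
    rw [ltToep, if_neg (by simp at hj; omega), zero_mul]
  have hmR : Measurable fun (ω : ℕ → ℝ) (i : Fin n) => ω i := by fun_prop
  have hP : ∀ y, gaussianTape {ω | (fun i : Fin n => logMatrixMechanism s 0 C y ω i) ∈ E} =
      stdGaussianPi n {v | G (v + a y) ∈ E} := by
    intro y
    have hms : MeasurableSet {v : Fin n → ℝ | G (v + a y) ∈ E} :=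
      (hG.comp (measurable_id.add_const (a y))) hE
    rw [← gaussianTape_map_restrict, Measure.map_apply hmR hms]
    simp only [hM]
    rfl
  rw [hP, hP]
  have hq : ∑ i, (a x i - a x' i) ^ 2 ≤ 1 / C ^ 2 := by
    have h1 := sum_sq_coeff_sub_le hs hx hx' hn n
    have h2 : ∑ i, (a x i - a x' i) ^ 2 = (∑ i ∈ range n,
        (PowerSeries.coeff i (PowerSeries.mk x * fSeries s 0) -
          PowerSeries.coeff i (PowerSeries.mk x' * fSeries s 0)) ^ 2) / σ ^ 2 := by
      rw [sum_div, ← Fin.sum_univ_eq_sum_range fun i =>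
        (PowerSeries.coeff i (PowerSeries.mk x * fSeries s 0) -
          PowerSeries.coeff i (PowerSeries.mk x' * fSeries s 0)) ^ 2 / σ ^ 2]
      refine sum_congr rfl fun i _ => ?_
      simp only [a]
      rw [← sub_div, div_pow]
    rw [h2, div_le_div_iff₀ (by positivity) (by positivity), hσdef, mul_pow, one_mul, mul_comm]
    exact mul_le_mul_of_nonneg_left h1 (by positivity)
  obtain ⟨l, hl0, hl⟩ := exp_noiseMultiplier_le hε hδ hq
  have hmA : MeasurableSet {v : Fin n → ℝ | G (v + a x') ∈ E} :=
    (hG.comp (measurable_id.add_const (a x'))) hE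
  have h := stdGaussianPi_shift_le (fun i => a x i - a x' i) (ε := ε) hl0 hmA
  have hset : {v : Fin n → ℝ | v + (fun i => a x i - a x' i) ∈
      {v : Fin n → ℝ | G (v + a x') ∈ E}} = {v | G (v + a x) ∈ E} := by
    ext v
    have : v + (fun i => a x i - a x' i) + a x' = v + a x := by
      funext i; simp [add_assoc]
    simp only [Set.mem_ofPred_eq, this]
  rw [hset] at h
  exact h.trans (by gcongr)

/-! ### The law and the variance of the noise. -/

theorem gaussianTape_map_sum (c : ℕ → ℝ) (t : ℕ) :
    gaussianTape.map (fun ω => ∑ j ∈ range t, c j * ω j) =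
      gaussianReal 0 (∑ j ∈ range t, Real.toNNReal (c j ^ 2)) := by
  have hind : iIndepFun (fun (j : ℕ) (ω : ℕ → ℝ) => c j * ω j) gaussianTape :=
    iIndepFun_infinitePi (P := fun _ : ℕ => gaussianReal 0 1) (X := fun j x => c j * x)
      fun j => by fun_prop
  have hmeas : ∀ j : ℕ, Measurable fun ω : ℕ → ℝ => c j * ω j := fun j => by fun_prop
  induction t with
  | zero => simp [gaussianReal_zero_var]
  | succ t ih =>
    have h1 := hind.indepFun_sum_range_succ hmeas t
    have h2 : gaussianTape.map (fun ω : ℕ → ℝ => c t * ω t) =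
        gaussianReal 0 (Real.toNNReal (c t ^ 2)) := by
      have h3 : gaussianTape.map (fun ω : ℕ → ℝ => ω t) = gaussianReal 0 1 :=
        Measure.infinitePi_map_eval (fun _ : ℕ => gaussianReal 0 1) t
      have h4 := gaussianReal_map_const_mul (μ := 0) (v := 1) (c t)
      rw [← h3, Measure.map_map (by fun_prop) (by fun_prop)] at h4
      rw [mul_zero, mul_one] at h4
      rw [Real.toNNReal_of_nonneg (sq_nonneg _)]
      exact h4
    have h5 : gaussianTape.map (∑ j ∈ range t, fun ω : ℕ → ℝ => c j * ω j) =
        gaussianReal 0 (∑ j ∈ range t, Real.toNNReal (c j ^ 2)) := by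
      rw [← ih]; congr 1; funext ω; simp
    have h6 := gaussianReal_add_gaussianReal_of_indepFun h1 h5 h2
    rw [sum_range_succ, ← zero_add (0 : ℝ), ← h6]
    congr 1
    funext ω
    simp [sum_range_succ]

/-- The variance of the noise at time step `t + 1`. -/
noncomputable def noiseVariance (s C : ℝ) (t : ℕ) : ℝ≥0 :=
  ∑ j ∈ range (t + 1), Real.toNNReal ((ltToep (fSeries (-s) 0) t j * (C * sensitivity s 0)) ^ 2)

theorem map_noise (s C : ℝ) (x : ℕ → ℝ) (t : ℕ) :
    gaussianTape.map (fun ω => logMatrixMechanism s 0 C x ω t - partialSum x t) =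
      gaussianReal 0 (noiseVariance s C t) := by
  rw [noiseVariance, ← gaussianTape_map_sum]
  congr 1
  funext ω
  rw [logMatrixMechanism, add_sub_cancel_left, neg_zero]
  exact sum_congr rfl fun j _ => by ring

theorem noiseVariance_eq (s C : ℝ) (t : ℕ) :
    (noiseVariance s C t : ℝ) = (C * sensitivity s 0) ^ 2 *
      ∑ n ∈ range (t + 1), PowerSeries.coeff n (fSeries (-s) 0) ^ 2 := by
  rw [noiseVariance, NNReal.coe_sum, ← sum_range_reflect, mul_sum]
  refine sum_congr rfl fun n hn => ?_
  have hn := mem_range.1 hn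
  rw [Real.coe_toNNReal _ (sq_nonneg _), ltToep, if_pos (by omega)]
  have : t - (t + 1 - 1 - n) = n := by omega
  rw [this]; ring

/-- With s = 1/2 + α the sum of squares is O(log^(2s + 1)) = O(log^(2 + 2α)), the square of the
claimed bound. The multiplier C scales out, so the constant depends on α alone. -/
theorem sqrt_noiseVariance_le {α : ℝ} (hα : 0 < α) : ∃ K : ℝ, 0 ≤ K ∧ ∀ C : ℝ, 0 < C →
    ∀ t : ℕ, 1 ≤ t → Real.sqrt (noiseVariance (-1 / 2 - α) C t) ≤
      K * (C * Real.log ((t : ℝ) + 1) ^ (1 + α)) := by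
  obtain ⟨K, hK, h⟩ := sum_coeff_fSeries_sq_le (s := 1 / 2 + α) (by linarith)
  have hs : -(-1 / 2 - α) = 1 / 2 + α := by ring
  have hΔ := sensitivity_pos (s := -1 / 2 - α) (by linarith)
  refine ⟨sensitivity (-1 / 2 - α) 0 * Real.sqrt K, by positivity, fun C hC t ht => ?_⟩
  have hl : 0 ≤ Real.log ((t : ℝ) + 1) := Real.log_nonneg (by linarith [t.cast_nonneg (α := ℝ)])
  rw [noiseVariance_eq, hs]
  refine Real.sqrt_le_iff.2 ⟨by positivity, ?_⟩
  refine (mul_le_mul_of_nonneg_left (h t ht) (by positivity)).trans (le_of_eq ?_)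
  have h1 : (Real.log ((t : ℝ) + 1) ^ (1 + α)) ^ 2 =
      Real.log ((t : ℝ) + 1) ^ (2 * (1 / 2 + α) + 1) := by
    rw [← Real.rpow_natCast, ← Real.rpow_mul hl]
    congr 1; push_cast; ring
  rw [mul_pow, mul_pow, mul_pow, Real.sq_sqrt hK, mul_pow, h1]
  ring

end Privacy

/-! ## Verification of programs -/

/-- The program `p` takes `σ` to `σ'` in at most `T` operations on integers at most `S`. -/
def Runs (θ ω : ℕ → ℝ) (S : ℕ) (p : Program) (σ σ' : Store) (T : ℕ) : Prop :=
  ∃ τ ≤ T, Exec θ ω S p σ σ' τ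

/-- `σ'` differs from `σ` only in the integer variables `V` and the arrays `A`. -/
structure Frame (V A : Finset ℕ) (σ σ' : Store) : Prop where
  ints : ∀ v, v ∉ V → σ'.ints v = σ.ints v
  arrs : ∀ a, a ∉ A → σ'.arrs a = σ.arrs a
  drawn : σ'.drawn = σ.drawn

section Verification

variable {θ ω : ℕ → ℝ} {S : ℕ}

theorem Frame.trans {V A : Finset ℕ} {σ₁ σ₂ σ₃ : Store} (h : Frame V A σ₁ σ₂)
    (h' : Frame V A σ₂ σ₃) : Frame V A σ₁ σ₃ :=
  ⟨fun v hv => (h'.ints v hv).trans (h.ints v hv), fun a ha => (h'.arrs a ha).trans (h.arrs a ha),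
    h'.drawn.trans h.drawn⟩

theorem Frame.mono {V V' A A' : Finset ℕ} {σ σ' : Store} (h : Frame V A σ σ') (hV : V ⊆ V')
    (hA : A ⊆ A') : Frame V' A' σ σ' :=
  ⟨fun v hv => h.ints v fun hv' => hv (hV hv'), fun a ha => h.arrs a fun ha' => ha (hA ha'),
    h.drawn⟩

theorem Frame.putInt (σ : Store) (v n : ℕ) : Frame {v} ∅ σ (σ.putInt v n) :=
  ⟨fun w hw => Function.update_of_ne (by simpa using hw) _ _, fun _ _ => rfl, rfl⟩

theorem Frame.putReal (σ : Store) (a i : ℕ) (r : ℝ) : Frame ∅ {a} σ (σ.putReal a i r) :=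
  ⟨fun _ _ => rfl, fun b hb => Function.update_of_ne (by simpa using hb) _ _, rfl⟩

theorem Runs.mono {p : Program} {σ σ' : Store} {T T' : ℕ} (h : Runs θ ω S p σ σ' T)
    (hT : T ≤ T') : Runs θ ω S p σ σ' T' :=
  let ⟨τ, hτ, he⟩ := h
  ⟨τ, hτ.trans hT, he⟩

theorem Runs.seq {p q : Program} {σ₁ σ₂ σ₃ : Store} {T₁ T₂ : ℕ} (h₁ : Runs θ ω S p σ₁ σ₂ T₁)
    (h₂ : Runs θ ω S q σ₂ σ₃ T₂) : Runs θ ω S (.seq p q) σ₁ σ₃ (T₁ + T₂) :=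
  let ⟨_, hτ₁, he₁⟩ := h₁
  let ⟨_, hτ₂, he₂⟩ := h₂
  ⟨_, Nat.add_le_add hτ₁ hτ₂, .seq he₁ he₂⟩

theorem Runs.skip (σ : Store) : Runs θ ω S .skip σ σ 1 := ⟨1, le_rfl, .skip σ⟩

theorem Runs.setInt {σ : Store} (v : ℕ) (e : IExpr) (h : e.peak σ.ints ≤ S) :
    Runs θ ω S (.setInt v e) σ (σ.putInt v (e.eval σ.ints)) (e.size + 1) :=
  ⟨_, le_rfl, .setInt σ v e h⟩

theorem Runs.setReal {σ : Store} (a : ℕ) (i : IExpr) (e : RExpr) (hi : i.peak σ.ints ≤ S)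
    (he : e.peak σ.ints ≤ S) :
    Runs θ ω S (.setReal a i e) σ (σ.putReal a (i.eval σ.ints) (e.eval θ σ.ints σ.arrs))
      (i.size + e.size + 1) :=
  ⟨_, le_rfl, .setReal σ a i e hi he⟩

theorem Runs.sample {σ : Store} (a : ℕ) (i : IExpr) (hi : i.peak σ.ints ≤ S) :
    Runs θ ω S (.sample a i) σ (σ.draw ω a (i.eval σ.ints)) (i.size + 1) :=
  ⟨_, le_rfl, .sample σ a i hi⟩

theorem Runs.ite_true {e₁ e₂ : IExpr} {p q : Program} {σ σ' : Store} {T : ℕ}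
    (h₁ : e₁.peak σ.ints ≤ S) (h₂ : e₂.peak σ.ints ≤ S) (h : e₁.eval σ.ints < e₂.eval σ.ints)
    (hp : Runs θ ω S p σ σ' T) :
    Runs θ ω S (.ite e₁ e₂ p q) σ σ' (e₁.size + e₂.size + 1 + T) :=
  let ⟨_, hτ, he⟩ := hp
  ⟨_, Nat.add_le_add_left hτ _, .ite_true h₁ h₂ h he⟩

theorem Runs.ite_false {e₁ e₂ : IExpr} {p q : Program} {σ σ' : Store} {T : ℕ}
    (h₁ : e₁.peak σ.ints ≤ S) (h₂ : e₂.peak σ.ints ≤ S) (h : ¬ e₁.eval σ.ints < e₂.eval σ.ints)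
    (hq : Runs θ ω S q σ σ' T) :
    Runs θ ω S (.ite e₁ e₂ p q) σ σ' (e₁.size + e₂.size + 1 + T) :=
  let ⟨_, hτ, he⟩ := hq
  ⟨_, Nat.add_le_add_left hτ _, .ite_false h₁ h₂ h he⟩

theorem Runs.loop_done {e₁ e₂ : IExpr} {p : Program} {σ : Store} (h₁ : e₁.peak σ.ints ≤ S)
    (h₂ : e₂.peak σ.ints ≤ S) (h : ¬ e₁.eval σ.ints < e₂.eval σ.ints) :
    Runs θ ω S (.loop e₁ e₂ p) σ σ (e₁.size + e₂.size + 1) :=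
  ⟨_, le_rfl, .loop_done h₁ h₂ h⟩

theorem Runs.loop_step {e₁ e₂ : IExpr} {p : Program} {σ₁ σ₂ σ₃ : Store} {T₁ T₂ : ℕ}
    (h₁ : e₁.peak σ₁.ints ≤ S) (h₂ : e₂.peak σ₁.ints ≤ S)
    (h : e₁.eval σ₁.ints < e₂.eval σ₁.ints) (hp : Runs θ ω S p σ₁ σ₂ T₁)
    (hl : Runs θ ω S (.loop e₁ e₂ p) σ₂ σ₃ T₂) :
    Runs θ ω S (.loop e₁ e₂ p) σ₁ σ₃ (e₁.size + e₂.size + 1 + T₁ + T₂) :=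
  let ⟨_, hτ₁, he₁⟩ := hp
  let ⟨_, hτ₂, he₂⟩ := hl
  ⟨_, by omega, .loop_step h₁ h₂ h he₁ he₂⟩

/-- Rule for a loop of `d` rounds with invariant `I`. -/
theorem Runs.loop_count {e₁ e₂ : IExpr} {p : Program} (I : ℕ → Store → Prop) {T : ℕ} (d : ℕ)
    (hpeak : ∀ k σ, k ≤ d → I k σ → e₁.peak σ.ints ≤ S ∧ e₂.peak σ.ints ≤ S)
    (hend : ∀ σ, I d σ → ¬ e₁.eval σ.ints < e₂.eval σ.ints)
    (hstep : ∀ k σ, k < d → I k σ → e₁.eval σ.ints < e₂.eval σ.ints ∧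
      ∃ σ', Runs θ ω S p σ σ' T ∧ I (k + 1) σ')
    {σ : Store} (h0 : I 0 σ) :
    ∃ σ', Runs θ ω S (.loop e₁ e₂ p) σ σ' ((e₁.size + e₂.size + 1 + T) * (d + 1)) ∧ I d σ' := by
  suffices H : ∀ j k σ, k + j = d → I k σ →
      ∃ σ', Runs θ ω S (.loop e₁ e₂ p) σ σ' ((e₁.size + e₂.size + 1 + T) * (j + 1)) ∧ I d σ' from
    H d 0 σ (by omega) h0
  intro j
  induction j with
  | zero =>
    intro k σ hk hI
    obtain rfl : k = d := by omega
    obtain ⟨h1, h2⟩ := hpeak k σ le_rfl hI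
    exact ⟨σ, (Runs.loop_done h1 h2 (hend σ hI)).mono (by nlinarith), hI⟩
  | succ j ih =>
    intro k σ hk hI
    obtain ⟨h1, h2⟩ := hpeak k σ (by omega) hI
    obtain ⟨hlt, σ₁, hr, hI₁⟩ := hstep k σ (by omega) hI
    obtain ⟨σ₂, hr₂, hI₂⟩ := ih (k + 1) σ₁ (by omega) hI₁
    exact ⟨σ₂, (Runs.loop_step h1 h2 hlt hr hr₂).mono (by ring_nf; omega), hI₂⟩

/-- `for k = lo, …, hi - 1 do a[k] := e`, where `k` is the integer variable `3`. -/
def fill (lo hi : IExpr) (a : ℕ) (e : RExpr) : Program :=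
  .seq (.setInt 3 lo) (.loop (.var 3) hi
    (.seq (.setReal a (.var 3) e) (.setInt 3 (.add (.var 3) (.lit 1)))))

/-- Hypothesis `he` lets the expression read the cells of `a` that are already filled, so that
recurrences such as prefix sums can be evaluated in place. -/
theorem fill_runs {lo hi : IExpr} {a : ℕ} {e : RExpr} {σ : Store} (l H K : ℕ) (F : ℕ → ℝ)
    (hlo : lo.eval σ.ints = l) (hlp : lo.peak σ.ints ≤ S) (hlH : l ≤ H) (hHS : H < S)
    (hhi : ∀ s' : ℕ → ℕ, (∀ v, v ≠ 3 → s' v = σ.ints v) → hi.eval s' = H ∧ hi.peak s' ≤ S)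
    (hK : e.size + lo.size + hi.size + 12 ≤ K)
    (he : ∀ k, l ≤ k → k < H → ∀ (s' : ℕ → ℕ) (m' : ℕ → ℕ → ℝ), s' 3 = k →
      (∀ v, v ≠ 3 → s' v = σ.ints v) → (∀ b, b ≠ a → m' b = σ.arrs b) →
      (∀ i, m' a i = if l ≤ i ∧ i < k then F i else σ.arrs a i) →
      e.eval θ s' m' = F k ∧ e.peak s' ≤ S) :
    ∃ σ', Runs θ ω S (fill lo hi a e) σ σ' (K * (H + 2)) ∧ Frame {3} {a} σ σ' ∧
      ∀ i, σ'.arrs a i = if l ≤ i ∧ i < H then F i else σ.arrs a i := by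
  let I : ℕ → Store → Prop := fun j τ => τ.ints 3 = l + j ∧ Frame {3} {a} σ τ ∧
    ∀ i, τ.arrs a i = if l ≤ i ∧ i < l + j then F i else σ.arrs a i
  have h1 : Runs θ ω S (.setInt 3 lo) σ (σ.putInt 3 l) (lo.size + 1) := by
    have := Runs.setInt (θ := θ) (ω := ω) (σ := σ) 3 lo hlp
    rwa [hlo] at this
  have hframe : ∀ {τ : Store}, Frame {3} {a} σ τ → ∀ v, v ≠ 3 → τ.ints v = σ.ints v :=
    fun h v hv => h.ints v (by simpa using hv)
  have hI0 : I 0 (σ.putInt 3 l) := by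
    refine ⟨by simp [Store.putInt], (Frame.putInt σ 3 l).mono subset_rfl (by simp), fun i => ?_⟩
    rw [if_neg (by omega)]; rfl
  have hloop := Runs.loop_count (θ := θ) (ω := ω) (S := S) (e₁ := .var 3) (e₂ := hi)
    (p := .seq (.setReal a (.var 3) e) (.setInt 3 (.add (.var 3) (.lit 1)))) I (H - l)
    (T := e.size + 6) ?_ ?_ ?_ hI0
  · obtain ⟨σ', hr, hI⟩ := hloop
    refine ⟨σ', (h1.seq hr).mono ?_, hI.2.1, fun i => ?_⟩
    · have : (IExpr.var 3).size = 1 := rfl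
      rw [this]
      calc lo.size + 1 + (1 + hi.size + 1 + (e.size + 6)) * (H - l + 1)
          ≤ K * 1 + K * (H + 1) := by
            refine Nat.add_le_add (by omega) (Nat.mul_le_mul (by omega) (by omega))
        _ = K * (H + 2) := by ring
    · rw [hI.2.2 i, Nat.add_sub_cancel' hlH]
  · intro k τ hk hI
    refine ⟨?_, (hhi _ (hframe hI.2.1)).2⟩
    simp only [IExpr.peak, hI.1]; omega
  · intro τ hI
    rw [(hhi _ (hframe hI.2.1)).1]
    simp only [IExpr.eval, hI.1]; omega
  · intro k τ hk hI
    obtain ⟨hI1, hI2, hI3⟩ := hI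
    obtain ⟨hev, hpk⟩ := he (l + k) (by omega) (by omega) τ.ints τ.arrs hI1 (hframe hI2)
      (fun b hb => hI2.arrs b (by simpa using hb)) hI3
    refine ⟨?_, ?_⟩
    · rw [(hhi _ (hframe hI2)).1]
      simp only [IExpr.eval, hI1]; omega
    · have r1 : Runs θ ω S (.setReal a (.var 3) e) τ (τ.putReal a (l + k) (F (l + k)))
          (1 + e.size + 1) := by
        have := Runs.setReal (θ := θ) (ω := ω) (S := S) (σ := τ) a (.var 3) e
          (by simp only [IExpr.peak, hI1]; omega) hpk
        simp only [IExpr.eval] at this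
        rw [hev, hI1] at this
        exact this
      have r2 : Runs θ ω S (.setInt 3 (.add (.var 3) (.lit 1)))
          (τ.putReal a (l + k) (F (l + k)))
          ((τ.putReal a (l + k) (F (l + k))).putInt 3 (l + (k + 1))) 4 := by
        have := Runs.setInt (θ := θ) (ω := ω) (S := S) (σ := τ.putReal a (l + k) (F (l + k)))
          3 (.add (.var 3) (.lit 1)) (by
            simp only [IExpr.peak, IExpr.eval, Store.putReal, hI1]; omega)
        simp only [IExpr.eval] at this
        have h3 : (τ.putReal a (l + k) (F (l + k))).ints 3 = l + k := hI1
        rw [h3] at this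
        exact this
      refine ⟨_, (r1.seq r2).mono (by omega), by simp [Store.putInt], ?_, fun i => ?_⟩
      · exact hI2.trans (((Frame.putReal τ a _ _).mono (by simp) subset_rfl).trans
          ((Frame.putInt _ 3 _).mono subset_rfl (by simp)))
      · simp only [Store.putInt, Store.putReal, Function.update_self]
        by_cases hi : i = l + k
        · subst hi
          rw [Function.update_self, if_pos (by omega)]
        · rw [Function.update_of_ne hi, hI3 i]
          by_cases h : l ≤ i ∧ i < l + k
          · rw [if_pos h, if_pos (by omega)]
          · rw [if_neg h, if_neg (by omega)]

/-- `for k = lo, …, hi - 1 do a[k] := fresh sample`. -/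
def sampleFill (lo hi : IExpr) (a : ℕ) : Program :=
  .seq (.setInt 3 lo) (.loop (.var 3) hi
    (.seq (.sample a (.var 3)) (.setInt 3 (.add (.var 3) (.lit 1)))))

/-- The hypothesis on `drawn` aligns the tape with the array, so that cell k receives exactly `ω k`.
-/
theorem sampleFill_runs {lo hi : IExpr} {a : ℕ} {σ : Store} (l H K : ℕ)
    (hlo : lo.eval σ.ints = l) (hlp : lo.peak σ.ints ≤ S) (hlH : l ≤ H) (hHS : H < S)
    (hhi : ∀ s' : ℕ → ℕ, (∀ v, v ≠ 3 → s' v = σ.ints v) → hi.eval s' = H ∧ hi.peak s' ≤ S)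
    (hK : lo.size + hi.size + 12 ≤ K) (hd : σ.drawn = l) :
    ∃ σ', Runs θ ω S (sampleFill lo hi a) σ σ' (K * (H + 2)) ∧
      (∀ v, v ≠ 3 → σ'.ints v = σ.ints v) ∧ (∀ b, b ≠ a → σ'.arrs b = σ.arrs b) ∧
      σ'.drawn = H ∧
      ∀ i, σ'.arrs a i = if l ≤ i ∧ i < H then ω i else σ.arrs a i := by
  let I : ℕ → Store → Prop := fun j τ => τ.ints 3 = l + j ∧
    (∀ v, v ≠ 3 → τ.ints v = σ.ints v) ∧ (∀ b, b ≠ a → τ.arrs b = σ.arrs b) ∧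
    τ.drawn = l + j ∧
    ∀ i, τ.arrs a i = if l ≤ i ∧ i < l + j then ω i else σ.arrs a i
  have h1 : Runs θ ω S (.setInt 3 lo) σ (σ.putInt 3 l) (lo.size + 1) := by
    have := Runs.setInt (θ := θ) (ω := ω) (σ := σ) 3 lo hlp
    rwa [hlo] at this
  have hI0 : I 0 (σ.putInt 3 l) := by
    refine ⟨by simp [Store.putInt], fun v hv => by simp [Store.putInt, hv], fun b _ => rfl,
      hd, fun i => ?_⟩
    rw [if_neg (by omega)]; rfl
  have hloop := Runs.loop_count (θ := θ) (ω := ω) (S := S) (e₁ := .var 3) (e₂ := hi)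
    (p := .seq (.sample a (.var 3)) (.setInt 3 (.add (.var 3) (.lit 1)))) I (H - l)
    (T := 6) ?_ ?_ ?_ hI0
  · obtain ⟨σ', hr, hI⟩ := hloop
    refine ⟨σ', (h1.seq hr).mono ?_, hI.2.1, hI.2.2.1, ?_, fun i => ?_⟩
    · have : (IExpr.var 3).size = 1 := rfl
      rw [this]
      calc lo.size + 1 + (1 + hi.size + 1 + 6) * (H - l + 1)
          ≤ K * 1 + K * (H + 1) := by
            refine Nat.add_le_add (by omega) (Nat.mul_le_mul (by omega) (by omega))
        _ = K * (H + 2) := by ring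
    · rw [hI.2.2.2.1, Nat.add_sub_cancel' hlH]
    · rw [hI.2.2.2.2 i, Nat.add_sub_cancel' hlH]
  · intro k τ hk hI
    refine ⟨?_, (hhi _ hI.2.1).2⟩
    simp only [IExpr.peak, hI.1]; omega
  · intro τ hI
    rw [(hhi _ hI.2.1).1]
    simp only [IExpr.eval, hI.1]; omega
  · intro k τ hk hI
    obtain ⟨hI1, hI2, hI3, hI4, hI5⟩ := hI
    refine ⟨?_, ?_⟩
    · rw [(hhi _ hI2).1]
      simp only [IExpr.eval, hI1]; omega
    · have r1 : Runs θ ω S (.sample a (.var 3)) τ (τ.draw ω a (l + k)) 2 := by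
        have := Runs.sample (θ := θ) (ω := ω) (S := S) (σ := τ) a (.var 3)
          (by simp only [IExpr.peak, hI1]; omega)
        simp only [IExpr.eval] at this
        rw [hI1] at this
        exact this
      have r2 : Runs θ ω S (.setInt 3 (.add (.var 3) (.lit 1))) (τ.draw ω a (l + k))
          ((τ.draw ω a (l + k)).putInt 3 (l + (k + 1))) 4 := by
        have := Runs.setInt (θ := θ) (ω := ω) (S := S) (σ := τ.draw ω a (l + k))
          3 (.add (.var 3) (.lit 1)) (by
            simp only [IExpr.peak, IExpr.eval, Store.draw, Store.putReal, hI1]; omega)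
        simp only [IExpr.eval] at this
        have h3 : (τ.draw ω a (l + k)).ints 3 = l + k := hI1
        rw [h3] at this
        exact this
      refine ⟨_, (r1.seq r2).mono (by omega), by simp [Store.putInt], fun v hv => ?_,
        fun b hb => ?_, ?_, fun i => ?_⟩
      · simp only [Store.putInt, Store.draw, Store.putReal, Function.update_of_ne hv, hI2 v hv]
      · simp only [Store.putInt, Store.draw, Store.putReal, Function.update_of_ne hb, hI3 b hb]
      · simp only [Store.putInt, Store.draw, hI4]; omega
      · simp only [Store.putInt, Store.draw, Store.putReal, Function.update_self, hI4]
        by_cases hi : i = l + k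
        · subst hi
          rw [Function.update_self, if_pos (by omega)]
        · rw [Function.update_of_ne hi, hI5 i]
          by_cases h : l ≤ i ∧ i < l + k
          · rw [if_pos h, if_pos (by omega)]
          · rw [if_neg h, if_neg (by omega)]

end Verification

/-! ## A fast Fourier transform modulo `X ^ n - i` -/

section FourierAlgebra

open Finset Complex

/-- A square root on the unit circle without `-1`, in terms of real square roots. -/
noncomputable def circleSqrt (z : ℂ) : ℂ :=
  ⟨Real.sqrt ((1 + z.re) / 2), z.im / (2 * Real.sqrt ((1 + z.re) / 2))⟩

/-- Half-angle formulas for cosine and sine; z ≠ -1 keeps the denominator nonzero. -/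
theorem circleSqrt_sq {z : ℂ} (hz : z.re ^ 2 + z.im ^ 2 = 1) (h : z ≠ -1) :
    circleSqrt z ^ 2 = z ∧ (circleSqrt z).re ^ 2 + (circleSqrt z).im ^ 2 = 1 := by
  have hre : 0 < 1 + z.re := by
    have h1 : -1 ≤ z.re := by nlinarith [sq_nonneg z.im]
    rcases h1.lt_or_eq with h2 | h2
    · linarith
    · refine absurd (Complex.ext h2.symm ?_) h
      rw [← h2] at hz
      have : z.im = 0 := by nlinarith
      simpa using this
  set a := Real.sqrt ((1 + z.re) / 2) with ha
  have ha0 : 0 < a := Real.sqrt_pos.2 (by linarith)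
  have ha2 : a ^ 2 = (1 + z.re) / 2 := Real.sq_sqrt (by linarith)
  have hb : (z.im / (2 * a)) ^ 2 = (1 - z.re) / 2 := by
    rw [div_pow, mul_pow, ha2, div_eq_iff (by positivity)]
    nlinarith
  constructor
  · refine Complex.ext ?_ ?_
    · rw [sq, mul_re]
      simp only [circleSqrt, ← ha]
      nlinarith
    · rw [sq, mul_im]
      simp only [circleSqrt, ← ha]
      field_simp
      ring
  · simp only [circleSqrt, ← ha]
    rw [ha2, hb]; ring

/-- The roots of the moduli: the residue ring modulo `X ^ (2 * m) - twiddle j` splits into those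
modulo `X ^ m - twiddle (2 * j)` and `X ^ m - twiddle (2 * j + 1)`, and `twiddle 1 = i`. -/
noncomputable def twiddle : ℕ → ℂ
  | 0 => 1
  | 1 => I
  | k + 2 => ((1 - 2 * (((k + 2) % 2 : ℕ) : ℝ) : ℝ) : ℂ) * circleSqrt (twiddle ((k + 2) / 2))
decreasing_by omega

theorem twiddle_zero : twiddle 0 = 1 := by rw [twiddle]

theorem twiddle_one : twiddle 1 = I := by rw [twiddle]

theorem twiddle_rec {k : ℕ} (hk : 2 ≤ k) :
    twiddle k = ((1 - 2 * ((k % 2 : ℕ) : ℝ) : ℝ) : ℂ) * circleSqrt (twiddle (k / 2)) := by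
  obtain ⟨k, rfl⟩ : ∃ m, k = m + 2 := ⟨k - 2, by omega⟩
  rw [twiddle]

/-- Repeated squaring of -1 reaches only -1 and 1. This keeps the twiddle factors off the point
where `circleSqrt` fails. -/
theorem ne_neg_one_of_pow_eq_I {z : ℂ} {e : ℕ} (h : z ^ (2 ^ e) = I) : z ≠ -1 := by
  rintro rfl
  cases e with
  | zero => rw [pow_zero, pow_one] at h; simpa using congrArg Complex.im h
  | succ e =>
    rw [pow_succ, mul_comm, pow_mul, neg_one_sq, one_pow] at h
    simpa using congrArg Complex.im h

theorem twiddle_spec (k : ℕ) (hk : 1 ≤ k) :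
    (twiddle k).re ^ 2 + (twiddle k).im ^ 2 = 1 ∧ (∃ e, twiddle k ^ (2 ^ e) = I) ∧
      (2 ≤ k → twiddle k ^ 2 = twiddle (k / 2)) := by
  induction k using Nat.strong_induction_on with
  | _ k ih =>
    rcases hk.lt_or_eq with h2 | h1
    · obtain ⟨hn, ⟨e, he⟩, -⟩ := ih (k / 2) (by omega) (by omega)
      obtain ⟨hs, hns⟩ := circleSqrt_sq hn (ne_neg_one_of_pow_eq_I he)
      have hsq : ((1 - 2 * ((k % 2 : ℕ) : ℝ) : ℝ)) ^ 2 = 1 := by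
        rcases Nat.mod_two_eq_zero_or_one k with h | h <;> rw [h] <;> norm_num
      have h3 : twiddle k ^ 2 = twiddle (k / 2) := by
        rw [twiddle_rec h2, mul_pow, hs, ← ofReal_pow, hsq, ofReal_one, one_mul]
      refine ⟨?_, ⟨e + 1, ?_⟩, fun _ => h3⟩
      · rw [twiddle_rec h2, re_ofReal_mul, im_ofReal_mul, mul_pow, mul_pow, hsq, one_mul, one_mul,
          hns]
      · rw [pow_succ', pow_mul, h3, he]
    · rw [← h1, twiddle_one]
      refine ⟨by simp, ⟨0, by simp⟩, by omega⟩

theorem twiddle_sq {j s : ℕ} (hj : 1 ≤ j) (hs : s < 2) : twiddle (2 * j + s) ^ 2 = twiddle j := by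
  have h : (2 * j + s) / 2 = j := by omega
  rw [(twiddle_spec (2 * j + s) (by omega)).2.2 (by omega), h]

theorem twiddle_succ {j : ℕ} (hj : 1 ≤ j) : twiddle (2 * j + 1) = -twiddle (2 * j) := by
  rw [twiddle_rec (k := 2 * j + 1) (by omega), twiddle_rec (k := 2 * j) (by omega)]
  have h1 : (2 * j + 1) % 2 = 1 := by omega
  have h2 : (2 * j) % 2 = 0 := by omega
  have h3 : (2 * j + 1) / 2 = j := by omega
  have h4 : (2 * j) / 2 = j := by omega
  rw [h1, h2, h3, h4]
  push_cast; ring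

theorem twiddle_mul_conj {j : ℕ} (hj : 1 ≤ j) : twiddle j * (starRingEnd ℂ) (twiddle j) = 1 := by
  rw [mul_conj, normSq_apply]
  have := (twiddle_spec j hj).1
  rw [← sq, ← sq, this, ofReal_one]

/-- The indices form a binary heap in which squaring a twiddle factor leads to its parent; l
squarings lead from level l to the root i. -/
theorem twiddle_pow (l : ℕ) : ∀ q, q < 2 ^ l → twiddle (2 ^ l + q) ^ (2 ^ l) = I := by
  induction l with
  | zero =>
    intro q hq
    obtain rfl : q = 0 := by simpa using hq
    simp [twiddle_one]
  | succ l ih =>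
    intro q hq
    rw [pow_succ] at hq
    have hp : 0 < 2 ^ l := by positivity
    have h1 : 2 ^ (l + 1) + q = 2 * (2 ^ l + q / 2) + q % 2 := by rw [pow_succ]; omega
    rw [pow_succ' 2 l, pow_mul, ← pow_succ' 2 l, h1, twiddle_sq (by omega) (by omega)]
    exact ih (q / 2) (by omega)

/-- The coefficient of `X ^ r` in the residue of `∑ i < c * m, P i * X ^ i` modulo
`X ^ m - twiddle j`. -/
noncomputable def residue (m c : ℕ) (P : ℕ → ℂ) (j r : ℕ) : ℂ :=
  ∑ q ∈ range c, P (m * q + r) * twiddle j ^ q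

theorem sum_range_two_mul {M : Type*} [AddCommMonoid M] (f : ℕ → M) (c : ℕ) :
    ∑ q ∈ range (2 * c), f q = ∑ q ∈ range c, (f (2 * q) + f (2 * q + 1)) := by
  induction c with
  | zero => simp
  | succ c ih =>
    rw [Nat.mul_succ, sum_range_succ, sum_range_succ, ih, sum_range_succ, add_assoc]

/-- The butterfly: modulo X^h - w with w² = `twiddle j`, the power X^h becomes w, so the upper half
is folded onto the lower one with weight w. -/
theorem residue_split {h c : ℕ} (P : ℕ → ℂ) {j s : ℕ} (hj : 1 ≤ j) (hs : s < 2) (r : ℕ) :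
    residue h (2 * c) P (2 * j + s) r = residue (2 * h) c P j r +
      twiddle (2 * j + s) * residue (2 * h) c P j (r + h) := by
  rw [residue, sum_range_two_mul, residue, residue, mul_sum, ← sum_add_distrib]
  refine sum_congr rfl fun q _ => ?_
  have e1 : h * (2 * q) + r = 2 * h * q + r := by ring
  have e2 : h * (2 * q + 1) + r = 2 * h * q + (r + h) := by ring
  rw [e1, e2, pow_succ, pow_mul, twiddle_sq hj hs]
  ring

theorem residue_merge_low {h c : ℕ} (P : ℕ → ℂ) {j : ℕ} (hj : 1 ≤ j) (r : ℕ) :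
    residue (2 * h) c P j r =
      (residue h (2 * c) P (2 * j) r + residue h (2 * c) P (2 * j + 1) r) / 2 := by
  have h1 := residue_split (h := h) (c := c) P hj (s := 0) (by norm_num) r
  rw [add_zero] at h1
  rw [h1, residue_split P hj (by norm_num), twiddle_succ hj]
  ring

/-- The difference of the two butterfly equations. Twiddle factors have modulus 1, so dividing by
one is multiplying by its conjugate. -/
theorem residue_merge_high {h c : ℕ} (P : ℕ → ℂ) {j : ℕ} (hj : 1 ≤ j) (r : ℕ) :
    residue (2 * h) c P j (r + h) =
      (residue h (2 * c) P (2 * j) r * (starRingEnd ℂ) (twiddle (2 * j)) +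
        residue h (2 * c) P (2 * j + 1) r * (starRingEnd ℂ) (twiddle (2 * j + 1))) / 2 := by
  have h1 := residue_split (h := h) (c := c) P hj (s := 0) (by norm_num) r
  rw [add_zero] at h1
  rw [h1, residue_split P hj (by norm_num), twiddle_succ hj, map_neg]
  linear_combination (-residue (2 * h) c P j (r + h)) * twiddle_mul_conj (j := 2 * j) (by omega)

/-- The product of two polynomials of degree less than `n`, reduced modulo `X ^ n - i`. -/
noncomputable def cyclicMul (n : ℕ) (P Q : ℕ → ℂ) (k : ℕ) : ℂ :=
  ∑ a ∈ range n, ∑ b ∈ range n, if (a + b) % n = k then P a * Q b * I ^ ((a + b) / n) else 0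

/-- A residue modulo a linear factor is the value at a root x of X^n = i, and reducing the exponent
a + b modulo n costs exactly the power of i built into `cyclicMul`. -/
theorem residue_cyclicMul (l : ℕ) (P Q : ℕ → ℂ) {q : ℕ} (hq : q < 2 ^ l) :
    residue 1 (2 ^ l) (cyclicMul (2 ^ l) P Q) (2 ^ l + q) 0 =
      residue 1 (2 ^ l) P (2 ^ l + q) 0 * residue 1 (2 ^ l) Q (2 ^ l + q) 0 := by
  have hx := twiddle_pow l q hq
  set x := twiddle (2 ^ l + q)
  have hn : 0 < 2 ^ l := by positivity
  set n := 2 ^ l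
  simp only [residue, one_mul, add_zero]
  rw [sum_mul_sum]
  simp only [cyclicMul, sum_mul]
  rw [sum_comm]
  refine sum_congr rfl fun a _ => ?_
  rw [sum_comm]
  refine sum_congr rfl fun b _ => ?_
  rw [sum_eq_single ((a + b) % n)]
  · rw [if_pos rfl]
    have h1 : x ^ a * x ^ b = I ^ ((a + b) / n) * x ^ ((a + b) % n) := by
      rw [← pow_add, ← hx, ← pow_mul, ← pow_add, Nat.div_add_mod]
    calc P a * Q b * I ^ ((a + b) / n) * x ^ ((a + b) % n) =
        P a * Q b * (I ^ ((a + b) / n) * x ^ ((a + b) % n)) := by ring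
      _ = _ := by rw [← h1]; ring
  · intro k _ hk
    rw [if_neg (Ne.symm hk), zero_mul]
  · intro h
    exact absurd (mem_range.2 (Nat.mod_lt _ hn)) h

/-- For real inputs the terms that wrap around carry a factor i and are imaginary. The real part is
therefore the ordinary truncated product, without padding to length 2n. -/
theorem cyclicMul_re {n k : ℕ} (hk : k < n) (p q : ℕ → ℝ) :
    (cyclicMul n (fun i => (p i : ℂ)) (fun i => (q i : ℂ)) k).re =
      PowerSeries.coeff k (PowerSeries.mk p * PowerSeries.mk q) := by
  rw [PowerSeries.coeff_mul, Finset.Nat.sum_antidiagonal_eq_sum_range_succ_mk, cyclicMul, re_sum]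
  simp only [PowerSeries.coeff_mk]
  rw [← sum_subset (range_subset_range.2 (show k + 1 ≤ n by omega))]
  · refine sum_congr rfl fun a ha => ?_
    have ha := mem_range.1 ha
    rw [re_sum, sum_eq_single (k - a)]
    · have h1 : a + (k - a) = k := by omega
      rw [h1, Nat.mod_eq_of_lt hk, if_pos rfl, Nat.div_eq_of_lt hk, pow_zero, mul_one,
        ← ofReal_mul, ofReal_re]
    · intro b hb hne
      have hb := mem_range.1 hb
      split_ifs with h
      · rcases lt_or_ge (a + b) n with h2 | h2
        · rw [Nat.mod_eq_of_lt h2] at h; omega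
        · have h3 : (a + b) / n = 1 := by
            rw [Nat.div_eq_iff (by omega)]; omega
          rw [h3, pow_one, ← ofReal_mul, re_ofReal_mul, I_re, mul_zero]
      · rfl
    · intro h; exact absurd (mem_range.2 (by omega)) h
  · intro a ha hna
    have ha := mem_range.1 ha
    simp only [mem_range, not_lt] at hna
    rw [re_sum]
    refine sum_eq_zero fun b hb => ?_
    have hb := mem_range.1 hb
    split_ifs with h
    · rcases lt_or_ge (a + b) n with h2 | h2
      · rw [Nat.mod_eq_of_lt h2] at h; omega
      · have h3 : (a + b) / n = 1 := by
          rw [Nat.div_eq_iff (by omega)]; omega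
        rw [h3, pow_one, ← ofReal_mul, re_ofReal_mul, I_re, mul_zero]
    · rfl

end FourierAlgebra

/-! ## Fast multiplication of power series as a program -/

theorem RExpr.eval_congr {θ : ℕ → ℝ} {s : ℕ → ℕ} {m m' : ℕ → ℕ → ℝ} {e : RExpr}
    (h : ∀ a ∈ e.arrays, m' a = m a) : e.eval θ s m' = e.eval θ s m := by
  induction e with
  | param k => rfl
  | cell a i => simp only [RExpr.eval, h a (by simp [RExpr.arrays])]
  | ofInt i => rfl
  | add x y hx hy | sub x y hx hy | mul x y hx hy | div x y hx hy =>
    simp only [RExpr.eval, hx fun a ha => h a (by simp [RExpr.arrays, ha]),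
      hy fun a ha => h a (by simp [RExpr.arrays, ha])]
  | sqrt x hx => simp only [RExpr.eval, hx fun a ha => h a (by simp [RExpr.arrays, ha])]

section Multiplication

variable {θ ω : ℕ → ℝ} {S : ℕ}

theorem eq_update_of_agree {s s' : ℕ → ℕ} {k : ℕ} (h3 : s' 3 = k)
    (h : ∀ v, v ≠ 3 → s' v = s v) : s' = Function.update s 3 k := by
  funext v
  by_cases hv : v = 3
  · subst hv; rw [h3, Function.update_self]
  · rw [h v hv, Function.update_of_ne hv]

/-- `fill` with an expression that does not read the array that is filled. -/
theorem fill_runs_of_notMem {lo hi : IExpr} {a : ℕ} {e : RExpr} {σ : Store} (l H K : ℕ)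
    (hlo : lo.eval σ.ints = l) (hlp : lo.peak σ.ints ≤ S) (hlH : l ≤ H) (hHS : H < S)
    (hhi : ∀ s' : ℕ → ℕ, (∀ v, v ≠ 3 → s' v = σ.ints v) → hi.eval s' = H ∧ hi.peak s' ≤ S)
    (hK : e.size + lo.size + hi.size + 12 ≤ K) (ha : a ∉ e.arrays)
    (he : ∀ k, l ≤ k → k < H → e.peak (Function.update σ.ints 3 k) ≤ S) :
    ∃ σ', Runs θ ω S (fill lo hi a e) σ σ' (K * (H + 2)) ∧ Frame {3} {a} σ σ' ∧
      ∀ i, σ'.arrs a i = if l ≤ i ∧ i < H then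
        e.eval θ (Function.update σ.ints 3 i) σ.arrs else σ.arrs a i := by
  refine fill_runs l H K (fun k => e.eval θ (Function.update σ.ints 3 k) σ.arrs)
    hlo hlp hlH hHS hhi hK ?_
  intro k hlk hkH s' m' h3 hs hm _
  rw [eq_update_of_agree h3 hs]
  refine ⟨RExpr.eval_congr fun b hb => hm b ?_, he k hlk hkH⟩
  rintro rfl
  exact ha hb

/-- Fill `a[0], …, a[n - 1]`, where `n` is the integer variable `2`. -/
def fillAll (a : ℕ) (e : RExpr) : Program := fill (.lit 0) (.var 2) a e

theorem fillAll_runs {a : ℕ} {e : RExpr} {σ : Store} (n K : ℕ) (hn : σ.ints 2 = n) (hnS : n < S)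
    (hK : e.size + 14 ≤ K) (ha : a ∉ e.arrays)
    (he : ∀ k, k < n → e.peak (Function.update σ.ints 3 k) ≤ S) :
    ∃ σ', Runs θ ω S (fillAll a e) σ σ' (K * (n + 2)) ∧ Frame {3} {a} σ σ' ∧
      ∀ i, i < n → σ'.arrs a i = e.eval θ (Function.update σ.ints 3 i) σ.arrs := by
  obtain ⟨σ', h1, h2, h3⟩ := fill_runs_of_notMem (θ := θ) (ω := ω) (S := S) (lo := .lit 0)
    (hi := .var 2) (a := a) (e := e) (σ := σ) 0 n K rfl (Nat.zero_le _) (Nat.zero_le _) hnS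
    (fun s' hs => ⟨(hs 2 (by norm_num)).trans hn, by simp only [IExpr.peak, hs 2 (by norm_num), hn]; omega⟩)
    (by simp only [IExpr.size]; omega) ha (fun k _ hk => he k hk)
  exact ⟨σ', h1, h2, fun i hi => by rw [h3 i, if_pos ⟨Nat.zero_le _, hi⟩]⟩

/-- Replace the complex array `(ar, ai)` by the values of `(eRe, eIm)`, through the temporary arrays
`13` and `14`. -/
def stage (eRe eIm : RExpr) (ar ai : ℕ) : Program :=
  .seq (fillAll 13 eRe) (.seq (fillAll 14 eIm)
    (.seq (fillAll ar (.cell 13 (.var 3))) (fillAll ai (.cell 14 (.var 3)))))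

/-- Both expressions may read `ar` and `ai`, so neither array is overwritten until both results are
stored in the temporary arrays. -/
theorem stage_runs {eRe eIm : RExpr} {ar ai : ℕ} {σ : Store} (n K : ℕ) (hn : σ.ints 2 = n)
    (hnS : n < S) (hK₁ : eRe.size + 14 ≤ K) (hK₂ : eIm.size + 14 ≤ K) (hK : 20 ≤ K)
    (h13 : 13 ∉ eRe.arrays) (h13' : 13 ∉ eIm.arrays) (h14 : 14 ∉ eIm.arrays)
    (har : ar ≠ 13) (har' : ar ≠ 14) (hai : ai ≠ 14) (hra : ar ≠ ai)
    (he₁ : ∀ k, k < n → eRe.peak (Function.update σ.ints 3 k) ≤ S)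
    (he₂ : ∀ k, k < n → eIm.peak (Function.update σ.ints 3 k) ≤ S) :
    ∃ σ', Runs θ ω S (stage eRe eIm ar ai) σ σ' (4 * (K * (n + 2))) ∧
      Frame {3} {13, 14, ar, ai} σ σ' ∧
      (∀ i, i < n → σ'.arrs ar i = eRe.eval θ (Function.update σ.ints 3 i) σ.arrs) ∧
      ∀ i, i < n → σ'.arrs ai i = eIm.eval θ (Function.update σ.ints 3 i) σ.arrs := by
  obtain ⟨σ₁, r₁, f₁, v₁⟩ := fillAll_runs (θ := θ) (ω := ω) (S := S) (a := 13) (e := eRe)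
    (σ := σ) n K hn hnS hK₁ h13 he₁
  have hup : ∀ {σ' : Store}, Frame {3} {13} σ σ' → ∀ k,
      Function.update σ'.ints 3 k = Function.update σ.ints 3 k := by
    intro σ' f k
    refine eq_update_of_agree (Function.update_self ..) fun v hv => ?_
    rw [Function.update_of_ne hv, f.ints v (by simpa using hv)]
  obtain ⟨σ₂, r₂, f₂, v₂⟩ := fillAll_runs (θ := θ) (ω := ω) (S := S) (a := 14) (e := eIm)
    (σ := σ₁) n K ((f₁.ints 2 (by simp)).trans hn) hnS hK₂ h14
    (fun k hk => by rw [hup f₁]; exact he₂ k hk)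
  have hpk : ∀ (s : ℕ → ℕ) (k c : ℕ), k < n →
      (RExpr.cell c (.var 3)).peak (Function.update s 3 k) ≤ S := by
    intro s k c hk
    simp only [RExpr.peak, IExpr.peak, Function.update_self]; omega
  obtain ⟨σ₃, r₃, f₃, v₃⟩ := fillAll_runs (θ := θ) (ω := ω) (S := S) (a := ar)
    (e := .cell 13 (.var 3)) (σ := σ₂) n K
    ((f₂.ints 2 (by simp)).trans ((f₁.ints 2 (by simp)).trans hn)) hnS
    (by simp only [RExpr.size, IExpr.size]; omega) (by simpa [RExpr.arrays] using har)
    (fun k hk => hpk _ _ _ hk)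
  obtain ⟨σ₄, r₄, f₄, v₄⟩ := fillAll_runs (θ := θ) (ω := ω) (S := S) (a := ai)
    (e := .cell 14 (.var 3)) (σ := σ₃) n K
    ((f₃.ints 2 (by simp)).trans ((f₂.ints 2 (by simp)).trans ((f₁.ints 2 (by simp)).trans hn)))
    hnS (by simp only [RExpr.size, IExpr.size]; omega) (by simpa [RExpr.arrays] using hai)
    (fun k hk => hpk _ _ _ hk)
  refine ⟨σ₄, (r₁.seq (r₂.seq (r₃.seq r₄))).mono (by omega), ?_, fun i hi => ?_, fun i hi => ?_⟩
  · exact (f₁.mono subset_rfl (by simp)).trans ((f₂.mono subset_rfl (by simp)).trans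
      ((f₃.mono subset_rfl (by simp)).trans (f₄.mono subset_rfl (by simp))))
  · rw [f₄.arrs ar (by simpa using hra), v₃ i hi]
    simp only [RExpr.eval, IExpr.eval, Function.update_self]
    rw [f₂.arrs 13 (by simp), v₁ i hi]
  · rw [v₄ i hi]
    simp only [RExpr.eval, IExpr.eval, Function.update_self]
    rw [f₃.arrs 14 (by simpa using har'.symm), v₂ i hi, hup f₁]
    refine RExpr.eval_congr fun b hb => f₁.arrs b ?_
    simp only [Finset.mem_singleton]
    rintro rfl
    exact h13' hb

/-- The block number of position `var 3` for blocks of length `var 5`. -/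
def blockExpr : IExpr := .div (.var 3) (.var 5)

/-- The parity of the block number. -/
def sideExpr : IExpr := .sub blockExpr (.mul (.lit 2) (.div blockExpr (.lit 2)))

/-- The position in the even block of the pair. -/
def evenExpr : IExpr := .sub (.var 3) (.mul sideExpr (.var 5))

/-- The position in the odd block of the pair. -/
def oddExpr : IExpr := .add evenExpr (.var 5)

/-- The index of the twiddle factor of the block, for `2 * var 4` blocks. -/
def childExpr : IExpr := .add (.mul (.lit 2) (.var 4)) blockExpr

/-- The index of the twiddle factor of the `c`-th block of the pair, or `0` in the even block. -/
def siblingExpr (c : ℕ) : IExpr :=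
  .mul sideExpr (.add (.mul (.lit 2) (.add (.var 4) (.div blockExpr (.lit 2)))) (.lit c))

/-- The loop variable is at position `r` of block `2 * q + d`, for `2 * B` blocks of length `h`. -/
structure AtBlock (s : ℕ → ℕ) (B h q d r : ℕ) : Prop where
  pos : s 3 = h * (2 * q + d) + r
  len : s 5 = h
  num : s 4 = B
  hq : q < B
  hd : d < 2
  hr : r < h

theorem exists_atBlock {s : ℕ → ℕ} {B h : ℕ} (hh : 0 < h) (h5 : s 5 = h) (h4 : s 4 = B)
    (h3 : s 3 < 2 * B * h) : ∃ q d r, AtBlock s B h q d r := by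
  refine ⟨s 3 / h / 2, s 3 / h % 2, s 3 % h, ?_, h5, h4, ?_, Nat.mod_lt _ (by norm_num),
    Nat.mod_lt _ hh⟩
  · rw [Nat.div_add_mod, Nat.div_add_mod]
  · have : s 3 / h < 2 * B := (Nat.div_lt_iff_lt_mul hh).2 h3
    omega

section AtBlock

variable {s : ℕ → ℕ} {B h q d r : ℕ}

theorem AtBlock.block (H : AtBlock s B h q d r) : blockExpr.eval s = 2 * q + d := by
  have := H.hr
  simp only [blockExpr, IExpr.eval, H.pos, H.len]
  rw [Nat.mul_add_div (by omega), Nat.div_eq_of_lt this, add_zero]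

theorem AtBlock.side (H : AtBlock s B h q d r) : sideExpr.eval s = d := by
  have := H.hd
  simp only [sideExpr, IExpr.eval, H.block]
  omega

theorem AtBlock.even (H : AtBlock s B h q d r) : evenExpr.eval s = h * (2 * q) + r := by
  simp only [evenExpr, IExpr.eval, H.side, H.pos, H.len]
  rw [mul_add, mul_comm d h]; omega

theorem AtBlock.odd (H : AtBlock s B h q d r) : oddExpr.eval s = h * (2 * q + 1) + r := by
  have h1 : oddExpr.eval s = evenExpr.eval s + s 5 := rfl
  rw [h1, H.even, H.len]; ring

theorem AtBlock.child (H : AtBlock s B h q d r) : childExpr.eval s = 2 * (B + q) + d := by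
  simp only [childExpr, IExpr.eval, H.block, H.num]; ring

theorem AtBlock.sibling (H : AtBlock s B h q d r) (c : ℕ) : (siblingExpr c).eval s = d * (2 * (B + q) + c) := by
  have := H.hd
  simp only [siblingExpr, IExpr.eval, H.block, H.num, H.side]
  congr 3; omega

theorem AtBlock.pos_lt (H : AtBlock s B h q d r) : s 3 < 2 * B * h := by
  rw [H.pos]
  have h1 := H.hq; have h2 := H.hd; have h3 := H.hr
  calc h * (2 * q + d) + r < h * (2 * q + d) + h := by omega
    _ = h * (2 * q + d + 1) := by ring
    _ ≤ h * (2 * B) := Nat.mul_le_mul_left _ (by omega)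
    _ = 2 * B * h := by ring

theorem AtBlock.block_peak (H : AtBlock s B h q d r) (hS : 4 * B * h < S) : blockExpr.peak s ≤ S := by
  have h1 := H.pos_lt
  have h2 : 4 * B * h = 2 * (2 * B * h) := by ring
  have h3 : h ≤ 2 * B * h := Nat.le_mul_of_pos_left _ (by have := H.hq; omega)
  simp only [blockExpr, IExpr.peak, H.len]; omega

theorem AtBlock.two_mul_le (H : AtBlock s B h q d r) : 2 * B ≤ 2 * B * h :=
  Nat.le_mul_of_pos_right _ (by have := H.hr; omega)

theorem AtBlock.len_le (H : AtBlock s B h q d r) : h ≤ 2 * B * h :=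
  Nat.le_mul_of_pos_left _ (by have := H.hq; omega)

theorem AtBlock.side_peak (H : AtBlock s B h q d r) (hS : 4 * B * h < S) : sideExpr.peak s ≤ S := by
  have h1 := H.block_peak hS
  have h2 := H.two_mul_le
  have h3 : 4 * B * h = 2 * (2 * B * h) := by ring
  have := H.hq; have := H.hd
  simp only [sideExpr, IExpr.peak, IExpr.eval, H.block]; omega

theorem AtBlock.even_peak (H : AtBlock s B h q d r) (hS : 4 * B * h < S) : evenExpr.peak s ≤ S := by
  have h1 := H.side_peak hS
  have h2 := H.pos_lt
  have h3 : 4 * B * h = 2 * (2 * B * h) := by ring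
  have h4 := H.len_le
  have h5 : d * h ≤ 1 * h := Nat.mul_le_mul_right _ (by have := H.hd; omega)
  simp only [evenExpr, IExpr.peak, IExpr.eval, H.side, H.len]; omega

theorem AtBlock.odd_peak (H : AtBlock s B h q d r) (hS : 4 * B * h < S) : oddExpr.peak s ≤ S := by
  have h1 := H.even_peak hS
  have h2 := H.pos_lt
  have h3 : 4 * B * h = 2 * (2 * B * h) := by ring
  have h4 := H.len_le
  have h5 : evenExpr.eval s ≤ s 3 := Nat.sub_le _ _
  have h6 : evenExpr.eval s + s 5 ≤ S := by rw [H.len]; omega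
  simp only [oddExpr, IExpr.peak, IExpr.eval]
  rw [H.len] at *
  omega

theorem AtBlock.child_peak (H : AtBlock s B h q d r) (hS : 4 * B * h < S) : childExpr.peak s ≤ S := by
  have h1 := H.block_peak hS
  have h2 := H.two_mul_le
  have h3 : 4 * B * h = 2 * (2 * B * h) := by ring
  have := H.hq; have := H.hd
  simp only [childExpr, IExpr.peak, IExpr.eval, H.block, H.num]; omega

theorem AtBlock.sibling_peak (H : AtBlock s B h q d r) (hS : 4 * B * h < S) {c : ℕ} (hc : c < 2) :
    (siblingExpr c).peak s ≤ S := by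
  have h1 := H.block_peak hS
  have h2 := H.two_mul_le
  have h3 : 4 * B * h = 2 * (2 * B * h) := by ring
  have h4 := H.side_peak hS
  have h5 := H.hq; have h6 := H.hd
  have h7 : (2 * q + d) / 2 = q := by omega
  have h8 : d * (2 * (B + q) + c) ≤ 1 * (2 * (B + q) + c) := Nat.mul_le_mul_right _ (by omega)
  simp only [siblingExpr, IExpr.peak, IExpr.eval, H.block, H.num, H.side, h7]; omega

end AtBlock

end Multiplication

/-! ### Butterfly stages and the multiplication program. -/

section Transform

variable {θ ω : ℕ → ℝ} {S : ℕ}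

/-- Arrays `3` and `4` hold the real and imaginary parts of the first `n` twiddle factors. -/
def TwiddleTable (m : ℕ → ℕ → ℝ) (n : ℕ) : Prop :=
  ∀ k, k < n → (⟨m 3 k, m 4 k⟩ : ℂ) = twiddle k

/-- The arrays `ar`, `ai` hold the residues of `P` modulo the `B` factors of degree `l`. -/
def HoldsResidues (m : ℕ → ℕ → ℝ) (ar ai l B : ℕ) (P : ℕ → ℂ) : Prop :=
  ∀ q, q < B → ∀ r, r < l → (⟨m ar (l * q + r), m ai (l * q + r)⟩ : ℂ) = residue l B P (B + q) r

/-- The real part of low + w · high. The twiddle factors of the two blocks of a pair are negatives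
of each other, so one formula serves both blocks without branching. -/
def forwardRe (ar ai : ℕ) : RExpr :=
  .add (.cell ar evenExpr)
    (.sub (.mul (.cell 3 childExpr) (.cell ar oddExpr)) (.mul (.cell 4 childExpr) (.cell ai oddExpr)))

def forwardIm (ar ai : ℕ) : RExpr :=
  .add (.cell ai evenExpr)
    (.add (.mul (.cell 3 childExpr) (.cell ai oddExpr)) (.mul (.cell 4 childExpr) (.cell ar oddExpr)))

/-- In an even block the twiddle index is 0, and `twiddle 0 = 1` turns the formula into the plain
average of `residue_merge_low`; in an odd block it is `residue_merge_high`. -/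
def inverseRe (ar ai : ℕ) : RExpr :=
  .div (.add
    (.add (.mul (.cell ar evenExpr) (.cell 3 (siblingExpr 0)))
      (.mul (.cell ai evenExpr) (.cell 4 (siblingExpr 0))))
    (.add (.mul (.cell ar oddExpr) (.cell 3 (siblingExpr 1)))
      (.mul (.cell ai oddExpr) (.cell 4 (siblingExpr 1))))) (.ofInt (.lit 2))

def inverseIm (ar ai : ℕ) : RExpr :=
  .div (.add
    (.sub (.mul (.cell ai evenExpr) (.cell 3 (siblingExpr 0)))
      (.mul (.cell ar evenExpr) (.cell 4 (siblingExpr 0))))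
    (.sub (.mul (.cell ai oddExpr) (.cell 3 (siblingExpr 1)))
      (.mul (.cell ar oddExpr) (.cell 4 (siblingExpr 1))))) (.ofInt (.lit 2))

theorem AtBlock.update {s : ℕ → ℕ} {B h q r : ℕ} (h5 : s 5 = h) (h4 : s 4 = B) (hq : q < 2 * B)
    (hr : r < h) : AtBlock (Function.update s 3 (h * q + r)) B h (q / 2) (q % 2) r :=
  ⟨by rw [Function.update_self, Nat.div_add_mod], by rwa [Function.update_of_ne (by norm_num)],
    by rwa [Function.update_of_ne (by norm_num)], by omega, Nat.mod_lt _ (by norm_num), hr⟩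

theorem exists_atBlock_update {s : ℕ → ℕ} {B h n k : ℕ} (hh : 0 < h) (h5 : s 5 = h) (h4 : s 4 = B)
    (hn : n = 2 * B * h) (hk : k < n) : ∃ q d r, AtBlock (Function.update s 3 k) B h q d r :=
  exists_atBlock hh (by rwa [Function.update_of_ne (by norm_num)])
    (by rwa [Function.update_of_ne (by norm_num)]) (by rw [Function.update_self]; omega)

theorem forwardStage_runs {ar ai : ℕ} (har : ar < 13) (hai : ai < 13) (hra : ar ≠ ai) {σ : Store}
    {n B h : ℕ} (hh : 0 < h) (hn : n = 2 * B * h) (h2 : σ.ints 2 = n) (h4 : σ.ints 4 = B)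
    (h5 : σ.ints 5 = h) (hS : 2 * n < S) (hT : TwiddleTable σ.arrs (2 * n)) {P : ℕ → ℂ}
    (hP : HoldsResidues σ.arrs ar ai (2 * h) B P) :
    ∃ σ', Runs θ ω S (stage (forwardRe ar ai) (forwardIm ar ai) ar ai) σ σ' (4 * (300 * (n + 2))) ∧
      Frame {3} {13, 14, ar, ai} σ σ' ∧ HoldsResidues σ'.arrs ar ai h (2 * B) P := by
  have hS' : 4 * B * h < S := by
    have : 4 * B * h = 2 * n := by rw [hn]; ring
    omega
  obtain ⟨σ', r, f, vr, vi⟩ := stage_runs (θ := θ) (ω := ω) (S := S) (eRe := forwardRe ar ai)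
    (eIm := forwardIm ar ai) (ar := ar) (ai := ai) (σ := σ) n 300 h2 (by omega)
    (by simp [forwardRe, RExpr.size, IExpr.size, evenExpr, oddExpr, childExpr, sideExpr, blockExpr])
    (by simp [forwardIm, RExpr.size, IExpr.size, evenExpr, oddExpr, childExpr, sideExpr, blockExpr])
    (by norm_num)
    (by simp [forwardRe, RExpr.arrays]; omega) (by simp [forwardIm, RExpr.arrays]; omega)
    (by simp [forwardIm, RExpr.arrays]; omega) (by omega) (by omega) (by omega) hra
    (fun k hk => by
      obtain ⟨q, d, r, H⟩ := exists_atBlock_update hh h5 h4 hn hk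
      simp [forwardRe, RExpr.peak, H.even_peak hS', H.odd_peak hS', H.child_peak hS'])
    (fun k hk => by
      obtain ⟨q, d, r, H⟩ := exists_atBlock_update hh h5 h4 hn hk
      simp [forwardIm, RExpr.peak, H.even_peak hS', H.odd_peak hS', H.child_peak hS'])
  refine ⟨σ', r, f, fun q hq r hr => ?_⟩
  have H := AtBlock.update h5 h4 hq hr
  have hpos : h * q + r < n := by
    have := H.pos_lt
    rwa [Function.update_self, ← hn] at this
  rw [vr _ hpos, vi _ hpos]
  have e1 : 2 * B + q = 2 * (B + q / 2) + q % 2 := by omega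
  have hq1 : 1 ≤ B + q / 2 := by omega
  rw [e1, residue_split P hq1 H.hd, ← hP _ H.hq r (by omega), ← hP _ H.hq (r + h) (by omega),
    ← hT (2 * (B + q / 2) + q % 2) (by
      have : 2 * B ≤ n := by rw [hn]; exact Nat.le_mul_of_pos_right _ hh
      omega)]
  have e2 : 2 * h * (q / 2) + r = h * (2 * (q / 2)) + r := by ring
  have e3 : 2 * h * (q / 2) + (r + h) = h * (2 * (q / 2) + 1) + r := by ring
  rw [e2, e3]
  refine Complex.ext ?_ ?_
  · simp only [forwardRe, RExpr.eval, H.even, H.odd, H.child, Complex.add_re, Complex.mul_re]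
  · simp only [forwardIm, RExpr.eval, H.even, H.odd, H.child, Complex.add_im, Complex.mul_im]

theorem inverseStage_runs {ar ai : ℕ} (har : ar < 13) (hai : ai < 13) (hra : ar ≠ ai) {σ : Store}
    {n B h : ℕ} (hh : 0 < h) (hn : n = 2 * B * h) (h2 : σ.ints 2 = n) (h4 : σ.ints 4 = B)
    (h5 : σ.ints 5 = h) (hS : 2 * n < S) (hT : TwiddleTable σ.arrs (2 * n)) {P : ℕ → ℂ}
    (hP : HoldsResidues σ.arrs ar ai h (2 * B) P) :
    ∃ σ', Runs θ ω S (stage (inverseRe ar ai) (inverseIm ar ai) ar ai) σ σ' (4 * (300 * (n + 2))) ∧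
      Frame {3} {13, 14, ar, ai} σ σ' ∧ HoldsResidues σ'.arrs ar ai (2 * h) B P := by
  have hS' : 4 * B * h < S := by
    have : 4 * B * h = 2 * n := by rw [hn]; ring
    omega
  obtain ⟨σ', r, f, vr, vi⟩ := stage_runs (θ := θ) (ω := ω) (S := S) (eRe := inverseRe ar ai)
    (eIm := inverseIm ar ai) (ar := ar) (ai := ai) (σ := σ) n 300 h2 (by omega)
    (by simp [inverseRe, RExpr.size, IExpr.size, evenExpr, oddExpr, siblingExpr, sideExpr, blockExpr])
    (by simp [inverseIm, RExpr.size, IExpr.size, evenExpr, oddExpr, siblingExpr, sideExpr, blockExpr])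
    (by norm_num)
    (by simp [inverseRe, RExpr.arrays]; omega) (by simp [inverseIm, RExpr.arrays]; omega)
    (by simp [inverseIm, RExpr.arrays]; omega) (by omega) (by omega) (by omega) hra
    (fun k hk => by
      obtain ⟨q, d, r, H⟩ := exists_atBlock_update hh h5 h4 hn hk
      have h0 := H.sibling_peak hS' (c := 0) (by norm_num)
      have h1 := H.sibling_peak hS' (c := 1) (by norm_num)
      simp [inverseRe, RExpr.peak, IExpr.peak, H.even_peak hS', H.odd_peak hS', h0, h1]
      have := H.two_mul_le; have := H.hq; have := H.pos_lt; have := H.hr; omega)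
    (fun k hk => by
      obtain ⟨q, d, r, H⟩ := exists_atBlock_update hh h5 h4 hn hk
      have h0 := H.sibling_peak hS' (c := 0) (by norm_num)
      have h1 := H.sibling_peak hS' (c := 1) (by norm_num)
      simp [inverseIm, RExpr.peak, IExpr.peak, H.even_peak hS', H.odd_peak hS', h0, h1]
      have := H.two_mul_le; have := H.hq; have := H.pos_lt; have := H.hr; omega)
  refine ⟨σ', r, f, fun q hq r hr => ?_⟩
  have hT0 := hT 0 (by
    have : 0 < 2 * B * h := Nat.mul_pos (by omega) hh
    omega)
  rw [twiddle_zero] at hT0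
  have hB : 2 * B ≤ n := by rw [hn]; exact Nat.le_mul_of_pos_right _ hh
  have hq1 : 1 ≤ B + q := by omega
  have hc0 := hT (2 * (B + q)) (by omega)
  have hc1 := hT (2 * (B + q) + 1) (by omega)
  have k0 : 2 * (B + q) = 2 * B + 2 * q := by ring
  have k1 : 2 * (B + q) + 1 = 2 * B + (2 * q + 1) := by ring
  have hre0 : σ.arrs 3 0 = 1 := by simpa using congrArg Complex.re hT0
  have him0 : σ.arrs 4 0 = 0 := by simpa using congrArg Complex.im hT0
  rcases lt_or_ge r h with hlt | hge
  · have H : AtBlock (Function.update σ.ints 3 (2 * h * q + r)) B h q 0 r := by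
      have e : h * (2 * q) + r = 2 * h * q + r := by ring
      have := AtBlock.update (q := 2 * q) h5 h4 (by omega) hlt
      rwa [e, Nat.mul_div_cancel_left _ (by norm_num), Nat.mul_mod_right] at this
    have hpos : 2 * h * q + r < n := by
      have := H.pos_lt
      rwa [Function.update_self, ← hn] at this
    rw [vr _ hpos, vi _ hpos, residue_merge_low P hq1, k1, k0, ← hP _ (by omega) r hlt,
      ← hP _ (by omega) r hlt]
    refine Complex.ext ?_ ?_
    · simp only [inverseRe, RExpr.eval, IExpr.eval, H.even, H.odd, H.sibling,
        zero_mul, hre0, him0, Nat.cast_ofNat, mul_one, mul_zero, add_zero]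
      rw [Complex.div_ofNat_re, Complex.add_re]
    · simp only [inverseIm, RExpr.eval, IExpr.eval, H.even, H.odd, H.sibling,
        zero_mul, hre0, him0, Nat.cast_ofNat, mul_one, mul_zero, sub_zero]
      rw [Complex.div_ofNat_im, Complex.add_im]
  · obtain ⟨t, rfl⟩ : ∃ t, r = t + h := ⟨r - h, by omega⟩
    have ht : t < h := by omega
    have H : AtBlock (Function.update σ.ints 3 (2 * h * q + (t + h))) B h q 1 t := by
      have e : h * (2 * q + 1) + t = 2 * h * q + (t + h) := by ring
      have := AtBlock.update (q := 2 * q + 1) h5 h4 (by omega) ht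
      have e1 : (2 * q + 1) / 2 = q := by omega
      have e2 : (2 * q + 1) % 2 = 1 := by omega
      rwa [e, e1, e2] at this
    have hpos : 2 * h * q + (t + h) < n := by
      have := H.pos_lt
      rwa [Function.update_self, ← hn] at this
    rw [vr _ hpos, vi _ hpos, residue_merge_high P hq1, ← hc0, ← hc1, k1, k0,
      ← hP _ (by omega) t ht, ← hP _ (by omega) t ht]
    refine Complex.ext ?_ ?_
    · simp only [inverseRe, RExpr.eval, IExpr.eval, H.even, H.odd, H.sibling, one_mul,
        Nat.cast_ofNat, add_zero, k0]
      rw [Complex.div_ofNat_re, Complex.add_re, Complex.mul_re, Complex.mul_re]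
      simp only [Complex.conj_re, Complex.conj_im]
      ring_nf
    · simp only [inverseIm, RExpr.eval, IExpr.eval, H.even, H.odd, H.sibling, one_mul,
        Nat.cast_ofNat, add_zero, k0]
      rw [Complex.div_ofNat_im, Complex.add_im, Complex.mul_im, Complex.mul_im]
      simp only [Complex.conj_re, Complex.conj_im]
      ring_nf

/-- `var 5 := var 2 / (2 * var 4)`, the length of the blocks. -/
def setLen : Program := .setInt 5 (.div (.var 2) (.mul (.lit 2) (.var 4)))

def forward (ar ai : ℕ) : Program :=
  .seq (.setInt 4 (.lit 1)) (.loop (.var 4) (.var 2)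
    (.seq setLen (.seq (stage (forwardRe ar ai) (forwardIm ar ai) ar ai)
      (.setInt 4 (.mul (.lit 2) (.var 4))))))

def inverse (ar ai : ℕ) : Program :=
  .seq (.setInt 4 (.var 2)) (.loop (.lit 1) (.var 4)
    (.seq (.setInt 4 (.div (.var 4) (.lit 2)))
      (.seq setLen (stage (inverseRe ar ai) (inverseIm ar ai) ar ai))))

theorem setLen_runs {σ : Store} {n B h : ℕ} (hB : 0 < B) (hn : n = 2 * B * h) (hh : 0 < h)
    (h2 : σ.ints 2 = n) (h4 : σ.ints 4 = B) (hS : 2 * n < S) :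
    Runs θ ω S setLen σ (σ.putInt 5 h) 6 := by
  have h1 : 2 * B ≤ n := by rw [hn]; exact Nat.le_mul_of_pos_right _ hh
  have := Runs.setInt (θ := θ) (ω := ω) (S := S) (σ := σ) 5
    (.div (.var 2) (.mul (.lit 2) (.var 4)))
    (by simp only [IExpr.peak, IExpr.eval, h2, h4]; omega)
  simp only [IExpr.eval, h2, h4] at this
  rw [hn, Nat.mul_div_cancel_left _ (by omega)] at this
  exact this

theorem TwiddleTable.frame {V A : Finset ℕ} {σ σ' : Store} {n : ℕ} (h : TwiddleTable σ.arrs n)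
    (f : Frame V A σ σ') (h3 : 3 ∉ A) (h4 : 4 ∉ A) : TwiddleTable σ'.arrs n := fun k hk => by
  rw [f.arrs 3 h3, f.arrs 4 h4, h k hk]

/-- The descent starts at the single modulus X^n - i, for which a polynomial of degree below n is
its own residue, and reaches n linear moduli after L stages of linear cost. -/
theorem forward_runs {ar ai : ℕ} (har : ar < 13) (hai : ai < 13) (hra : ar ≠ ai)
    (har' : 4 < ar) (hai' : 4 < ai) {σ : Store} {L : ℕ} (h2 : σ.ints 2 = 2 ^ L)
    (hS : 2 * 2 ^ L < S) (hT : TwiddleTable σ.arrs (2 * 2 ^ L)) {P : ℕ → ℂ}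
    (hP : ∀ i, i < 2 ^ L → (⟨σ.arrs ar i, σ.arrs ai i⟩ : ℂ) = P i) :
    ∃ σ', Runs θ ω S (forward ar ai) σ σ' (1220 * ((2 ^ L + 2) * (L + 1))) ∧
      Frame {3, 4, 5} {13, 14, ar, ai} σ σ' ∧ HoldsResidues σ'.arrs ar ai 1 (2 ^ L) P := by
  let I : ℕ → Store → Prop := fun l τ => τ.ints 4 = 2 ^ l ∧ Frame {3, 4, 5} {13, 14, ar, ai} σ τ ∧
    HoldsResidues τ.arrs ar ai (2 ^ (L - l)) (2 ^ l) P
  have hLpos : 0 < 2 ^ L := by positivity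
  have r0 : Runs θ ω S (.setInt 4 (.lit 1)) σ (σ.putInt 4 1) 2 :=
    Runs.setInt 4 (.lit 1) (by simp only [IExpr.peak]; omega)
  have hI0 : I 0 (σ.putInt 4 1) := by
    refine ⟨by simp [Store.putInt], (Frame.putInt σ 4 1).mono (by simp) (by simp), ?_⟩
    intro q hq r hr
    obtain rfl : q = 0 := by simpa using hq
    simp only [Nat.sub_zero] at hr
    simpa [residue, Store.putInt] using hP r hr
  have hI2 : ∀ {l τ}, I l τ → τ.ints 2 = 2 ^ L := fun h => (h.2.1.ints 2 (by simp)).trans h2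
  have hpw : ∀ {l}, l ≤ L → 2 ^ l ≤ 2 ^ L := fun h => Nat.pow_le_pow_right (by norm_num) h
  have hloop := Runs.loop_count (θ := θ) (ω := ω) (S := S) (e₁ := .var 4) (e₂ := .var 2)
    (p := .seq setLen (.seq (stage (forwardRe ar ai) (forwardIm ar ai) ar ai)
      (.setInt 4 (.mul (.lit 2) (.var 4))))) I L
    (T := 6 + (4 * (300 * (2 ^ L + 2)) + 4)) ?_ ?_ ?_ hI0
  · obtain ⟨σ', hr, hI⟩ := hloop
    refine ⟨σ', (r0.seq hr).mono ?_, hI.2.1, ?_⟩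
    · have e1 : ∀ v, (IExpr.var v).size = 1 := fun _ => rfl
      simp only [e1]
      set N := 2 ^ L
      have : 1 ≤ (N + 2) * (L + 1) := Nat.mul_pos (by omega) (by omega)
      calc 2 + (1 + 1 + 1 + (6 + (4 * (300 * (N + 2)) + 4))) * (L + 1)
          = 2 + 13 * (L + 1) + 1200 * ((N + 2) * (L + 1)) := by ring
        _ ≤ _ := by nlinarith
    · have := hI.2.2
      rwa [Nat.sub_self, pow_zero] at this
  · intro k τ hk hI
    have := hpw hk
    simp only [IExpr.peak, hI.1, hI2 hI]; omega
  · intro τ hI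
    simp only [IExpr.eval, hI.1, hI2 hI]; omega
  · intro k τ hk hI
    obtain ⟨e, rfl⟩ : ∃ e, L = k + 1 + e := ⟨L - (k + 1), by omega⟩
    have hh : 0 < 2 ^ e := by positivity
    have hB : 0 < 2 ^ k := by positivity
    have hn : 2 ^ (k + 1 + e) = 2 * 2 ^ k * 2 ^ e := by rw [pow_add, pow_succ]; ring
    have h22 := hI2 hI
    obtain ⟨hI4, hIf, hIr⟩ := hI
    refine ⟨?_, ?_⟩
    · simp only [IExpr.eval, hI4, h22]
      exact Nat.pow_lt_pow_right (by norm_num) hk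
    have r1 := setLen_runs (θ := θ) (ω := ω) hB hn hh h22 hI4 hS
    have f1 := Frame.putInt τ 5 (2 ^ e)
    have hT1 := (hT.frame hIf (by simp; omega) (by simp; omega)).frame f1 (by simp) (by simp)
    have hP1 : HoldsResidues (τ.putInt 5 (2 ^ e)).arrs ar ai (2 * 2 ^ e) (2 ^ k) P := by
      have e1 : k + 1 + e - k = e + 1 := by omega
      rw [e1, pow_succ'] at hIr
      exact hIr
    obtain ⟨τ', r2, f2, hP2⟩ := forwardStage_runs (θ := θ) (ω := ω) har hai hra
      (σ := τ.putInt 5 (2 ^ e)) hh hn ((f1.ints 2 (by simp)).trans h22)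
      ((f1.ints 4 (by simp)).trans hI4) (by simp [Store.putInt]) hS hT1 hP1
    have h4' : τ'.ints 4 = 2 ^ k := (f2.ints 4 (by simp)).trans ((f1.ints 4 (by simp)).trans hI4)
    have r3 := Runs.setInt (θ := θ) (ω := ω) (S := S) (σ := τ') 4 (.mul (.lit 2) (.var 4))
      (by
        have := hpw hk
        have h3 : 2 ^ (k + 1) = 2 * 2 ^ k := pow_succ' _ _
        simp only [IExpr.peak, IExpr.eval, h4']; omega)
    simp only [IExpr.eval, h4'] at r3
    refine ⟨_, (r1.seq (r2.seq r3)).mono le_rfl, by simp [Store.putInt, pow_succ'], ?_, ?_⟩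
    · exact hIf.trans ((f1.mono (by simp) (by simp)).trans ((f2.mono (by simp) subset_rfl).trans
        ((Frame.putInt τ' 4 _).mono (by simp) (by simp))))
    · have e1 : k + 1 + e - (k + 1) = e := by omega
      rw [e1, pow_succ']
      exact hP2

theorem inverse_runs {ar ai : ℕ} (har : ar < 13) (hai : ai < 13) (hra : ar ≠ ai)
    (har' : 4 < ar) (hai' : 4 < ai) {σ : Store} {L : ℕ} (h2 : σ.ints 2 = 2 ^ L)
    (hS : 2 * 2 ^ L < S) (hT : TwiddleTable σ.arrs (2 * 2 ^ L)) {P : ℕ → ℂ}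
    (hP : HoldsResidues σ.arrs ar ai 1 (2 ^ L) P) :
    ∃ σ', Runs θ ω S (inverse ar ai) σ σ' (1220 * ((2 ^ L + 2) * (L + 1))) ∧
      Frame {3, 4, 5} {13, 14, ar, ai} σ σ' ∧
      ∀ i, i < 2 ^ L → (⟨σ'.arrs ar i, σ'.arrs ai i⟩ : ℂ) = P i := by
  let I : ℕ → Store → Prop := fun l τ => τ.ints 4 = 2 ^ (L - l) ∧
    Frame {3, 4, 5} {13, 14, ar, ai} σ τ ∧
    HoldsResidues τ.arrs ar ai (2 ^ l) (2 ^ (L - l)) P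
  have hLpos : 0 < 2 ^ L := by positivity
  have r0 : Runs θ ω S (.setInt 4 (.var 2)) σ (σ.putInt 4 (2 ^ L)) 2 := by
    have := Runs.setInt (θ := θ) (ω := ω) (S := S) (σ := σ) 4 (.var 2)
      (by simp only [IExpr.peak, h2]; omega)
    simp only [IExpr.eval, h2] at this
    exact this
  have hI0 : I 0 (σ.putInt 4 (2 ^ L)) :=
    ⟨by simp [Store.putInt], (Frame.putInt σ 4 _).mono (by simp) (by simp), hP⟩
  have hI2 : ∀ {l τ}, I l τ → τ.ints 2 = 2 ^ L := fun h => (h.2.1.ints 2 (by simp)).trans h2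
  have hpw : ∀ {l}, l ≤ L → 2 ^ l ≤ 2 ^ L := fun h => Nat.pow_le_pow_right (by norm_num) h
  have hloop := Runs.loop_count (θ := θ) (ω := ω) (S := S) (e₁ := .lit 1) (e₂ := .var 4)
    (p := .seq (.setInt 4 (.div (.var 4) (.lit 2)))
      (.seq setLen (stage (inverseRe ar ai) (inverseIm ar ai) ar ai))) I L
    (T := 4 + (6 + 4 * (300 * (2 ^ L + 2)))) ?_ ?_ ?_ hI0
  · obtain ⟨σ', hr, hI⟩ := hloop
    refine ⟨σ', (r0.seq hr).mono ?_, hI.2.1, fun i hi => ?_⟩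
    · have e1 : (IExpr.var 4).size = 1 := rfl
      have e2 : (IExpr.lit 1).size = 1 := rfl
      simp only [e1, e2]
      set N := 2 ^ L
      have : 1 ≤ (N + 2) * (L + 1) := Nat.mul_pos (by omega) (by omega)
      calc 2 + (1 + 1 + 1 + (4 + (6 + 4 * (300 * (N + 2))))) * (L + 1)
          = 2 + 13 * (L + 1) + 1200 * ((N + 2) * (L + 1)) := by ring
        _ ≤ _ := by nlinarith
    · have := hI.2.2 0 (by simp) i hi
      simpa [residue] using this
  · intro k τ hk hI
    have := hpw (Nat.sub_le L k)
    simp only [IExpr.peak, hI.1]; omega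
  · intro τ hI
    simp [IExpr.eval, hI.1]
  · intro k τ hk hI
    obtain ⟨e, rfl⟩ : ∃ e, L = k + 1 + e := ⟨L - (k + 1), by omega⟩
    have hh : 0 < 2 ^ k := by positivity
    have hB : 0 < 2 ^ e := by positivity
    have hn : 2 ^ (k + 1 + e) = 2 * 2 ^ e * 2 ^ k := by rw [pow_add, pow_succ]; ring
    have h22 := hI2 hI
    obtain ⟨hI4, hIf, hIr⟩ := hI
    have e1 : k + 1 + e - k = e + 1 := by omega
    rw [e1, pow_succ'] at hI4 hIr
    refine ⟨?_, ?_⟩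
    · simp only [IExpr.eval, hI4]; omega
    have r1 : Runs θ ω S (.setInt 4 (.div (.var 4) (.lit 2))) τ (τ.putInt 4 (2 ^ e)) 4 := by
      have h3 : 2 * 2 ^ e ≤ 2 ^ (k + 1 + e) := by rw [hn]; exact Nat.le_mul_of_pos_right _ hh
      have := Runs.setInt (θ := θ) (ω := ω) (S := S) (σ := τ) 4 (.div (.var 4) (.lit 2))
        (by simp only [IExpr.peak, hI4]; omega)
      simp only [IExpr.eval, hI4] at this
      rwa [Nat.mul_div_cancel_left _ (by norm_num)] at this
    have f1 := Frame.putInt τ 4 (2 ^ e)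
    have r2 := setLen_runs (θ := θ) (ω := ω) (σ := τ.putInt 4 (2 ^ e)) hB hn hh
      ((f1.ints 2 (by simp)).trans h22) (by simp [Store.putInt]) hS
    have f2 := Frame.putInt (τ.putInt 4 (2 ^ e)) 5 (2 ^ k)
    have hT1 := ((hT.frame hIf (by simp; omega) (by simp; omega)).frame f1
      (by simp) (by simp)).frame f2 (by simp) (by simp)
    obtain ⟨τ', r3, f3, hP3⟩ := inverseStage_runs (θ := θ) (ω := ω) har hai hra
      (σ := (τ.putInt 4 (2 ^ e)).putInt 5 (2 ^ k)) (P := P) hh hn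
      ((f2.ints 2 (by simp)).trans ((f1.ints 2 (by simp)).trans h22))
      (by simp [Store.putInt]) (by simp [Store.putInt]) hS hT1 hIr
    have e2 : k + 1 + e - (k + 1) = e := by omega
    refine ⟨τ', (r1.seq (r2.seq r3)).mono le_rfl, ?_, ?_, ?_⟩
    · rw [e2, f3.ints 4 (by simp), f2.ints 4 (by simp)]
      simp [Store.putInt]
    · exact hIf.trans ((f1.mono (by simp) (by simp)).trans ((f2.mono (by simp) (by simp)).trans
        (f3.mono (by simp) subset_rfl)))
    · rw [e2, pow_succ']
      exact hP3

/-- `c[k] := [z^k] (a * b)` for `k < n`, where `n` is the integer variable `2`. -/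
def mulProgram (a b c : ℕ) : Program :=
  .seq (fillAll 9 (.cell a (.var 3))) (.seq (fillAll 10 (.ofInt (.lit 0)))
    (.seq (fillAll 11 (.cell b (.var 3))) (.seq (fillAll 12 (.ofInt (.lit 0)))
      (.seq (forward 9 10) (.seq (forward 11 12)
        (.seq (stage
          (.sub (.mul (.cell 9 (.var 3)) (.cell 11 (.var 3)))
            (.mul (.cell 10 (.var 3)) (.cell 12 (.var 3))))
          (.add (.mul (.cell 9 (.var 3)) (.cell 12 (.var 3)))
            (.mul (.cell 10 (.var 3)) (.cell 11 (.var 3)))) 9 10)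
          (.seq (inverse 9 10) (fillAll c (.cell 9 (.var 3))))))))))

/-- Residues modulo the linear factors multiply pointwise, and the inverse transform recovers
`cyclicMul`, whose real part is kept. Cells at or beyond the transform length do not affect the
coefficients claimed here. -/
theorem mulProgram_runs {a b c : ℕ} (ha : a ∉ ({9, 10, 11, 12, 13, 14} : Finset ℕ))
    (hb : b ∉ ({9, 10, 11, 12, 13, 14} : Finset ℕ)) (hc : c ≠ 9) {σ : Store} {L : ℕ}
    (h2 : σ.ints 2 = 2 ^ L) (hS : 2 * 2 ^ L < S) (hT : TwiddleTable σ.arrs (2 * 2 ^ L)) :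
    ∃ σ', Runs θ ω S (mulProgram a b c) σ σ' (6400 * ((2 ^ L + 2) * (L + 1))) ∧
      Frame {3, 4, 5} {9, 10, 11, 12, 13, 14, c} σ σ' ∧
      ∀ i, i < 2 ^ L → σ'.arrs c i =
        PowerSeries.coeff i (PowerSeries.mk (σ.arrs a) * PowerSeries.mk (σ.arrs b)) := by
  have hLpos : 0 < 2 ^ L := by positivity
  simp only [Finset.mem_insert, Finset.mem_singleton, not_or] at ha hb
  have hpk : ∀ (s : ℕ → ℕ) (k c : ℕ), k < 2 ^ L →
      (RExpr.cell c (.var 3)).peak (Function.update s 3 k) ≤ S := by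
    intro s k c hk
    simp only [RExpr.peak, IExpr.peak, Function.update_self]; omega
  obtain ⟨σ₁, r₁, f₁, v₁⟩ := fillAll_runs (θ := θ) (ω := ω) (S := S) (a := 9)
    (e := .cell a (.var 3)) (σ := σ) (2 ^ L) 100 h2 (by omega)
    (by simp [RExpr.size, IExpr.size]) (by simp [RExpr.arrays]; omega) (fun k hk => hpk _ _ _ hk)
  have h2₁ := (f₁.ints 2 (by simp)).trans h2
  obtain ⟨σ₂, r₂, f₂, v₂⟩ := fillAll_runs (θ := θ) (ω := ω) (S := S) (a := 10)
    (e := .ofInt (.lit 0)) (σ := σ₁) (2 ^ L) 100 h2₁ (by omega)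
    (by simp [RExpr.size, IExpr.size]) (by simp [RExpr.arrays])
    (fun k hk => by simp [RExpr.peak, IExpr.peak])
  have h2₂ := (f₂.ints 2 (by simp)).trans h2₁
  obtain ⟨σ₃, r₃, f₃, v₃⟩ := fillAll_runs (θ := θ) (ω := ω) (S := S) (a := 11)
    (e := .cell b (.var 3)) (σ := σ₂) (2 ^ L) 100 h2₂ (by omega)
    (by simp [RExpr.size, IExpr.size]) (by simp [RExpr.arrays]; omega) (fun k hk => hpk _ _ _ hk)
  have h2₃ := (f₃.ints 2 (by simp)).trans h2₂
  obtain ⟨σ₄, r₄, f₄, v₄⟩ := fillAll_runs (θ := θ) (ω := ω) (S := S) (a := 12)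
    (e := .ofInt (.lit 0)) (σ := σ₃) (2 ^ L) 100 h2₃ (by omega)
    (by simp [RExpr.size, IExpr.size]) (by simp [RExpr.arrays])
    (fun k hk => by simp [RExpr.peak, IExpr.peak])
  have h2₄ := (f₄.ints 2 (by simp)).trans h2₃
  have F₄ : Frame {3, 4, 5} {9, 10, 11, 12, 13, 14, c} σ σ₄ :=
    (f₁.mono (by simp) (by simp)).trans ((f₂.mono (by simp) (by simp)).trans
      ((f₃.mono (by simp) (by simp)).trans (f₄.mono (by simp) (by simp))))
  have F₄' : Frame {3} {9, 10, 11, 12} σ σ₄ :=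
    (f₁.mono (by simp) (by simp)).trans ((f₂.mono (by simp) (by simp)).trans
      ((f₃.mono (by simp) (by simp)).trans (f₄.mono (by simp) (by simp))))
  set P : ℕ → ℂ := fun i => ((σ.arrs a i : ℝ) : ℂ) with hPdef
  set Q : ℕ → ℂ := fun i => ((σ.arrs b i : ℝ) : ℂ) with hQdef
  have hT₄ := hT.frame F₄' (by simp) (by simp)
  have hP₄ : ∀ i, i < 2 ^ L → (⟨σ₄.arrs 9 i, σ₄.arrs 10 i⟩ : ℂ) = P i := by
    intro i hi
    rw [f₄.arrs 9 (by simp), f₃.arrs 9 (by simp), f₂.arrs 9 (by simp), v₁ i hi,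
      f₄.arrs 10 (by simp), f₃.arrs 10 (by simp), v₂ i hi]
    refine Complex.ext ?_ ?_ <;> simp [RExpr.eval, IExpr.eval, P]
  have hQ₄ : ∀ i, i < 2 ^ L → (⟨σ₄.arrs 11 i, σ₄.arrs 12 i⟩ : ℂ) = Q i := by
    intro i hi
    rw [f₄.arrs 11 (by simp), v₃ i hi, v₄ i hi]
    refine Complex.ext ?_ ?_
    · simp only [RExpr.eval, IExpr.eval, Function.update_self, Q, Complex.ofReal_re]
      rw [f₂.arrs b (by simp; omega), f₁.arrs b (by simp; omega)]
    · simp [RExpr.eval, IExpr.eval, Q]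
  obtain ⟨σ₅, r₅, f₅, v₅⟩ := forward_runs (θ := θ) (ω := ω) (S := S) (ar := 9) (ai := 10)
    (by norm_num) (by norm_num) (by norm_num) (by norm_num) (by norm_num) h2₄ hS hT₄ hP₄
  have h2₅ := (f₅.ints 2 (by simp)).trans h2₄
  have hT₅ := hT₄.frame f₅ (by simp) (by simp)
  obtain ⟨σ₆, r₆, f₆, v₆⟩ := forward_runs (θ := θ) (ω := ω) (S := S) (ar := 11) (ai := 12)
    (P := Q) (by norm_num) (by norm_num) (by norm_num) (by norm_num) (by norm_num) h2₅ hS hT₅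
    (fun i hi => by rw [f₅.arrs 11 (by simp), f₅.arrs 12 (by simp)]; exact hQ₄ i hi)
  have h2₆ := (f₆.ints 2 (by simp)).trans h2₅
  have hT₆ := hT₅.frame f₆ (by simp) (by simp)
  obtain ⟨σ₇, r₇, f₇, vr₇, vi₇⟩ := stage_runs (θ := θ) (ω := ω) (S := S)
    (eRe := .sub (.mul (.cell 9 (.var 3)) (.cell 11 (.var 3)))
            (.mul (.cell 10 (.var 3)) (.cell 12 (.var 3))))
    (eIm := .add (.mul (.cell 9 (.var 3)) (.cell 12 (.var 3)))
            (.mul (.cell 10 (.var 3)) (.cell 11 (.var 3)))) (ar := 9) (ai := 10) (σ := σ₆)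
    (2 ^ L) 100 h2₆ (by omega) (by simp [RExpr.size, IExpr.size]) (by simp [RExpr.size, IExpr.size])
    (by norm_num) (by simp [RExpr.arrays]) (by simp [RExpr.arrays]) (by simp [RExpr.arrays])
    (by norm_num) (by norm_num) (by norm_num) (by norm_num)
    (fun k hk => by simp only [RExpr.peak, IExpr.peak, Function.update_self]; omega)
    (fun k hk => by simp only [RExpr.peak, IExpr.peak, Function.update_self]; omega)
  have h2₇ := (f₇.ints 2 (by simp)).trans h2₆
  have hT₇ := hT₆.frame f₇ (by simp) (by simp)
  have hP₇ : HoldsResidues σ₇.arrs 9 10 1 (2 ^ L) (cyclicMul (2 ^ L) P Q) := by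
    intro q hq r hr
    obtain rfl : r = 0 := by omega
    have hp := v₅ q hq 0 hr
    have hq' := v₆ q hq 0 hr
    rw [residue_cyclicMul L P Q hq, ← hp, ← hq']
    simp only [one_mul, add_zero]
    rw [vr₇ q hq, vi₇ q hq]
    simp only [RExpr.eval, IExpr.eval, Function.update_self]
    rw [f₆.arrs 9 (by simp), f₆.arrs 10 (by simp)]
    exact Complex.ext (by simp [Complex.mul_re]) (by simp [Complex.mul_im])
  obtain ⟨σ₈, r₈, f₈, v₈⟩ := inverse_runs (θ := θ) (ω := ω) (S := S) (ar := 9) (ai := 10)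
    (by norm_num) (by norm_num) (by norm_num) (by norm_num) (by norm_num) h2₇ hS hT₇ hP₇
  have h2₈ := (f₈.ints 2 (by simp)).trans h2₇
  obtain ⟨σ₉, r₉, f₉, v₉⟩ := fillAll_runs (θ := θ) (ω := ω) (S := S) (a := c)
    (e := .cell 9 (.var 3)) (σ := σ₈) (2 ^ L) 100 h2₈ (by omega)
    (by simp [RExpr.size, IExpr.size]) (by simpa [RExpr.arrays] using hc)
    (fun k hk => hpk _ _ _ hk)
  refine ⟨σ₉, (r₁.seq (r₂.seq (r₃.seq (r₄.seq (r₅.seq (r₆.seq (r₇.seq (r₈.seq r₉)))))))).mono ?_,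
    ?_, fun i hi => ?_⟩
  · have h : 2 ^ L + 2 ≤ (2 ^ L + 2) * (L + 1) := Nat.le_mul_of_pos_right _ (by omega)
    generalize (2 ^ L + 2) * (L + 1) = Z at *
    omega
  · refine F₄.trans ((f₅.mono subset_rfl ?_).trans ((f₆.mono subset_rfl ?_).trans
      ((f₇.mono (by simp) ?_).trans ((f₈.mono subset_rfl ?_).trans (f₉.mono (by simp) ?_)))))
    all_goals intro x hx; simp only [Finset.mem_insert, Finset.mem_singleton] at hx ⊢; omega
  · rw [v₉ i hi]
    simp only [RExpr.eval, IExpr.eval, Function.update_self]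
    have := congrArg Complex.re (v₈ i hi)
    simp only at this
    rw [this, cyclicMul_re hi]

end Transform

/-! ## Newton iteration for reciprocals and first-order linear equations -/

section Newton

open PowerSeries

theorem X_pow_dvd_mk_sub {a : ℕ → ℝ} {g : PowerSeries ℝ} {M : ℕ}
    (h : ∀ i, i < M → a i = coeff i g) : X ^ M ∣ mk a - g := by
  rw [X_pow_dvd_iff]
  intro i hi
  rw [map_sub, coeff_mk, h i hi, sub_self]

theorem eq_coeff_of_X_pow_dvd {a b : PowerSeries ℝ} {M : ℕ} (h : X ^ M ∣ a - b) {i : ℕ}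
    (hi : i < M) : coeff i a = coeff i b := by
  have := X_pow_dvd_iff.1 h i hi
  rwa [map_sub, sub_eq_zero] at this

theorem X_pow_dvd_sub_cut {u : ℕ → ℝ} {U : PowerSeries ℝ} {N : ℕ}
    (hu : ∀ i, u i = if i < N then coeff i U else 0) : X ^ N ∣ U - mk u := by
  rw [X_pow_dvd_iff]
  intro i hi
  rw [map_sub, coeff_mk, hu, if_pos hi, sub_self]

/-- The Newton iterate 2u - G u² differs from the reciprocal U by G (U - u)², which is divisible by
X^(2N). From index N on the term 2u vanishes, leaving -u(Gu). -/
theorem newton_inverse {G U : PowerSeries ℝ} (h : G * U = 1) {N : ℕ} {a u e d : ℕ → ℝ}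
    (ha : ∀ i, i < 2 * N → a i = coeff i G)
    (hu : ∀ i, u i = if i < N then coeff i U else 0)
    (he : ∀ i, i < 2 * N → e i = coeff i (mk a * mk u))
    (hd : ∀ i, i < 2 * N → d i = coeff i (mk u * mk e)) :
    ∀ k, N ≤ k → k < 2 * N → -d k = coeff k U := by
  intro k hk hk2
  have h1 := X_pow_dvd_mk_sub ha
  have h2 := X_pow_dvd_sub_cut hu
  have h3 := X_pow_dvd_mk_sub he
  have h4 : X ^ (2 * N) ∣ (U - mk u) * (U - mk u) := by
    rw [two_mul, pow_add]; exact mul_dvd_mul h2 h2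
  have h5 : X ^ (2 * N) ∣ mk u * mk e - (2 * mk u - U) := by
    have e1 : mk u * mk e - (2 * mk u - U) = mk u * (mk e - mk a * mk u) +
        mk u * mk u * (mk a - G) + G * ((U - mk u) * (U - mk u)) := by
      linear_combination (2 * mk u - U) * h
    rw [e1]
    exact dvd_add (dvd_add (h3.mul_left _) (h1.mul_left _)) (h4.mul_left _)
  rw [hd k hk2, eq_coeff_of_X_pow_dvd h5 hk2, map_sub, two_mul, map_add, coeff_mk, hu,
    if_neg (by omega)]
  ring

theorem coeff_X_mul_derivative (f : PowerSeries ℝ) (n : ℕ) :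
    coeff n (X * d⁄dX ℝ f) = n * coeff n f := by
  cases n with
  | zero => simp
  | succ n => rw [coeff_succ_X_mul, coeff_derivative]; push_cast; ring

/-- Variation of constants. The error E = f - u solves z E' - Q E = R with R = Q u - z u', so z (E
h)' = R h for h = 1/f, and E is f times a formal integral. As R and E are divisible by X^N,
replacing h and f by their truncations v and u costs only multiples of X^(2N). -/
theorem newton_euler {Q f h : PowerSeries ℝ} (hf : X * d⁄dX ℝ f = Q * f) (hfh : f * h = 1) {N : ℕ}
    (hN : 1 ≤ N) {q u v e r w t p : ℕ → ℝ}
    (hq : ∀ i, i < 2 * N → q i = coeff i Q)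
    (hu : ∀ i, u i = if i < N then coeff i f else 0)
    (hv : ∀ i, v i = if i < N then coeff i h else 0)
    (he : ∀ i, i < 2 * N → e i = coeff i (mk q * mk u))
    (hr : ∀ i, i < 2 * N → r i = e i - i * u i)
    (hw : ∀ i, i < 2 * N → w i = coeff i (mk r * mk v))
    (ht : ∀ i, i < 2 * N → t i = if i = 0 then 0 else w i / i)
    (hp : ∀ i, i < 2 * N → p i = coeff i (mk u * mk t)) :
    ∀ k, N ≤ k → k < 2 * N → p k = coeff k f := by
  intro k hk hk2
  have dq := X_pow_dvd_mk_sub hq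
  have du := X_pow_dvd_sub_cut hu
  have dv := X_pow_dvd_sub_cut hv
  have de := X_pow_dvd_mk_sub he
  have dw := X_pow_dvd_mk_sub hw
  have dp := X_pow_dvd_mk_sub hp
  set E := f - mk u with hE
  set R := Q * mk u - X * d⁄dX ℝ (mk u) with hR
  have hXh : X * d⁄dX ℝ h = -Q * h := by
    have h1 := congrArg (d⁄dX ℝ) hfh
    rw [Derivation.leibniz, smul_eq_mul, smul_eq_mul, ← map_one C, derivative_C] at h1
    linear_combination h * X * h1 - h ^ 2 * hf - (Q * h + X * d⁄dX ℝ h) * hfh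
  have hRE : R = X * d⁄dX ℝ E - Q * E := by
    rw [hE, map_sub, hR]; linear_combination -hf
  have dR : X ^ N ∣ R := by
    rw [hRE]
    refine dvd_sub ?_ (du.mul_left _)
    rw [X_pow_dvd_iff] at du ⊢
    intro i hi
    rw [coeff_X_mul_derivative, du i hi, mul_zero]
  have dr : X ^ (2 * N) ∣ mk r - R := by
    have h1 : mk r - R = mk r - (mk e - X * d⁄dX ℝ (mk u)) + (mk e - mk q * mk u) +
        mk u * (mk q - Q) := by rw [hR]; ring
    rw [h1]
    refine dvd_add (dvd_add (X_pow_dvd_mk_sub fun i hi => ?_) de) (dq.mul_left _)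
    rw [hr i hi, map_sub, coeff_X_mul_derivative, coeff_mk, coeff_mk]
  have dRh : X ^ (2 * N) ∣ mk w - R * h := by
    have h1 : mk w - R * h = (mk w - mk r * mk v) + mk v * (mk r - R) - R * (h - mk v) := by ring
    rw [h1]
    refine dvd_sub (dvd_add dw (dr.mul_left _)) ?_
    rw [two_mul, pow_add]
    exact mul_dvd_mul dR dv
  have hEh : X * d⁄dX ℝ (E * h) = R * h := by
    rw [Derivation.leibniz, smul_eq_mul, smul_eq_mul, hRE]
    linear_combination E * hXh
  have dt : X ^ (2 * N) ∣ mk t - E * h := by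
    refine X_pow_dvd_mk_sub fun i hi => ?_
    rw [ht i hi]
    split_ifs with h0
    -- The constant of integration is zero because X^N divides E and N ≥ 1.
    · rw [h0]
      exact (X_pow_dvd_iff.1 (du.mul_right h) 0 (by omega)).symm
    · have h1 := eq_coeff_of_X_pow_dvd dRh hi
      rw [coeff_mk, ← hEh, coeff_X_mul_derivative] at h1
      have : (i : ℝ) ≠ 0 := by exact_mod_cast h0
      rw [h1, mul_div_cancel_left₀ _ this]
  have dfin : X ^ (2 * N) ∣ mk p - E := by
    have h1 : mk p - E = (mk p - mk u * mk t) + mk u * (mk t - E * h) - h * (E * E) := by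
      rw [hE]; linear_combination (f - mk u) * hfh
    rw [h1]
    refine dvd_sub (dvd_add dp (dt.mul_left _)) (Dvd.dvd.mul_left ?_ _)
    rw [two_mul, pow_add]
    exact mul_dvd_mul du du
  have h2 := eq_coeff_of_X_pow_dvd dfin hk2
  rw [coeff_mk, hE, map_sub, coeff_mk, hu, if_neg (by omega), sub_zero] at h2
  exact h2

end Newton

/-! ## Doubling the length of the precomputed series -/

section Doubling

open PowerSeries

variable {θ ω : ℕ → ℝ} {S : ℕ}

/-- The parity of `var 3`. -/
def parityExpr : IExpr := .sub (.var 3) (.mul (.lit 2) (.div (.var 3) (.lit 2)))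

/-- `1` if `var 3` is even, `-1` if it is odd. -/
def signExpr : RExpr := .sub (.ofInt (.lit 1)) (.mul (.ofInt (.lit 2)) (.ofInt parityExpr))

/-- The real part of the square root of the `var 3 / 2`-nd twiddle factor. -/
def rootExpr : RExpr :=
  .sqrt (.div (.add (.ofInt (.lit 1)) (.cell 3 (.div (.var 3) (.lit 2)))) (.ofInt (.lit 2)))

def twiddleRe : RExpr := .mul signExpr rootExpr

def twiddleIm : RExpr :=
  .mul signExpr (.div (.cell 4 (.div (.var 3) (.lit 2))) (.mul (.ofInt (.lit 2)) rootExpr))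

/-- Double the table of twiddle factors in the arrays `3` and `4`. -/
def twiddleProgram : Program :=
  .seq (fill (.var 2) (.mul (.lit 2) (.var 2)) 3 twiddleRe)
    (fill (.var 2) (.mul (.lit 2) (.var 2)) 4 twiddleIm)

theorem parityExpr_eval (s : ℕ → ℕ) : parityExpr.eval s = s 3 % 2 := by
  simp only [parityExpr, IExpr.eval]; omega

theorem twiddleRe_eval {s : ℕ → ℕ} {m : ℕ → ℕ → ℝ} {k : ℕ} (h3 : s 3 = k) (hk : 2 ≤ k)
    (hre : m 3 (k / 2) = (twiddle (k / 2)).re) : twiddleRe.eval θ s m = (twiddle k).re := by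
  rw [twiddle_rec hk, Complex.re_ofReal_mul]
  simp only [twiddleRe, signExpr, rootExpr, RExpr.eval, parityExpr_eval, IExpr.eval, h3, hre,
    circleSqrt]
  push_cast; rfl

theorem twiddleIm_eval {s : ℕ → ℕ} {m : ℕ → ℕ → ℝ} {k : ℕ} (h3 : s 3 = k) (hk : 2 ≤ k)
    (hre : m 3 (k / 2) = (twiddle (k / 2)).re) (him : m 4 (k / 2) = (twiddle (k / 2)).im) :
    twiddleIm.eval θ s m = (twiddle k).im := by
  rw [twiddle_rec hk, Complex.im_ofReal_mul]
  simp only [twiddleIm, signExpr, rootExpr, RExpr.eval, parityExpr_eval, IExpr.eval, h3, hre, him,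
    circleSqrt]
  push_cast; rfl

/-- A new entry k < 2M reads only the entry k / 2 < M of the old table; M ≥ 2 keeps k beyond the two
initial values. -/
theorem twiddleProgram_runs {σ : Store} {M : ℕ} (h2 : σ.ints 2 = M) (hM : 2 ≤ M)
    (hS : 2 * M < S) (hT : TwiddleTable σ.arrs M) :
    ∃ σ', Runs θ ω S twiddleProgram σ σ' (260 * (M + 2)) ∧ Frame {3} {3, 4} σ σ' ∧
      TwiddleTable σ'.arrs (2 * M) := by
  have hre : ∀ k, k < M → σ.arrs 3 k = (twiddle k).re := fun k hk => by rw [← hT k hk]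
  have him : ∀ k, k < M → σ.arrs 4 k = (twiddle k).im := fun k hk => by rw [← hT k hk]
  have hhi : ∀ s : ℕ → ℕ, s 2 = M →
      (IExpr.mul (.lit 2) (.var 2)).eval s = 2 * M ∧
        (IExpr.mul (.lit 2) (.var 2)).peak s ≤ S := fun s hs => by
    simp only [IExpr.eval, IExpr.peak, hs]; exact ⟨trivial, by omega⟩
  obtain ⟨σ₁, r₁, f₁, v₁⟩ := fill_runs (θ := θ) (ω := ω) (S := S) (lo := .var 2)
    (hi := .mul (.lit 2) (.var 2)) (a := 3) (e := twiddleRe) (σ := σ) M (2 * M) 60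
    (fun k => (twiddle k).re) h2 (by simp only [IExpr.peak, h2]; omega) (by omega) hS
    (fun s hs => hhi s ((hs 2 (by decide)).trans h2)) (by decide) (by
      intro k hk hk2 s m h3 hs hm hv
      refine ⟨twiddleRe_eval h3 (by omega) ?_, ?_⟩
      · rw [hv, if_neg (by omega), hre _ (by omega)]
      · simp only [twiddleRe, signExpr, rootExpr, parityExpr, RExpr.peak, IExpr.peak, IExpr.eval,
          h3]
        omega)
  have hre₁ : ∀ k, k < 2 * M → σ₁.arrs 3 k = (twiddle k).re := fun k hk => by
    rw [v₁ k]
    split_ifs with h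
    · rfl
    · exact hre k (by omega)
  have h2' : σ₁.ints 2 = M := (f₁.ints 2 (by decide)).trans h2
  obtain ⟨σ₂, r₂, f₂, v₂⟩ := fill_runs (θ := θ) (ω := ω) (S := S) (lo := .var 2)
    (hi := .mul (.lit 2) (.var 2)) (a := 4) (e := twiddleIm) (σ := σ₁) M (2 * M) 60
    (fun k => (twiddle k).im) h2' (by simp only [IExpr.peak, h2']; omega) (by omega) hS
    (fun s hs => hhi s ((hs 2 (by decide)).trans h2')) (by decide) (by
      intro k hk hk2 s m h3 hs hm hv
      refine ⟨twiddleIm_eval h3 (by omega) ?_ ?_, ?_⟩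
      · rw [hm 3 (by decide), hre₁ _ (by omega)]
      · rw [hv, if_neg (by omega), f₁.arrs 4 (by decide), him _ (by omega)]
      · simp only [twiddleIm, signExpr, rootExpr, parityExpr, RExpr.peak, IExpr.peak, IExpr.eval,
          h3]
        omega)
  refine ⟨σ₂, (r₁.seq r₂).mono (by omega),
    (f₁.mono subset_rfl (by decide)).trans (f₂.mono subset_rfl (by decide)), fun k hk => ?_⟩
  rw [f₂.arrs 3 (by decide), hre₁ k hk, v₂ k]
  split_ifs with h
  · rfl
  · rw [f₁.arrs 4 (by decide), him k (by omega)]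

/-- Fill `a[N], …, a[M - 1]`, where `N`, `M` are the integer variables `1`, `2`. -/
def fillTail (a : ℕ) (e : RExpr) : Program := fill (.var 1) (.var 2) a e

theorem fillTail_runs {a : ℕ} {e : RExpr} {σ : Store} {N M : ℕ} (K : ℕ) (h1 : σ.ints 1 = N)
    (h2 : σ.ints 2 = M) (hNM : N ≤ M) (hS : M < S) (hK : e.size + 14 ≤ K) (ha : a ∉ e.arrays)
    (he : ∀ k, k < M → e.peak (Function.update σ.ints 3 k) ≤ S) :
    ∃ σ', Runs θ ω S (fillTail a e) σ σ' (K * (M + 2)) ∧ Frame {3} {a} σ σ' ∧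
      ∀ i, σ'.arrs a i = if N ≤ i ∧ i < M then
        e.eval θ (Function.update σ.ints 3 i) σ.arrs else σ.arrs a i :=
  fill_runs_of_notMem N M K h1 (by simp only [IExpr.peak, h1]; omega) hNM hS
    (fun s' hs => ⟨(hs 2 (by decide)).trans h2,
      by simp only [IExpr.peak, hs 2 (by decide), h2]; omega⟩)
    (by simp only [IExpr.size]; omega) ha (fun k _ hk => he k hk)

/-- One Newton step for the reciprocal `u` of the series in the array `a`. -/
def inverseProgram (a u : ℕ) : Program :=
  .seq (mulProgram a u 16) (.seq (mulProgram u 16 17)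
    (fillTail u (.sub (.ofInt (.lit 0)) (.cell 17 (.var 3)))))

/-- `hU` includes zeros from 2^l on, so the array itself is the truncation that the Newton step
needs, and only its second half is written. -/
theorem inverseProgram_runs {G U : PowerSeries ℝ} (hGU : G * U = 1) {a u l : ℕ} (ha : a < 9 ∨ a = 15)
    (hu : u < 9) (hu3 : 4 < u) {σ : Store} (h1 : σ.ints 1 = 2 ^ l) (h2 : σ.ints 2 = 2 ^ (l + 1))
    (hS : 2 * 2 ^ (l + 1) < S) (hT : TwiddleTable σ.arrs (2 * 2 ^ (l + 1)))
    (hG : ∀ i, i < 2 ^ (l + 1) → σ.arrs a i = coeff i G)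
    (hU : ∀ i, σ.arrs u i = if i < 2 ^ l then coeff i U else 0) :
    ∃ σ', Runs θ ω S (inverseProgram a u) σ σ' (12830 * ((2 ^ (l + 1) + 2) * (l + 1 + 1))) ∧
      Frame {3, 4, 5} {9, 10, 11, 12, 13, 14, 16, 17, u} σ σ' ∧
      ∀ i, σ'.arrs u i = if i < 2 ^ (l + 1) then coeff i U else 0 := by
  have hpow : 2 ^ (l + 1) = 2 * 2 ^ l := pow_succ' 2 l
  have hu' : u ∉ ({9, 10, 11, 12, 13, 14} : Finset ℕ) := by
    simp only [Finset.mem_insert, Finset.mem_singleton]; omega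
  have hu16 : u ∉ ({9, 10, 11, 12, 13, 14, 16} : Finset ℕ) := by
    simp only [Finset.mem_insert, Finset.mem_singleton]; omega
  have hu17 : u ∉ ({9, 10, 11, 12, 13, 14, 17} : Finset ℕ) := by
    simp only [Finset.mem_insert, Finset.mem_singleton]; omega
  obtain ⟨σ₁, r₁, f₁, v₁⟩ := mulProgram_runs (θ := θ) (ω := ω) (S := S) (a := a) (b := u) (c := 16)
    (by simp only [Finset.mem_insert, Finset.mem_singleton]; omega) hu' (by decide) (σ := σ)
    (L := l + 1) h2 hS hT
  have h2₁ := (f₁.ints 2 (by decide)).trans h2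
  obtain ⟨σ₂, r₂, f₂, v₂⟩ := mulProgram_runs (θ := θ) (ω := ω) (S := S) (a := u) (b := 16)
    (c := 17) hu' (by decide) (by decide) (σ := σ₁) (L := l + 1) h2₁ hS
    (hT.frame f₁ (by decide) (by decide))
  have h2₂ := (f₂.ints 2 (by decide)).trans h2₁
  obtain ⟨σ₃, r₃, f₃, v₃⟩ := fillTail_runs (θ := θ) (ω := ω) (S := S) (a := u)
    (e := .sub (.ofInt (.lit 0)) (.cell 17 (.var 3))) (σ := σ₂) (N := 2 ^ l) (M := 2 ^ (l + 1)) 30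
    ((f₂.ints 1 (by decide)).trans ((f₁.ints 1 (by decide)).trans h1)) h2₂ (by omega) (by omega)
    (by decide) (by simp [RExpr.arrays]; omega)
    (fun k hk => by
      simp only [RExpr.peak, IExpr.peak, Function.update_self]; omega)
  have hnewton := newton_inverse hGU (N := 2 ^ l) (a := σ.arrs a) (u := σ.arrs u)
    (e := σ₁.arrs 16) (d := σ₂.arrs 17) (by rwa [← hpow]) hU (by rwa [← hpow])
    (by rw [← hpow, ← f₁.arrs u hu16]; exact v₂)
  refine ⟨σ₃, (r₁.seq (r₂.seq r₃)).mono ?_, ?_, fun i => ?_⟩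
  · have hW : (2 ^ (l + 1) + 2) * 1 ≤ (2 ^ (l + 1) + 2) * (l + 1 + 1) :=
      Nat.mul_le_mul_left _ (by omega)
    omega
  · have hsub : ∀ c ∈ ({16, 17, u} : Finset ℕ), ({9, 10, 11, 12, 13, 14, c} : Finset ℕ) ⊆
        {9, 10, 11, 12, 13, 14, 16, 17, u} := by
      intro c hc x hx
      simp only [Finset.mem_insert, Finset.mem_singleton] at hc hx ⊢
      omega
    exact (f₁.mono subset_rfl (hsub 16 (by simp))).trans
      ((f₂.mono subset_rfl (hsub 17 (by simp))).trans (f₃.mono (by decide) (by simp)))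
  · rw [v₃ i, f₂.arrs u hu17, f₁.arrs u hu16, hU]
    by_cases hi : i < 2 ^ (l + 1)
    · rw [if_pos hi]
      by_cases hi' : i < 2 ^ l
      · rw [if_neg (by omega), if_pos hi']
      · rw [if_pos ⟨by omega, hi⟩, ← hnewton i (by omega) (by omega)]
        simp only [RExpr.eval, IExpr.eval, Function.update_self]
        push_cast; ring
    · rw [if_neg (by omega), if_neg (by omega), if_neg hi]

/-- `a[0] := 0`, and fill `a[1], …, a[M - 1]`, where `M` is the integer variable `2`. -/
def fillPositive (a : ℕ) (e : RExpr) : Program :=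
  .seq (.setReal a (.lit 0) (.ofInt (.lit 0))) (fill (.lit 1) (.var 2) a e)

theorem fillPositive_runs {a : ℕ} {e : RExpr} {σ : Store} {M : ℕ} (K : ℕ) (h2 : σ.ints 2 = M)
    (hM : 1 ≤ M) (hS : M < S) (hK : e.size + 14 ≤ K) (ha : a ∉ e.arrays)
    (he : ∀ k, k < M → e.peak (Function.update σ.ints 3 k) ≤ S) :
    ∃ σ', Runs θ ω S (fillPositive a e) σ σ' (K * (M + 3)) ∧ Frame {3} {a} σ σ' ∧
      ∀ i, i < M → σ'.arrs a i = if i = 0 then 0 else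
        e.eval θ (Function.update σ.ints 3 i) σ.arrs := by
  have r₁ : Runs θ ω S (.setReal a (.lit 0) (.ofInt (.lit 0))) σ (σ.putReal a 0 0) 4 := by
    have := Runs.setReal (θ := θ) (ω := ω) (S := S) (σ := σ) a (.lit 0) (.ofInt (.lit 0))
      (Nat.zero_le _) (Nat.zero_le _)
    simp only [IExpr.eval, RExpr.eval, Nat.cast_zero] at this
    exact this
  have f₁ := Frame.putReal σ a 0 0
  obtain ⟨σ₂, r₂, f₂, v₂⟩ := fill_runs_of_notMem (θ := θ) (ω := ω) (S := S) (lo := .lit 1)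
    (hi := .var 2) (a := a) (e := e) (σ := σ.putReal a 0 0) 1 M K rfl
    (by simp only [IExpr.peak]; omega) hM hS
    (fun s' hs => ⟨(hs 2 (by decide)).trans h2,
      by simp only [IExpr.peak, hs 2 (by decide)]; exact (h2.trans_lt hS).le⟩)
    (by simp only [IExpr.size]; omega) ha (fun k _ hk => he k hk)
  refine ⟨σ₂, (r₁.seq r₂).mono (by ring_nf; omega), (f₁.mono (by simp) subset_rfl).trans f₂,
    fun i hi => ?_⟩
  rw [v₂ i]
  split_ifs with h h0 h0
  · omega
  · refine RExpr.eval_congr fun b hb => f₁.arrs b ?_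
    rw [Finset.mem_singleton]
    rintro rfl
    exact ha hb
  · subst h0
    simp [Store.putReal]
  · omega

/-- Double the number of coefficients of the reciprocal of `logBase` in the array `5`. -/
def recipProgram : Program :=
  .seq (fillAll 15 (.div (.ofInt (.lit 1)) (.add (.ofInt (.var 3)) (.ofInt (.lit 1)))))
    (inverseProgram 15 5)

theorem recipProgram_runs {σ : Store} {l : ℕ} (h1 : σ.ints 1 = 2 ^ l)
    (h2 : σ.ints 2 = 2 ^ (l + 1)) (hS : 2 * 2 ^ (l + 1) < S)
    (hT : TwiddleTable σ.arrs (2 * 2 ^ (l + 1)))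
    (hU : ∀ i, σ.arrs 5 i = if i < 2 ^ l then coeff i recipSeries else 0) :
    ∃ σ', Runs θ ω S recipProgram σ σ' (12860 * ((2 ^ (l + 1) + 2) * (l + 1 + 1))) ∧
      Frame {3, 4, 5} {5, 9, 10, 11, 12, 13, 14, 15, 16, 17} σ σ' ∧
      ∀ i, σ'.arrs 5 i = if i < 2 ^ (l + 1) then coeff i recipSeries else 0 := by
  have hpow : 2 ^ (l + 1) = 2 * 2 ^ l := pow_succ' 2 l
  have hpos : 0 < 2 ^ l := by positivity
  obtain ⟨σ₁, r₁, f₁, v₁⟩ := fillAll_runs (θ := θ) (ω := ω) (S := S) (a := 15)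
    (e := .div (.ofInt (.lit 1)) (.add (.ofInt (.var 3)) (.ofInt (.lit 1)))) (σ := σ)
    (2 ^ (l + 1)) 30 h2 (by omega) (by decide) (by simp [RExpr.arrays])
    (fun k hk => by simp only [RExpr.peak, IExpr.peak, Function.update_self]; omega)
  have hG : ∀ i, i < 2 ^ (l + 1) → σ₁.arrs 15 i = coeff i logBase := fun i hi => by
    rw [v₁ i hi, coeff_logBase]
    simp only [RExpr.eval, IExpr.eval, Function.update_self, Nat.cast_one]
  obtain ⟨σ₂, r₂, f₂, v₂⟩ := inverseProgram_runs (θ := θ) (ω := ω)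
    ((mul_comm _ _).trans recipSeries_mul_logBase) (a := 15) (u := 5) (Or.inr rfl) (by decide)
    (by decide) ((f₁.ints 1 (by decide)).trans h1) ((f₁.ints 2 (by decide)).trans h2) hS
    (hT.frame f₁ (by decide) (by decide)) hG (by rw [f₁.arrs 5 (by decide)]; exact hU)
  refine ⟨σ₂, (r₁.seq r₂).mono ?_, (f₁.mono (by decide) (by decide)).trans
    (f₂.mono subset_rfl (by decide)), v₂⟩
  have hW : (2 ^ (l + 1) + 2) * 1 ≤ (2 ^ (l + 1) + 2) * (l + 1 + 1) :=
    Nat.mul_le_mul_left _ (by omega)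
  omega

/-- Compute the coefficients of the logarithmic derivative into the array `15`. -/
def eulerProgram : Program :=
  .seq (.setReal 17 (.lit 0) (.ofInt (.lit 1)))
    (.seq (fill (.lit 1) (.var 2) 17
        (.add (.cell 17 (.sub (.var 3) (.lit 1))) (.cell 5 (.var 3))))
      (fillPositive 15 (.sub (.div (.ofInt (.lit 1)) (.ofInt (.lit 2)))
        (.mul (.param 0) (.cell 17 (.var 3))))))

theorem renewal_succ (n : ℕ) : renewal (n + 1) = renewal n + coeff (n + 1) recipSeries := by
  rw [renewal_eq_sum, renewal_eq_sum, Finset.sum_range_succ]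

/-- Prefix sums of the coefficients of `recipSeries` give `renewal`. The parameter γ enters the
computation of the series only here, as a factor; the sign is that of the exponent -γ in L. -/
theorem eulerProgram_runs {σ : Store} {M : ℕ} (h2 : σ.ints 2 = M) (hM : 2 ≤ M) (hS : M < S)
    (hU : ∀ i, i < M → σ.arrs 5 i = coeff i recipSeries) :
    ∃ σ', Runs θ ω S eulerProgram σ σ' (100 * (M + 2)) ∧ Frame {3} {15, 17} σ σ' ∧
      ∀ i, i < M → σ'.arrs 15 i = coeff i (eulerSeries (-θ 0)) := by
  have r₁ : Runs θ ω S (.setReal 17 (.lit 0) (.ofInt (.lit 1))) σ (σ.putReal 17 0 1) 4 := by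
    have := Runs.setReal (θ := θ) (ω := ω) (S := S) (σ := σ) 17 (.lit 0) (.ofInt (.lit 1))
      (Nat.zero_le _) (by simp only [RExpr.peak, IExpr.peak]; omega)
    simp only [IExpr.eval, RExpr.eval, Nat.cast_one] at this
    exact this
  have f₁ := Frame.putReal σ 17 0 1
  have h2₁ := (f₁.ints 2 (by decide)).trans h2
  obtain ⟨σ₂, r₂, f₂, v₂⟩ := fill_runs (θ := θ) (ω := ω) (S := S) (lo := .lit 1)
    (hi := .var 2) (a := 17) (e := .add (.cell 17 (.sub (.var 3) (.lit 1))) (.cell 5 (.var 3)))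
    (σ := σ.putReal 17 0 1) 1 M 30 renewal rfl (by simp only [IExpr.peak]; omega) (by omega) hS
    (fun s' hs => ⟨(hs 2 (by decide)).trans h2₁,
      by simp only [IExpr.peak, hs 2 (by decide), h2₁]; exact hS.le⟩)
    (by decide) (by
      intro k hk hkM s m h3 hs hm hv
      obtain ⟨k, rfl⟩ : ∃ j, k = j + 1 := ⟨k - 1, by omega⟩
      refine ⟨?_, by simp only [RExpr.peak, IExpr.peak, h3]; omega⟩
      simp only [RExpr.eval, IExpr.eval, h3, Nat.add_sub_cancel]
      rw [hm 5 (by decide), f₁.arrs 5 (by decide), hU _ hkM, hv, renewal_succ]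
      split_ifs with h
      · rfl
      · obtain rfl : k = 0 := by omega
        simp [Store.putReal, renewal_zero])
  have hren : ∀ i, i < M → σ₂.arrs 17 i = renewal i := fun i hi => by
    rw [v₂ i]
    split_ifs with h
    · rfl
    · obtain rfl : i = 0 := by omega
      simp [Store.putReal, renewal_zero]
  obtain ⟨σ₃, r₃, f₃, v₃⟩ := fillPositive_runs (θ := θ) (ω := ω) (S := S) (a := 15)
    (e := .sub (.div (.ofInt (.lit 1)) (.ofInt (.lit 2))) (.mul (.param 0) (.cell 17 (.var 3))))
    (σ := σ₂) (M := M) 30 ((f₂.ints 2 (by decide)).trans h2₁) (by omega) hS (by decide)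
    (by simp [RExpr.arrays])
    (fun k hk => by simp only [RExpr.peak, IExpr.peak, Function.update_self]; omega)
  refine ⟨σ₃, (r₁.seq (r₂.seq r₃)).mono (by omega), (f₁.mono (by simp) (by decide)).trans
    ((f₂.mono subset_rfl (by decide)).trans (f₃.mono subset_rfl (by decide))), fun i hi => ?_⟩
  rw [v₃ i hi, coeff_eulerSeries]
  split_ifs
  · rfl
  · simp only [RExpr.eval, IExpr.eval, Function.update_self, hren i hi]
    push_cast; ring

/-- One Newton step for the series in the array `6`, from its logarithmic derivative in the array
`15` and its reciprocal in the array `7`. -/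
def powerProgram : Program :=
  .seq (mulProgram 15 6 16)
    (.seq (fillAll 15 (.sub (.cell 16 (.var 3)) (.mul (.ofInt (.var 3)) (.cell 6 (.var 3)))))
      (.seq (mulProgram 15 7 16)
        (.seq (fillPositive 15 (.div (.cell 16 (.var 3)) (.ofInt (.var 3))))
          (.seq (mulProgram 6 15 16) (fillTail 6 (.cell 16 (.var 3)))))))

/-- In the notation of `newton_euler`, array 15 holds q, r, t in turn and array 16 holds e, w, p. -/
theorem powerProgram_runs {Q f h : PowerSeries ℝ} (hf : X * d⁄dX ℝ f = Q * f) (hfh : f * h = 1)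
    {σ : Store} {l : ℕ} (h1 : σ.ints 1 = 2 ^ l) (h2 : σ.ints 2 = 2 ^ (l + 1))
    (hS : 2 * 2 ^ (l + 1) < S) (hT : TwiddleTable σ.arrs (2 * 2 ^ (l + 1)))
    (hq : ∀ i, i < 2 ^ (l + 1) → σ.arrs 15 i = coeff i Q)
    (hu : ∀ i, σ.arrs 6 i = if i < 2 ^ l then coeff i f else 0)
    (hv : ∀ i, σ.arrs 7 i = if i < 2 ^ l then coeff i h else 0) :
    ∃ σ', Runs θ ω S powerProgram σ σ' (19320 * ((2 ^ (l + 1) + 2) * (l + 1 + 1))) ∧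
      Frame {3, 4, 5} {6, 9, 10, 11, 12, 13, 14, 15, 16} σ σ' ∧
      ∀ i, σ'.arrs 6 i = if i < 2 ^ (l + 1) then coeff i f else 0 := by
  have hpow : 2 ^ (l + 1) = 2 * 2 ^ l := pow_succ' 2 l
  have hpos : 0 < 2 ^ l := by positivity
  have hMS : 2 ^ (l + 1) < S := by omega
  obtain ⟨σ₁, r₁, f₁, v₁⟩ := mulProgram_runs (θ := θ) (ω := ω) (S := S) (a := 15) (b := 6)
    (c := 16) (by decide) (by decide) (by decide) h2 hS hT
  have t₁ := hT.frame f₁ (by decide) (by decide)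
  have h2₁ := (f₁.ints 2 (by decide)).trans h2
  obtain ⟨σ₂, r₂, f₂, v₂⟩ := fillAll_runs (θ := θ) (ω := ω) (S := S) (a := 15)
    (e := .sub (.cell 16 (.var 3)) (.mul (.ofInt (.var 3)) (.cell 6 (.var 3)))) (σ := σ₁)
    (2 ^ (l + 1)) 30 h2₁ hMS (by decide) (by decide)
    (fun k hk => by simp only [RExpr.peak, IExpr.peak, Function.update_self]; omega)
  have t₂ := t₁.frame f₂ (by decide) (by decide)
  have h2₂ := (f₂.ints 2 (by decide)).trans h2₁
  obtain ⟨σ₃, r₃, f₃, v₃⟩ := mulProgram_runs (θ := θ) (ω := ω) (S := S) (a := 15) (b := 7)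
    (c := 16) (by decide) (by decide) (by decide) h2₂ hS t₂
  have t₃ := t₂.frame f₃ (by decide) (by decide)
  have h2₃ := (f₃.ints 2 (by decide)).trans h2₂
  obtain ⟨σ₄, r₄, f₄, v₄⟩ := fillPositive_runs (θ := θ) (ω := ω) (S := S) (a := 15)
    (e := .div (.cell 16 (.var 3)) (.ofInt (.var 3))) (σ := σ₃) 30 h2₃ (by omega) hMS (by decide)
    (by decide) (fun k hk => by simp only [RExpr.peak, IExpr.peak, Function.update_self]; omega)
  have t₄ := t₃.frame f₄ (by decide) (by decide)
  have h2₄ := (f₄.ints 2 (by decide)).trans h2₃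
  obtain ⟨σ₅, r₅, f₅, v₅⟩ := mulProgram_runs (θ := θ) (ω := ω) (S := S) (a := 6) (b := 15)
    (c := 16) (by decide) (by decide) (by decide) h2₄ hS t₄
  have h2₅ := (f₅.ints 2 (by decide)).trans h2₄
  have h1₅ : σ₅.ints 1 = 2 ^ l := (f₅.ints 1 (by decide)).trans ((f₄.ints 1 (by decide)).trans
    ((f₃.ints 1 (by decide)).trans ((f₂.ints 1 (by decide)).trans
    ((f₁.ints 1 (by decide)).trans h1))))
  obtain ⟨σ₆, r₆, f₆, v₆⟩ := fillTail_runs (θ := θ) (ω := ω) (S := S) (a := 6)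
    (e := .cell 16 (.var 3)) (σ := σ₅) 30 h1₅ h2₅ (by omega) hMS (by decide)
    (by decide) (fun k hk => by simp only [RExpr.peak, IExpr.peak, Function.update_self]; omega)
  have e6₁ : σ₁.arrs 6 = σ.arrs 6 := f₁.arrs 6 (by decide)
  have e6₄ : σ₄.arrs 6 = σ.arrs 6 := (f₄.arrs 6 (by decide)).trans
    ((f₃.arrs 6 (by decide)).trans ((f₂.arrs 6 (by decide)).trans e6₁))
  have e6₅ : σ₅.arrs 6 = σ.arrs 6 := (f₅.arrs 6 (by decide)).trans e6₄
  have e7₂ : σ₂.arrs 7 = σ.arrs 7 := (f₂.arrs 7 (by decide)).trans (f₁.arrs 7 (by decide))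
  have hnewton := newton_euler hf hfh (N := 2 ^ l) hpos (q := σ.arrs 15) (u := σ.arrs 6)
    (v := σ.arrs 7) (e := σ₁.arrs 16) (r := σ₂.arrs 15) (w := σ₃.arrs 16) (t := σ₄.arrs 15)
    (p := σ₅.arrs 16) (by rwa [← hpow]) hu hv (by rwa [← hpow])
    (by
      rw [← hpow]
      intro i hi
      rw [v₂ i hi]
      simp only [RExpr.eval, IExpr.eval, Function.update_self, e6₁])
    (by rw [← hpow, ← e7₂]; exact v₃)
    (by
      rw [← hpow]
      intro i hi
      rw [v₄ i hi]
      simp only [RExpr.eval, IExpr.eval, Function.update_self])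
    (by rw [← hpow, ← e6₄]; exact v₅)
  refine ⟨σ₆, (r₁.seq (r₂.seq (r₃.seq (r₄.seq (r₅.seq r₆))))).mono ?_, ?_, fun i => ?_⟩
  · have hW : (2 ^ (l + 1) + 2) * 1 ≤ (2 ^ (l + 1) + 2) * (l + 1 + 1) :=
      Nat.mul_le_mul_left _ (by omega)
    omega
  · exact (f₁.mono subset_rfl (by decide)).trans ((f₂.mono (by decide) (by decide)).trans
      ((f₃.mono subset_rfl (by decide)).trans ((f₄.mono (by decide) (by decide)).trans
      ((f₅.mono subset_rfl (by decide)).trans (f₆.mono (by decide) (by decide))))))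
  · rw [v₆ i, e6₅, hu]
    by_cases hi : i < 2 ^ (l + 1)
    · rw [if_pos hi]
      by_cases hi' : i < 2 ^ l
      · rw [if_neg (by omega), if_pos hi']
      · rw [if_pos ⟨by omega, hi⟩, ← hnewton i (by omega) (by omega)]
        simp only [RExpr.eval, IExpr.eval, Function.update_self]
    · rw [if_neg (by omega), if_neg (by omega), if_neg hi]

/-- The memory holds everything needed for the first `2 ^ l` values of the noise: the samples, the
twiddle factors, and the first `2 ^ l` coefficients of the reciprocal of `logBase`, of `fSeries s 0`,
of its reciprocal, and of the product with the samples. -/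
structure Prepared (ω : ℕ → ℝ) (s : ℝ) (l : ℕ) (σ : Store) : Prop where
  len : σ.ints 1 = 2 ^ l
  drawn : σ.drawn = 2 ^ l
  noise : ∀ i, i < 2 ^ l → σ.arrs 2 i = ω i
  table : TwiddleTable σ.arrs (2 * 2 ^ l)
  recip : ∀ i, σ.arrs 5 i = if i < 2 ^ l then coeff i recipSeries else 0
  power : ∀ i, σ.arrs 6 i = if i < 2 ^ l then coeff i (fSeries s 0) else 0
  inverse : ∀ i, σ.arrs 7 i = if i < 2 ^ l then coeff i (fInvSeries s) else 0
  product : ∀ i, i < 2 ^ l → σ.arrs 8 i = coeff i (fSeries s 0 * mk ω)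

theorem Prepared.frame {s : ℝ} {l : ℕ} {V A : Finset ℕ} {σ σ' : Store} (h : Prepared ω s l σ)
    (f : Frame V A σ σ') (hV : 1 ∉ V) (hA : ∀ a ∈ Finset.Icc 2 8, a ∉ A) :
    Prepared ω s l σ' where
  len := (f.ints 1 hV).trans h.len
  drawn := f.drawn.trans h.drawn
  noise := by rw [f.arrs 2 (hA 2 (by decide))]; exact h.noise
  table := h.table.frame f (hA 3 (by decide)) (hA 4 (by decide))
  recip := by rw [f.arrs 5 (hA 5 (by decide))]; exact h.recip
  power := by rw [f.arrs 6 (hA 6 (by decide))]; exact h.power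
  inverse := by rw [f.arrs 7 (hA 7 (by decide))]; exact h.inverse
  product := by rw [f.arrs 8 (hA 8 (by decide))]; exact h.product

/-- Double the number of prepared values. -/
def doubleProgram : Program :=
  .seq (.setInt 2 (.mul (.lit 2) (.var 1))) (.seq (sampleFill (.var 1) (.var 2) 2)
    (.seq twiddleProgram (.seq recipProgram (.seq eulerProgram (.seq powerProgram
      (.seq (inverseProgram 6 7) (.seq (mulProgram 6 2 8) (.setInt 1 (.var 2)))))))))

theorem coeff_mk_mul_mk {a b : ℕ → ℝ} {f g : PowerSeries ℝ} {M : ℕ}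
    (ha : ∀ i, i < M → a i = coeff i f) (hb : ∀ i, i < M → b i = coeff i g) {i : ℕ} (hi : i < M) :
    coeff i (mk a * mk b) = coeff i (f * g) := by
  refine eq_coeff_of_X_pow_dvd ?_ hi
  have : mk a * mk b - f * g = (mk a - f) * mk b + f * (mk b - g) := by ring
  rw [this]
  exact dvd_add ((X_pow_dvd_mk_sub ha).mul_right _) ((X_pow_dvd_mk_sub hb).mul_left _)

/-- The twiddle table comes first, since products at the new length need it. The step for f uses 1/f
at the old length, and 1/f is then extended from the longer f. Recomputing the product leaves its
earlier values unchanged, as they are determined by `ω`. -/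
theorem doubleProgram_runs {σ : Store} {l : ℕ} (h : Prepared ω (-θ 0) l σ)
    (hS : 2 * 2 ^ (l + 1) < S) :
    ∃ σ', Runs θ ω S doubleProgram σ σ' (60000 * ((2 ^ (l + 1) + 2) * (l + 1 + 1))) ∧
      Prepared ω (-θ 0) (l + 1) σ' ∧ σ'.ints 0 = σ.ints 0 ∧ σ'.arrs 0 = σ.arrs 0 ∧
      σ'.arrs 18 = σ.arrs 18 := by
  have hpow : 2 ^ (l + 1) = 2 * 2 ^ l := pow_succ' 2 l
  have hpos : 0 < 2 ^ l := by positivity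
  have hMS : 2 ^ (l + 1) < S := by omega
  have r₁ : Runs θ ω S (.setInt 2 (.mul (.lit 2) (.var 1))) σ (σ.putInt 2 (2 ^ (l + 1))) 4 := by
    have := Runs.setInt (θ := θ) (ω := ω) (S := S) (σ := σ) 2 (.mul (.lit 2) (.var 1))
      (by simp only [IExpr.peak, IExpr.eval, h.len]; omega)
    simp only [IExpr.eval, h.len, ← hpow] at this
    exact this
  have f₁ := Frame.putInt σ 2 (2 ^ (l + 1))
  have p₁ := h.frame f₁ (by decide) (by simp)
  have h2₁ : (σ.putInt 2 (2 ^ (l + 1))).ints 2 = 2 ^ (l + 1) := by simp [Store.putInt]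
  generalize σ.putInt 2 (2 ^ (l + 1)) = σ₁ at r₁ f₁ p₁ h2₁
  obtain ⟨σ₂, r₂, i₂, a₂, d₂, v₂⟩ := sampleFill_runs (θ := θ) (ω := ω) (S := S) (lo := .var 1)
    (hi := .var 2) (a := 2) (σ := σ₁) (2 ^ l) (2 ^ (l + 1)) 20 p₁.len
    (by simp only [IExpr.peak, p₁.len]; omega) (by omega) hMS
    (fun s hs => ⟨(hs 2 (by decide)).trans h2₁,
      by simp only [IExpr.peak, hs 2 (by decide), h2₁]; omega⟩) (by decide) p₁.drawn
  have h1₂ : σ₂.ints 1 = 2 ^ l := (i₂ 1 (by decide)).trans p₁.len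
  have h2₂ : σ₂.ints 2 = 2 ^ (l + 1) := (i₂ 2 (by decide)).trans h2₁
  have n₂ : ∀ i, i < 2 ^ (l + 1) → σ₂.arrs 2 i = ω i := fun i hi => by
    rw [v₂ i]
    split_ifs with h'
    · rfl
    · exact p₁.noise i (by omega)
  obtain ⟨σ₃, r₃, f₃, t₃⟩ := twiddleProgram_runs (θ := θ) (ω := ω) (S := S) (σ := σ₂) h2₂
    (by omega) hS (by
      intro k hk
      rw [a₂ 3 (by decide), a₂ 4 (by decide)]
      exact p₁.table k (by omega))
  have h1₃ := (f₃.ints 1 (by decide)).trans h1₂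
  have h2₃ := (f₃.ints 2 (by decide)).trans h2₂
  obtain ⟨σ₄, r₄, f₄, v₄⟩ := recipProgram_runs (θ := θ) (ω := ω) h1₃ h2₃ hS t₃
    (by rw [f₃.arrs 5 (by decide), a₂ 5 (by decide)]; exact p₁.recip)
  have t₄ := t₃.frame f₄ (by decide) (by decide)
  have h1₄ := (f₄.ints 1 (by decide)).trans h1₃
  have h2₄ := (f₄.ints 2 (by decide)).trans h2₃
  obtain ⟨σ₅, r₅, f₅, v₅⟩ := eulerProgram_runs (θ := θ) (ω := ω) h2₄ (by omega) hMS
    (fun i hi => by rw [v₄, if_pos hi])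
  have t₅ := t₄.frame f₅ (by decide) (by decide)
  have h1₅ := (f₅.ints 1 (by decide)).trans h1₄
  have h2₅ := (f₅.ints 2 (by decide)).trans h2₄
  obtain ⟨σ₆, r₆, f₆, v₆⟩ := powerProgram_runs (θ := θ) (ω := ω)
    (X_mul_derivative_fSeries (-θ 0)) (fSeries_mul_fInvSeries (-θ 0)) h1₅ h2₅ hS t₅ v₅
    (by
      rw [f₅.arrs 6 (by decide), f₄.arrs 6 (by decide), f₃.arrs 6 (by decide), a₂ 6 (by decide)]
      exact p₁.power)
    (by
      rw [f₅.arrs 7 (by decide), f₄.arrs 7 (by decide), f₃.arrs 7 (by decide), a₂ 7 (by decide)]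
      exact p₁.inverse)
  have t₆ := t₅.frame f₆ (by decide) (by decide)
  have h1₆ := (f₆.ints 1 (by decide)).trans h1₅
  have h2₆ := (f₆.ints 2 (by decide)).trans h2₅
  obtain ⟨σ₇, r₇, f₇, v₇⟩ := inverseProgram_runs (θ := θ) (ω := ω)
    (fSeries_mul_fInvSeries (-θ 0)) (a := 6) (u := 7) (by decide) (by decide) (by decide) h1₆ h2₆
    hS t₆ (fun i hi => by rw [v₆, if_pos hi])
    (by
      rw [f₆.arrs 7 (by decide), f₅.arrs 7 (by decide), f₄.arrs 7 (by decide),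
        f₃.arrs 7 (by decide), a₂ 7 (by decide)]
      exact p₁.inverse)
  have t₇ := t₆.frame f₇ (by decide) (by decide)
  have h2₇ := (f₇.ints 2 (by decide)).trans h2₆
  obtain ⟨σ₈, r₈, f₈, v₈⟩ := mulProgram_runs (θ := θ) (ω := ω) (S := S) (a := 6) (b := 2)
    (c := 8) (by decide) (by decide) (by decide) h2₇ hS t₇
  have h2₈ := (f₈.ints 2 (by decide)).trans h2₇
  have r₉ : Runs θ ω S (.setInt 1 (.var 2)) σ₈ (σ₈.putInt 1 (2 ^ (l + 1))) 2 := by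
    have := Runs.setInt (θ := θ) (ω := ω) (S := S) (σ := σ₈) 1 (.var 2)
      (by simp only [IExpr.peak, h2₈]; omega)
    simp only [IExpr.eval, h2₈] at this
    exact this
  have f₉ := Frame.putInt σ₈ 1 (2 ^ (l + 1))
  have f : Frame {1, 3, 4, 5} (Finset.Icc 3 17) σ₂ (σ₈.putInt 1 (2 ^ (l + 1))) :=
    (f₃.mono (by decide) (by decide)).trans <| (f₄.mono (by decide) (by decide)).trans <|
      (f₅.mono (by decide) (by decide)).trans <| (f₆.mono (by decide) (by decide)).trans <|
      (f₇.mono (by decide) (by decide)).trans <| (f₈.mono (by decide) (by decide)).trans <|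
      f₉.mono (by decide) (by decide)
  have e₇ : σ₇.arrs 2 = σ₂.arrs 2 := (f₇.arrs 2 (by decide)).trans <|
    (f₆.arrs 2 (by decide)).trans <| (f₅.arrs 2 (by decide)).trans <|
    (f₄.arrs 2 (by decide)).trans <| f₃.arrs 2 (by decide)
  have e₇' : σ₇.arrs 6 = σ₆.arrs 6 := f₇.arrs 6 (by decide)
  refine ⟨_, (r₁.seq <| r₂.seq <| r₃.seq <| r₄.seq <| r₅.seq <| r₆.seq <| r₇.seq <|
    r₈.seq r₉).mono ?_, ⟨?_, ?_, ?_, ?_, ?_, ?_, ?_, ?_⟩, ?_, ?_, ?_⟩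
  · have hW : (2 ^ (l + 1) + 2) * 1 ≤ (2 ^ (l + 1) + 2) * (l + 1 + 1) :=
      Nat.mul_le_mul_left _ (by omega)
    omega
  · simp [Store.putInt]
  · exact f.drawn.trans d₂
  · rw [f.arrs 2 (by decide)]; exact n₂
  · exact (t₇.frame f₈ (by decide) (by decide)).frame f₉ (by decide) (by decide)
  · rw [f₉.arrs 5 (by decide), f₈.arrs 5 (by decide), f₇.arrs 5 (by decide),
      f₆.arrs 5 (by decide), f₅.arrs 5 (by decide)]
    exact v₄
  · rw [f₉.arrs 6 (by decide), f₈.arrs 6 (by decide), e₇']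
    exact v₆
  · rw [f₉.arrs 7 (by decide), f₈.arrs 7 (by decide)]
    exact v₇
  · intro i hi
    rw [f₉.arrs 8 (by decide), v₈ i hi]
    refine coeff_mk_mul_mk (fun j hj => ?_) (fun j hj => ?_) hi
    · rw [e₇', v₆, if_pos hj]
    · rw [e₇, n₂ j hj, coeff_mk]
  · rw [f.ints 0 (by decide), i₂ 0 (by decide), f₁.ints 0 (by decide)]
  · rw [f.arrs 0 (by decide), a₂ 0 (by decide), f₁.arrs 0 (by decide)]
  · rw [f.arrs 18 (by decide), a₂ 18 (by decide), f₁.arrs 18 (by decide)]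

end Doubling

/-! ## The streaming program -/

section Streaming

open PowerSeries

variable {θ ω : ℕ → ℝ} {S : ℕ}

/-- Prepare one value of the noise, starting from the blank memory. -/
def startProgram : Program :=
  .seq (.setInt 1 (.lit 1)) (.seq (.sample 2 (.lit 0))
    (.seq (.setReal 3 (.lit 0) (.ofInt (.lit 1))) (.seq (.setReal 4 (.lit 1) (.ofInt (.lit 1)))
      (.seq (.setReal 5 (.lit 0) (.ofInt (.lit 1))) (.seq (.setReal 6 (.lit 0) (.ofInt (.lit 1)))
        (.seq (.setReal 7 (.lit 0) (.ofInt (.lit 1))) (.setReal 8 (.lit 0) (.cell 2 (.lit 0)))))))))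

/-- All the series start with 1, and in blank memory the twiddle factors 1 and i require one written
cell each. -/
theorem startProgram_runs (hS : 1 ≤ S) (s v : ℝ) :
    ∃ σ', Runs θ ω S startProgram (Store.init.putReal 0 0 v) σ' 40 ∧ Prepared ω s 0 σ' ∧
      σ'.ints 0 = 0 ∧ σ'.arrs 0 0 = v ∧ σ'.arrs 18 0 = 0 := by
  refine ⟨_, ((Runs.setInt _ _ ?_).seq <| (Runs.sample _ _ ?_).seq <|
    (Runs.setReal _ _ _ ?_ ?_).seq <| (Runs.setReal _ _ _ ?_ ?_).seq <|
    (Runs.setReal _ _ _ ?_ ?_).seq <| (Runs.setReal _ _ _ ?_ ?_).seq <|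
    (Runs.setReal _ _ _ ?_ ?_).seq <| Runs.setReal _ _ _ ?_ ?_).mono ?_,
    ⟨?_, ?_, ?_, ?_, ?_, ?_, ?_, ?_⟩, ?_, ?_, ?_⟩
  all_goals try first | exact hS | exact Nat.zero_le _ | decide
  · rfl
  · rfl
  · intro i hi
    obtain rfl : i = 0 := by simpa using hi
    simp [Store.putInt, Store.putReal, Store.draw, Store.init, IExpr.eval]
  · intro k hk
    have hk : k < 2 := by simpa using hk
    interval_cases k
    · rw [twiddle_zero]
      apply Complex.ext <;>
        simp [Store.putInt, Store.putReal, Store.draw, Store.init, IExpr.eval, RExpr.eval]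
    · rw [twiddle_one]
      apply Complex.ext <;>
        simp [Store.putInt, Store.putReal, Store.draw, Store.init, IExpr.eval, RExpr.eval]
  · intro i
    by_cases hi : i = 0
    · subst hi
      simp [Store.putInt, Store.putReal, Store.draw, Store.init, IExpr.eval, RExpr.eval,
        constantCoeff_recipSeries]
    · simp [Store.putInt, Store.putReal, Store.draw, Store.init, IExpr.eval, RExpr.eval, hi]
  · intro i
    by_cases hi : i = 0
    · subst hi
      simp [Store.putInt, Store.putReal, Store.draw, Store.init, IExpr.eval, RExpr.eval,
        constantCoeff_fSeries]
    · simp [Store.putInt, Store.putReal, Store.draw, Store.init, IExpr.eval, RExpr.eval, hi]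
  · intro i
    by_cases hi : i = 0
    · subst hi
      have h := congrArg constantCoeff (fSeries_mul_fInvSeries s)
      rw [map_mul, constantCoeff_fSeries, one_mul, map_one] at h
      simp [Store.putInt, Store.putReal, Store.draw, Store.init, IExpr.eval, RExpr.eval, h]
    · simp [Store.putInt, Store.putReal, Store.draw, Store.init, IExpr.eval, RExpr.eval, hi]
  · intro i hi
    obtain rfl : i = 0 := by simpa using hi
    simp [Store.putInt, Store.putReal, Store.draw, Store.init, IExpr.eval, RExpr.eval,
      constantCoeff_fSeries]
  · simp [Store.putInt, Store.putReal, Store.draw, Store.init]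
  · simp [Store.putInt, Store.putReal, Store.draw, Store.init]
  · simp [Store.putInt, Store.putReal, Store.draw, Store.init]

/-- One time step: prepare the noise, add the datum in `0[0]` to the running total in `18[0]`, and
put the noisy total into `1[0]`.  The integer variable `0` counts the time steps. -/
def streamProgram : Program :=
  .seq (.ite (.var 0) (.lit 1) startProgram .skip)
    (.seq (.ite (.var 0) (.var 1) .skip doubleProgram)
      (.seq (.setReal 18 (.lit 0) (.add (.cell 18 (.lit 0)) (.cell 0 (.lit 0))))
        (.seq (.setReal 1 (.lit 0) (.add (.cell 18 (.lit 0))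
            (.mul (.mul (.param 2) (.param 3)) (.cell 8 (.var 0)))))
          (.setInt 0 (.add (.var 0) (.lit 1))))))

/-- The memory after `t` time steps, with `2 ^ l` prepared values of the noise. -/
def StepState (θ x ω : ℕ → ℝ) (t l : ℕ) (σ : Store) : Prop :=
  (t = 0 ∧ l = 0 ∧ σ = Store.init) ∨
    (0 < t ∧ σ.ints 0 = t ∧ Prepared ω (-θ 0) l σ ∧ t ≤ 2 ^ l ∧ 2 ^ l ≤ 2 * t ∧
      σ.arrs 18 0 = ∑ i ∈ Finset.range t, x i)

/-- The time that has been paid for when `2 ^ l` values of the noise are prepared. -/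
def potential (l : ℕ) : ℕ := 240000 * (2 ^ l * (l + 1))

theorem start_runs {x : ℕ → ℝ} {t l : ℕ} {σ : Store} (h : StepState θ x ω t l σ)
    (hS : 4 * t + 10 ≤ S) :
    ∃ σ', Runs θ ω S (.ite (.var 0) (.lit 1) startProgram .skip) (σ.putReal 0 0 (x t)) σ' 50 ∧
      Prepared ω (-θ 0) l σ' ∧ σ'.ints 0 = t ∧ t ≤ 2 ^ l ∧ 2 ^ l ≤ 2 * t + 1 ∧
      σ'.arrs 0 0 = x t ∧ σ'.arrs 18 0 = ∑ i ∈ Finset.range t, x i := by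
  rcases h with ⟨rfl, rfl, rfl⟩ | ⟨ht, h0, hp, htl, hlt, hx⟩
  · obtain ⟨σ', r, hp, h0, hx, hs⟩ := startProgram_runs (θ := θ) (ω := ω) (S := S) (by omega)
      (-θ 0) (x 0)
    refine ⟨σ', (Runs.ite_true ?_ ?_ ?_ r).mono (by decide), hp, h0, by simp, by simp, hx,
      by simpa using hs⟩
    · exact Nat.zero_le _
    · simp only [IExpr.peak]; omega
    · exact Nat.zero_lt_one
  · have f := Frame.putReal σ 0 0 (x t)
    have h0' := (f.ints 0 (by simp)).trans h0
    refine ⟨_, (Runs.ite_false ?_ ?_ ?_ (Runs.skip _)).mono (by decide),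
      hp.frame f (by simp) (by decide), h0', htl, by omega, ?_, ?_⟩
    · simp only [IExpr.peak, h0']; omega
    · simp only [IExpr.peak]; omega
    · simp only [IExpr.eval, h0']; omega
    · simp [Store.putReal]
    · rw [f.arrs 18 (by decide)]; exact hx

/-- Doubling occurs only when t = 2^l. Then the potential grows by 240000 · 2^l (l + 3), which
covers the cost of `doubleProgram`, and the largest size needed is 2 · 2^(l+1) = 4t, below the bound
on `S`. -/
theorem extend_runs {t l : ℕ} {σ : Store} (hp : Prepared ω (-θ 0) l σ) (h0 : σ.ints 0 = t)
    (htl : t ≤ 2 ^ l) (hlt : 2 ^ l ≤ 2 * t + 1) (hS : 4 * t + 10 ≤ S) :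
    ∃ σ' l' T, Runs θ ω S (.ite (.var 0) (.var 1) .skip doubleProgram) σ σ' T ∧
      T + potential l ≤ 10 + potential l' ∧ Prepared ω (-θ 0) l' σ' ∧ σ'.ints 0 = t ∧
      t + 1 ≤ 2 ^ l' ∧ 2 ^ l' ≤ 2 * (t + 1) ∧ σ'.arrs 0 = σ.arrs 0 ∧
      σ'.arrs 18 = σ.arrs 18 := by
  have hpow : 2 ^ (l + 1) = 2 * 2 ^ l := pow_succ' 2 l
  have hk₁ : (IExpr.var 0).peak σ.ints ≤ S := by simp only [IExpr.peak, h0]; omega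
  have hk₂ : (IExpr.var 1).peak σ.ints ≤ S := by simp only [IExpr.peak, hp.len]; omega
  have hpos : 1 ≤ 2 ^ l := Nat.one_le_two_pow
  have heq : t = 2 ^ l ∨ t < 2 ^ l := by omega
  rcases heq with heq | hlt'
  · obtain ⟨σ', r, hp', h0', ha, ha'⟩ := doubleProgram_runs hp (S := S) (by omega)
    refine ⟨σ', l + 1, _, Runs.ite_false hk₁ hk₂ ?_ r, ?_, hp', h0'.trans h0, by omega, by omega,
      ha, ha'⟩
    · simp only [IExpr.eval, h0, hp.len]; omega
    · simp only [potential, IExpr.size, hpow]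
      have h3 : 1 * l ≤ 2 ^ l * l := Nat.mul_le_mul_right _ hpos
      ring_nf
      ring_nf at h3
      omega
  · refine ⟨σ, l, _, Runs.ite_true hk₁ hk₂ ?_ (Runs.skip _), ?_, hp, h0, hlt', by omega, rfl, rfl⟩
    · simp only [IExpr.eval, h0, hp.len]; omega
    · simp only [IExpr.size]; omega

theorem streamProgram_runs {x : ℕ → ℝ} {t l : ℕ} {σ : Store} (h : StepState θ x ω t l σ) :
    ∃ σ' l' T, Exec θ ω (4 * t + 10) streamProgram (σ.putReal 0 0 (x t)) σ' T ∧
      T + potential l ≤ 100 + potential l' ∧ StepState θ x ω (t + 1) l' σ' ∧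
      σ'.arrs 1 0 = ∑ i ∈ Finset.range (t + 1), x i +
        θ 2 * θ 3 * coeff t (fSeries (-θ 0) 0 * mk ω) := by
  obtain ⟨σ₁, r₁, p₁, h₁, htl, hlt, a₁, b₁⟩ := start_runs h le_rfl
  obtain ⟨σ₂, l', T₂, r₂, hT, p₂, h₂, htl', hlt', a₂, b₂⟩ := extend_runs p₁ h₁ htl hlt le_rfl
  have r₃ : Runs θ ω (4 * t + 10)
      (.setReal 18 (.lit 0) (.add (.cell 18 (.lit 0)) (.cell 0 (.lit 0)))) σ₂
      (σ₂.putReal 18 0 (∑ i ∈ Finset.range (t + 1), x i)) 7 := by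
    have := Runs.setReal (θ := θ) (ω := ω) (S := 4 * t + 10) (σ := σ₂) 18 (.lit 0)
      (.add (.cell 18 (.lit 0)) (.cell 0 (.lit 0))) (Nat.zero_le _)
      (by simp only [RExpr.peak, IExpr.peak]; omega)
    simp only [IExpr.eval, RExpr.eval, a₂, b₂, a₁, b₁, ← Finset.sum_range_succ] at this
    exact this
  have f₃ := Frame.putReal σ₂ 18 0 (∑ i ∈ Finset.range (t + 1), x i)
  have p₃ := p₂.frame f₃ (by simp) (by decide)
  have h₃ := (f₃.ints 0 (by simp)).trans h₂
  have b₃ : (σ₂.putReal 18 0 (∑ i ∈ Finset.range (t + 1), x i)).arrs 18 0 =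
      ∑ i ∈ Finset.range (t + 1), x i := by simp [Store.putReal]
  generalize σ₂.putReal 18 0 (∑ i ∈ Finset.range (t + 1), x i) = σ₃ at r₃ f₃ p₃ h₃ b₃
  set out := ∑ i ∈ Finset.range (t + 1), x i + θ 2 * θ 3 * coeff t (fSeries (-θ 0) 0 * mk ω)
    with hout
  have r₄ : Runs θ ω (4 * t + 10)
      (.setReal 1 (.lit 0) (.add (.cell 18 (.lit 0))
        (.mul (.mul (.param 2) (.param 3)) (.cell 8 (.var 0))))) σ₃ (σ₃.putReal 1 0 out) 20 := by
    have := Runs.setReal (θ := θ) (ω := ω) (S := 4 * t + 10) (σ := σ₃) 1 (.lit 0)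
      (.add (.cell 18 (.lit 0)) (.mul (.mul (.param 2) (.param 3)) (.cell 8 (.var 0))))
      (Nat.zero_le _) (by simp only [RExpr.peak, IExpr.peak, h₃]; omega)
    simp only [IExpr.eval, RExpr.eval, h₃, b₃, p₃.product t htl', ← hout] at this
    exact this.mono (by decide)
  have f₄ := Frame.putReal σ₃ 1 0 out
  have p₄ := p₃.frame f₄ (by simp) (by decide)
  have h₄ := (f₄.ints 0 (by simp)).trans h₃
  have o₄ : (σ₃.putReal 1 0 out).arrs 1 0 = out := by simp [Store.putReal]
  have b₄ := (congrFun (f₄.arrs 18 (by decide)) 0).trans b₃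
  generalize σ₃.putReal 1 0 out = σ₄ at r₄ f₄ p₄ h₄ o₄ b₄
  have r₅ : Runs θ ω (4 * t + 10) (.setInt 0 (.add (.var 0) (.lit 1))) σ₄ (σ₄.putInt 0 (t + 1))
      4 := by
    have := Runs.setInt (θ := θ) (ω := ω) (S := 4 * t + 10) (σ := σ₄) 0 (.add (.var 0) (.lit 1))
      (by simp only [IExpr.peak, IExpr.eval, h₄]; omega)
    simp only [IExpr.eval, h₄] at this
    exact this
  have f₅ := Frame.putInt σ₄ 0 (t + 1)
  obtain ⟨T, hT', hr⟩ := r₁.seq (r₂.seq (r₃.seq (r₄.seq r₅)))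
  refine ⟨_, l', T, hr, by omega, Or.inr ⟨by omega, by simp [Store.putInt],
    p₄.frame f₅ (by decide) (by simp), htl', hlt', ?_⟩, ?_⟩
  · rw [f₅.arrs 18 (by simp)]; exact b₄
  · rw [f₅.arrs 1 (by simp)]; exact o₄

theorem logMatrixMechanism_eq_coeff (γ C : ℝ) (x ω : ℕ → ℝ) (t : ℕ) :
    logMatrixMechanism γ 0 C x ω t = ∑ i ∈ Finset.range (t + 1), x i +
      C * sensitivity γ 0 * coeff t (fSeries (-γ) 0 * mk ω) := by
  rw [logMatrixMechanism, partialSum, mul_comm (fSeries _ _), ← sum_ltToep_mul, Finset.mul_sum,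
    neg_zero]
  congr 1
  exact Finset.sum_congr rfl fun j _ => by ring

theorem potential_le {t l : ℕ} (ht : 1 ≤ t) (hl : 2 ^ l ≤ 2 * (t + 1)) :
    (potential l : ℝ) ≤ 2880000 * (((t : ℝ) + 1) * Real.log ((t : ℝ) + 1)) := by
  have ht' : (1 : ℝ) ≤ t := by exact_mod_cast ht
  have hl' : (2 : ℝ) ^ l ≤ 2 * ((t : ℝ) + 1) := by exact_mod_cast hl
  have h2 := Real.log_two_gt_d9
  have hmono : Real.log 2 ≤ Real.log ((t : ℝ) + 1) := Real.log_le_log (by norm_num) (by linarith)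
  have h3 : l * Real.log 2 ≤ Real.log 2 + Real.log ((t : ℝ) + 1) := by
    rw [← Real.log_pow, ← Real.log_mul (by norm_num) (by linarith)]
    exact Real.log_le_log (by positivity) hl'
  -- From l/2 ≤ l log 2 ≤ 2 log(t + 1) and 1 ≤ 2 log(t + 1), both using log 2 > 1/2.
  have h4 : (l : ℝ) + 1 ≤ 6 * Real.log ((t : ℝ) + 1) := by
    have h5 : (l : ℝ) * (1 / 2) ≤ l * Real.log 2 :=
      mul_le_mul_of_nonneg_left (by linarith) (by positivity)
    linarith
  have h6 : (2 : ℝ) ^ l * ((l : ℝ) + 1) ≤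
      2 * ((t : ℝ) + 1) * (6 * Real.log ((t : ℝ) + 1)) :=
    mul_le_mul hl' h4 (by positivity) (by positivity)
  rw [potential]
  push_cast
  linarith

theorem streams_streamProgram : ∃ K : ℝ, 0 ≤ K ∧ ∀ γ C : ℝ,
    streamProgram.Streams (mechanismParams γ 0 C) (logMatrixMechanism γ 0 C) K := by
  set a := streamProgram.vars.card
  set b := streamProgram.arrays.card
  -- Memory is a + b(4t + 11). For the time, 2880000 comes from the potential and 200 from the 100
  -- operations per step, since log(t + 1) ≥ 1/2.
  refine ⟨(a : ℝ) + 11 * b + 2880200, by positivity, fun γ C x ω => ?_⟩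
  set θ := mechanismParams γ 0 C
  have : Nonempty Store := ⟨Store.init⟩
  choose! next nextLevel time hrun htime hstate hout using
    fun (t l : ℕ) (σ : Store) (h : StepState θ x ω t l σ) => streamProgram_runs h
  let q : ℕ → Store × ℕ := fun t =>
    Nat.rec (Store.init, 0) (fun t q => (next t q.2 q.1, nextLevel t q.2 q.1)) t
  have hq : ∀ t, StepState θ x ω t (q t).2 (q t).1 := by
    intro t
    induction t with
    | zero => exact Or.inl ⟨rfl, rfl, rfl⟩
    | succ t ih => exact hstate t _ _ ih
  refine ⟨fun t => (q t).1, fun t => 4 * t + 10, fun t => time t (q t).2 (q t).1, rfl,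
    fun t => hrun t _ _ (hq t), fun t => ?_, fun t => ?_, fun t ht => ?_⟩
  · rw [logMatrixMechanism_eq_coeff]
    exact hout t _ _ (hq t)
  · rw [Program.memory]
    push_cast
    have ha : (0 : ℝ) ≤ a := by positivity
    have hb : (0 : ℝ) ≤ b := by positivity
    have ht : (0 : ℝ) ≤ t := by positivity
    nlinarith [mul_nonneg ha ht, mul_nonneg hb ht]
  · have htotal : ∀ n, ∑ s ∈ Finset.range n, time s (q s).2 (q s).1 ≤
        100 * n + potential (q n).2 := by
      intro n
      induction n with
      | zero => simp
      | succ n ih =>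
        have h := htime n _ _ (hq n)
        have hn : (q (n + 1)).2 = nextLevel n (q n).2 (q n).1 := rfl
        rw [Finset.sum_range_succ, hn]
        omega
    have hpot : (potential (q (t + 1)).2 : ℝ) ≤
        2880000 * (((t : ℝ) + 1) * Real.log ((t : ℝ) + 1)) := by
      refine potential_le ht ?_
      rcases hq (t + 1) with h | h
      · omega
      · exact h.2.2.2.2.1
    clear_value a b
    have hcast : ((∑ s ∈ Finset.range (t + 1), time s (q s).2 (q s).1 : ℕ) : ℝ) ≤
        100 * ((t : ℝ) + 1) + potential (q (t + 1)).2 := by exact_mod_cast htotal (t + 1)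
    have ht' : (1 : ℝ) ≤ t := by exact_mod_cast ht
    have h2 := Real.log_two_gt_d9
    have hlog : 1 / 2 ≤ Real.log ((t : ℝ) + 1) :=
      le_trans (by linarith) (Real.log_le_log (by norm_num) (by linarith : (2 : ℝ) ≤ (t : ℝ) + 1))
    have hprod : ((t : ℝ) + 1) * (1 / 2) ≤ ((t : ℝ) + 1) * Real.log ((t : ℝ) + 1) :=
      mul_le_mul_of_nonneg_left hlog (by positivity)
    have hab : (0 : ℝ) ≤ (a + 11 * b) * (((t : ℝ) + 1) * Real.log ((t : ℝ) + 1)) :=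
      mul_nonneg (by positivity) (by linarith)
    linarith

end Streaming

end ContinualCounting

/-! ### Assembly. -/

theorem corollary1 :
    ∃ (C : ℝ → ℝ → ℝ) (p : ContinualCounting.Program),
      (∀ ε δ : ℝ, 0 < ε → 0 < δ → 0 < C ε δ) ∧
      (∀ ε₀ δ₀ : ℝ, 0 < ε₀ → 0 < δ₀ → δ₀ < 1 → ∃ K : ℝ, ∀ ε δ : ℝ,
        0 < ε → ε ≤ ε₀ → 0 < δ → δ ≤ δ₀ →
          C ε δ ≤ K * (ε⁻¹ * Real.sqrt (Real.log (1 / δ)))) ∧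
      ∀ α : ℝ, 0 < α → ∃ γ η : ℝ, γ < -1 / 2 ∧
        ContinualCounting.colNorm
          (ContinualCounting.ltToep (ContinualCounting.fSeries γ η)) ≠ ⊤ ∧
        ∃ K : ℝ, ∀ ε δ : ℝ, 0 < ε → 0 < δ →
          p.Streams (ContinualCounting.mechanismParams γ η (C ε δ))
            (ContinualCounting.logMatrixMechanism γ η (C ε δ)) K ∧
          ContinualCounting.IsContinualDP ContinualCounting.gaussianTape
            (ContinualCounting.logMatrixMechanism γ η (C ε δ)) ε δ ∧
          ∃ v : ℕ → ℝ≥0,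
            (∀ (x : ℕ → ℝ) (t : ℕ),
              Measure.map
                (fun ω => ContinualCounting.logMatrixMechanism γ η (C ε δ) x ω t -
                  ContinualCounting.partialSum x t)
                ContinualCounting.gaussianTape = gaussianReal 0 (v t)) ∧
            ∀ t : ℕ, 1 ≤ t →
              Real.sqrt (v t) ≤ K * (C ε δ * Real.log ((t : ℝ) + 1) ^ (1 + α)) := by
  open ContinualCounting in
  obtain ⟨K₁, hK₁, hstreams⟩ := streams_streamProgram
  refine ⟨noiseMultiplier, streamProgram, fun ε δ hε _ => noiseMultiplier_pos hε δ,
    fun ε₀ δ₀ _ hδ₀ hδ₀' => ⟨_, fun ε δ hε hε' hδ hδ' =>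
      noiseMultiplier_le hδ₀ hδ₀' hε hε' hδ hδ'⟩, fun α hα => ?_⟩
  have hγ : -1 / 2 - α < -1 / 2 := by linarith
  obtain ⟨K₂, hK₂, hnoise⟩ := sqrt_noiseVariance_le hα
  -- The power η is not needed: γ alone gives the noise exponent (2(-γ) + 1)/2 = 1 + α. A single
  -- constant must serve resources and noise, hence the sum.
  refine ⟨-1 / 2 - α, 0, hγ, colNorm_fSeries_ne_top hγ, K₁ + K₂, fun ε δ hε hδ =>
    ⟨?_, isContinualDP_logMatrixMechanism hγ hε hδ,
      noiseVariance (-1 / 2 - α) (noiseMultiplier ε δ), fun x t => map_noise _ _ x t,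
      fun t ht => ?_⟩⟩
  · intro x ω
    obtain ⟨σ, S, τ, h0, h1, h2, h3, h4⟩ := hstreams (-1 / 2 - α) (noiseMultiplier ε δ) x ω
    refine ⟨σ, S, τ, h0, h1, h2, fun t => (h3 t).trans ?_, fun t ht => (h4 t ht).trans ?_⟩
    · exact mul_le_mul_of_nonneg_right (by linarith) (by positivity)
    · exact mul_le_mul_of_nonneg_right (by linarith)
        (mul_nonneg (by positivity) (Real.log_nonneg (by linarith [Nat.cast_nonneg (α := ℝ) t])))
  · refine (hnoise _ (noiseMultiplier_pos hε δ) t ht).trans ?_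
    refine mul_le_mul_of_nonneg_right (by linarith) ?_
    exact mul_nonneg (noiseMultiplier_pos hε δ).le
      (Real.rpow_nonneg (Real.log_nonneg (by linarith [Nat.cast_nonneg (α := ℝ) t])) _)
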